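/- Let $\tau\in i\mathbb R_{>0}$, $p=e^{2\pi i\tau}\in(0,1)$, $(p;p)_\infty=\prod_{j\ge 1}(1-p^j)$, and $$\theta(x)=i\sum_{n\in\mathbb Z}(-1)^n e^{\pi i\tau(n-1/2)^2+\pi i(2n-1)x},$$ with the conventions $\theta(c\pm d)=\theta(c+d)\theta(c-d)$, $\theta(x,y)=\theta(x)\theta(y)$. Let $N\ge 0$ be an integer and let $\eta\in\mathbb R_N\cup\mathbb I_N$, where $$\mathbb R_N=\Big\{\eta\in\mathbb R:\ |\eta|<\tfrac1{2(N+1)}\Big\},\qquad \mathbb I_N=\Big\{\eta\in i\mathbb R:\ |\eta|<\tfrac{\operatorname{Im}\tau}{2(N+1)}\Big\}.$$ Write $[x]=\theta(2\eta x)$, $[x]_k=[x][x+1]\cdots[x+k-1]$ and $[x,y]_k=[x]_k[y]_k$. Let $\Theta_N$ be the space of entire functions $f$ with $f(x+1)=f(x)$, $f(x+\tau)=e^{-2\pi iN(2x+\tau)}f(x)$ and $f(-x)=f(x)$. For $0\le k\le N$ and $a,b\in\mathbb C$ let $$e_k^N(x;a,b)=\prod_{j=0}^{k-1}\theta(a\pm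 x+2j\eta)\prod_{j=0}^{N-k-1}\theta(b\pm x+2j\eta),$$ and define $(\sigma f)(x)=e^{2\pi iN(\frac14+\frac\tau4+x)}f(x+\frac12+\frac\tau2)$. Let $$\langle f,g\rangle=\iint_{\mathbb C/(\mathbb Z+\tau\mathbb Z)}f(u)\,\overline{g(u)}\,M(u,\bar u)\,dx\,dy\quad(u=x+iy),$$ $$M(u,v)=\frac{\theta(2u)\theta(2v)}{e^{2\pi iu(N+2)}\prod_{k=0}^{N+1}\theta(u\pm v+(2k-N-1)\eta+\frac12+\frac\tau2)},$$ the integral being taken over the rectangle $0\le x<1$, $0\le y<\operatorname{Im}\tau$. **Theorem.** Let $a_1,a_2\in\mathbb C$ be such that the functions $e_k(x)=e_k^N(x;a_1-\tfrac12N\eta,a_2-\tfrac12N\eta)$, $k=0,\dots,N$, form a basis of $\Theta_N$. Let $$f_k(x)=\sigma e_k^N(x;\mp\bar a_2-\tfrac12N\eta+\eta,\mp\bar a_1-\tfrac12N\eta+\eta),$$ with the minus sign if $\eta\in\mathbb R_N$ and the plus sign if $\eta\in\mathbb I_N$ (either sign if $\eta=0$). Then $(f_k)_{k=0}^N$ is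 a basis of $\Theta_N$, the integrals $\langle e_k,f_l\rangle$ converge absolutely, and for $0\le k,l\le N$ $$\langle e_k,f_l\rangle=C\,\Gamma_k\,\delta_{kl},\qquad C\,\Gamma_k\neq 0,$$ where, with $\lambda=(a_1-a_2-2N\eta)/2\eta$, $$C=\frac{2\eta\,p^{3/8}}{\theta(2(N+1)\eta)\,(p;p)_\infty^3},$$ $$\Gamma_k=e^{\pi iN(\tau-1)/2}\,\frac{[\lambda]}{[\lambda+2k]}\,\frac{[1,\lambda+N+1]_k}{[-N,\lambda]_k}\,[\lambda+1,(a_1+a_2-N\eta)/2\eta]_N .$$ If $\eta\ne0$ and the denominator $[\lambda+2k]\,[-N,\lambda]_k$ vanishes, $\Gamma_k$ is understood after cancelling common factors, that is, as $$\Gamma_k=e^{\pi iN(\tau-1)/2}\,\frac{[1]_k}{[-N]_k}\prod_{0\le j\le N,\ j\ne k}[\lambda+k+j]\;\,[(a_1+a_2-N\eta)/2\eta]_N .$$ If $\eta=0$, $C$ and $\Gamma_k$ are understood as the limits $$C=\frac{p^{1/4}}{2\pi(N+1)(p;p)_\infty^6},\qquad \Gamma_k=e^{\pi iN(\tau-1)/2}\,\frac{(-1)^k}{\binom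 Nk}\,\theta(a_1+a_2)^N\theta(a_1-a_2)^N .$$ -/

import Mathlib

open Complex MeasureTheory

noncomputable section

namespace SklyaninTheta

/-- Jacobi's theta function `θ(x) = θ₁(x|τ)`, given by its series. -/
def theta (τ x : ℂ) : ℂ :=
  I * ∑' n : ℤ, (-1 : ℂ) ^ n *
    exp (Real.pi * I * τ * ((n : ℂ) - 1 / 2) ^ 2 + Real.pi * I * (2 * (n : ℂ) - 1) * x)

/-- The nome `p = e^{2πiτ}`. -/
def nome (τ : ℂ) : ℂ := exp (2 * Real.pi * I * τ)

/-- The infinite product `(p;p)_∞ = ∏_{j ≥ 0} (1 - p^{j+1})`. -/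
def qPochInf (τ : ℂ) : ℂ := ∏' j : ℕ, (1 - nome τ ^ (j + 1))

/-- The elliptic number `[x] = θ(2ηx)`. -/
def ellNum (τ η x : ℂ) : ℂ := theta τ (2 * η * x)

/-- The elliptic shifted factorial `[x]_k = [x][x+1]⋯[x+k-1]`. -/
def ellFac (τ η x : ℂ) (k : ℕ) : ℂ := ∏ j ∈ Finset.range k, ellNum τ η (x + j)

/-- The space `Θ_N` of even theta functions of order `2N`, quasi-period `(1, τ)` and zero
characteristics. -/
def ThetaSpace (τ : ℂ) (N : ℕ) : Submodule ℂ (ℂ → ℂ) where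
  carrier := {f | Differentiable ℂ f ∧ (∀ x, f (x + 1) = f x) ∧
    (∀ x, f (x + τ) = exp (-(2 * Real.pi * I * N * (2 * x + τ))) * f x) ∧
    (∀ x, f (-x) = f x)}
  add_mem' := by
    rintro f g ⟨hf, hf1, hf2, hf3⟩ ⟨hg, hg1, hg2, hg3⟩
    refine ⟨hf.add hg, fun x => ?_, fun x => ?_, fun x => ?_⟩
    · simp [hf1, hg1]
    · simp [hf2, hg2, mul_add]
    · simp [hf3, hg3]
  zero_mem' := ⟨differentiable_const 0, by simp, by simp, by simp⟩
  smul_mem' := by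
    rintro c f ⟨hf, hf1, hf2, hf3⟩
    refine ⟨hf.const_smul c, fun x => ?_, fun x => ?_, fun x => ?_⟩
    · simp [hf1]
    · simp [hf2, mul_left_comm]
    · simp [hf3]

/-- The finite family `v` is a basis of the subspace `V`. -/
def IsBasisOf {n : ℕ} (V : Submodule ℂ (ℂ → ℂ)) (v : Fin n → ℂ → ℂ) : Prop :=
  LinearIndependent ℂ v ∧ Submodule.span ℂ (Set.range v) = V

/-- `e_k^N(x;a,b) = ∏_{j<k} θ(a ± x + 2jη) ∏_{j<N-k} θ(b ± x + 2jη)`, for `0 ≤ k ≤ N`. -/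
def eFun (τ η : ℂ) (N k : ℕ) (a b : ℂ) (x : ℂ) : ℂ :=
  (∏ j ∈ Finset.range k, theta τ (a + x + 2 * j * η) * theta τ (a - x + 2 * j * η)) *
    ∏ j ∈ Finset.range (N - k), theta τ (b + x + 2 * j * η) * theta τ (b - x + 2 * j * η)

/-- The involution `(σf)(x) = e^{2πiN(1/4+τ/4+x)} f(x+1/2+τ/2)`. -/
def sigma (τ : ℂ) (N : ℕ) (f : ℂ → ℂ) (x : ℂ) : ℂ :=
  exp (2 * Real.pi * I * N * (1 / 4 + τ / 4 + x)) * f (x + 1 / 2 + τ / 2)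

/-- The weight `M(u, v)` of the invariant metric. -/
def weight (τ η : ℂ) (N : ℕ) (u v : ℂ) : ℂ :=
  theta τ (2 * u) * theta τ (2 * v) /
    (exp (2 * Real.pi * I * u * (N + 2)) *
      ∏ k ∈ Finset.range (N + 2),
        (theta τ (u + v + (2 * k - N - 1) * η + 1 / 2 + τ / 2) *
          theta τ (u - v + (2 * k - N - 1) * η + 1 / 2 + τ / 2)))

/-- The fundamental rectangle `{x + iy : 0 ≤ x < 1, 0 ≤ y < Im τ}` of the torus
`ℂ / (ℤ + τℤ)`, for `τ` purely imaginary. -/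
def fundRect (τ : ℂ) : Set ℂ := {u | u.re ∈ Set.Ico 0 1 ∧ u.im ∈ Set.Ico 0 τ.im}

/-- The integrand `f(u) conj(g(u)) M(u, conj u)` of the invariant metric. -/
def metricIntegrand (τ η : ℂ) (N : ℕ) (f g : ℂ → ℂ) (u : ℂ) : ℂ :=
  f u * (starRingEnd ℂ) (g u) * weight τ η N u ((starRingEnd ℂ) u)

/-- The invariant metric `⟨f, g⟩ = ∬ f(u) conj(g(u)) M(u, conj u) dx dy`, `u = x + iy`, over
`ℂ / (ℤ + τℤ)`. -/
def metric (τ η : ℂ) (N : ℕ) (f g : ℂ → ℂ) : ℂ :=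
  ∫ u in fundRect τ, metricIntegrand τ η N f g u

/-- `ℝ_N`: real `η` with `|η| < 1/(2(N+1))`. -/
def RealRange (N : ℕ) : Set ℂ := {η | η.im = 0 ∧ ‖η‖ < 1 / (2 * ((N : ℝ) + 1))}

/-- `𝕀_N`: purely imaginary `η` with `|η| < (τ/i)/(2(N+1))`. -/
def ImagRange (τ : ℂ) (N : ℕ) : Set ℂ := {η | η.re = 0 ∧ ‖η‖ < τ.im / (2 * ((N : ℝ) + 1))}

open Classical in
/-- The constant `C = 2η p^{3/8} / (θ(2(N+1)η) (p;p)_∞^3)`, replaced at the removable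
singularity `η = 0` by its limit `p^{1/4} / (2π (N+1) (p;p)_∞^6)`. -/
def constC (τ η : ℂ) (N : ℕ) : ℂ :=
  if η = 0 then nome τ ^ (1 / 4 : ℂ) / (2 * Real.pi * (N + 1) * qPochInf τ ^ 6)
  else 2 * η * nome τ ^ (3 / 8 : ℂ) / (theta τ (2 * (N + 1) * η) * qPochInf τ ^ 3)

/-- `λ = (a₁ - a₂ - 2Nη) / 2η`. -/
def lam (η : ℂ) (N : ℕ) (a₁ a₂ : ℂ) : ℂ := (a₁ - a₂ - 2 * N * η) / (2 * η)

/-- The denominator `[λ+2k] [-N,λ]_k` of the formula for `Γ_k`. -/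
def gammaDen (τ η : ℂ) (N k : ℕ) (a₁ a₂ : ℂ) : ℂ :=
  ellNum τ η (lam η N a₁ a₂ + 2 * k) *
    (ellFac τ η (-N) k * ellFac τ η (lam η N a₁ a₂) k)

/-- The formula
`Γ_k = e^{πiN(τ-1)/2} ([λ]/[λ+2k]) ([1,λ+N+1]_k/[-N,λ]_k) [λ+1,(a₁+a₂-Nη)/2η]_N`,
to be read for `η ≠ 0` and non-vanishing denominator. -/
def gammaFormula (τ η : ℂ) (N k : ℕ) (a₁ a₂ : ℂ) : ℂ :=
  exp (Real.pi * I * N * (τ - 1) / 2) *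
    (ellNum τ η (lam η N a₁ a₂) / ellNum τ η (lam η N a₁ a₂ + 2 * k)) *
    ((ellFac τ η 1 k * ellFac τ η (lam η N a₁ a₂ + N + 1) k) /
      (ellFac τ η (-N) k * ellFac τ η (lam η N a₁ a₂) k)) *
    (ellFac τ η (lam η N a₁ a₂ + 1) N * ellFac τ η ((a₁ + a₂ - N * η) / (2 * η)) N)

/-- The same expression after cancelling all common factors that depend on `λ`:
`e^{πiN(τ-1)/2} ([1]_k/[-N]_k) (∏_{0 ≤ j ≤ N, j ≠ k} [λ+k+j]) [(a₁+a₂-Nη)/2η]_N`. -/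
def gammaCancelled (τ η : ℂ) (N k : ℕ) (a₁ a₂ : ℂ) : ℂ :=
  exp (Real.pi * I * N * (τ - 1) / 2) * (ellFac τ η 1 k / ellFac τ η (-N) k) *
    (∏ j ∈ (Finset.range (N + 1)).erase k, ellNum τ η (lam η N a₁ a₂ + k + j)) *
    ellFac τ η ((a₁ + a₂ - N * η) / (2 * η)) N

theorem ellFac_add (τ η x : ℂ) (m n : ℕ) :
    ellFac τ η x (m + n) = ellFac τ η x m * ellFac τ η (x + m) n := by
  simp only [ellFac, Finset.prod_range_add, Nat.cast_add, add_assoc]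

/-- The cancelled expression agrees with the original one when the latter makes sense. -/
theorem gammaCancelled_eq (τ η : ℂ) (N k : ℕ) (hk : k ≤ N) (a₁ a₂ : ℂ)
    (h : gammaDen τ η N k a₁ a₂ ≠ 0) :
    gammaCancelled τ η N k a₁ a₂ = gammaFormula τ η N k a₁ a₂ := by
  have hD := h
  simp only [gammaDen, mul_ne_zero_iff] at hD
  obtain ⟨h1, h2, h3⟩ := hD
  set L := lam η N a₁ a₂ with hL
  have hP : (∏ j ∈ (Finset.range (N + 1)).erase k, ellNum τ η (L + k + j)) *
      ellNum τ η (L + 2 * k) = ellFac τ η (L + k) (N + 1) := by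
    rw [ellFac, ← Finset.prod_erase_mul (Finset.range (N + 1)) _
      (Finset.mem_range.2 (Nat.lt_succ_of_le hk))]
    congr 2
    ring
  have hS : ellFac τ η L k * ellFac τ η (L + k) (N + 1) =
      ellNum τ η L * ellFac τ η (L + 1) N * ellFac τ η (L + N + 1) k := by
    have e1 : ellFac τ η L 1 = ellNum τ η L := by simp [ellFac]
    rw [← ellFac_add, show k + (N + 1) = 1 + N + k by ring, ellFac_add, ellFac_add, e1]
    congr 2
    · simp
    · push_cast
      ring
  rw [← hP] at hS
  simp only [gammaCancelled, gammaFormula, ← hL]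
  field_simp
  linear_combination
    ellFac τ η 1 k * ellFac τ η ((a₁ + a₂ - N * η) / (2 * η)) N * hS

open Classical in
/-- The constant `Γ_k`. For `η ≠ 0` it is given by the quotient formula. If the denominator of
that formula vanishes, the removable singularity is removed by cancelling common factors; at
`η = 0` the formula is replaced by its limit
`e^{πiN(τ-1)/2} ((-1)^k / binom(N,k)) θ(a₁+a₂)^N θ(a₁-a₂)^N`. -/
def constGamma (τ η : ℂ) (N k : ℕ) (a₁ a₂ : ℂ) : ℂ :=
  if η = 0 then
    exp (Real.pi * I * N * (τ - 1) / 2) * ((-1) ^ k / (N.choose k : ℂ)) *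
      theta τ (a₁ + a₂) ^ N * theta τ (a₁ - a₂) ^ N
  else if gammaDen τ η N k a₁ a₂ ≠ 0 then gammaFormula τ η N k a₁ a₂
  else gammaCancelled τ η N k a₁ a₂

end SklyaninTheta

end

namespace SklyaninTheta

/-! Put T(z) = e^{πiz} θ(z + 1/2 + τ/2), an even theta function. For v = ū one has u+v = 2x and u−v
= 2iy, so the denominator of the weight is a product of factors T(2x + cη) and T(2iy + cη) with |c|
≤ N+1. The bounds on η keep them away from the zeros of T. Hence the integrand is continuous on the
torus, and x and y can be moved independently into complex strips. Writing conj g(u) as G(ū) turns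
the metric into the bilinear form `pairing`. Apart from the bounds, η being real or imaginary serves
only to make conj f_l a constant times a product of T-strings in ū (`dualStr`).

The engine is an adjunction, `pairing_lowering`: the difference operator F ↦ (c(u)F(u+η) −
c(−u)F(u−η))/θ(2u), from level n+1 to level n, is adjoint, up to the factor −θ(2(n+2)η), to
multiplication by T(c+v)T(c−v). Indeed the two halves of the integrand are exchanged by (u,v) ↦
(−u,−v). The contour shift x → x − η/2, y → y + iη/2 sends u to u−η and fixes v, and the three-term
Weierstrass identity recombines the shifted halves. If c is adapted to the string in a, the operator
shortens the b-string of a product of two θ-strings by one and multiplies by an explicit constant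
(`lower_thetaStr`); it kills the product if no b-factor is left. Each T-factor of the dual a-string
thus consumes one b-factor, and conversely. Strings of mismatched lengths pair to zero, and matching
lengths reduce the pairing to N = 0 with an explicit product of theta values.

For N = 0 the differentiated three-term identity writes the integrand as logarithmic derivatives of
T in x alone minus the same in y alone. Contour shifts, with the quasi-periodicity of T'/T in the
direction τ, give 4πη (`pairing_zero_one`). Jacobi's triple product supplies θ'(0) and the location
of the zeros.

The recursion divides by θ(2jη), so η = 0 is reached by continuity of both sides. For non-vanishing:
if one of the theta values in the formula that involve a₁, a₂ were zero, all e_k would have a common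
zero, which a spanning family of Θ_N cannot have. Biorthogonality with nonzero diagonal makes the
f_l independent, and they are as many as the e_k. -/

/-! ### Quasi-periodicity and symmetry of θ and T. -/

/-- The even theta function `T(z) = e^{πiz} θ(z + 1/2 + τ/2)`. -/
noncomputable def evenTheta (τ z : ℂ) : ℂ := exp (Real.pi * I * z) * theta τ (z + 1 / 2 + τ / 2)

theorem neg_one_zpow_eq_exp (n : ℤ) : (-1 : ℂ) ^ n = exp (Real.pi * I * n) := by
  rw [← exp_pi_mul_I, ← exp_int_mul]
  ring_nf

theorem theta_eq_jacobiTheta₂ (τ x : ℂ) :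
    theta τ x = I * exp (Real.pi * I * (τ / 4 - x)) * jacobiTheta₂ (x + 1 / 2 - τ / 2) τ := by
  rw [theta, jacobiTheta₂, mul_assoc I (exp _), ← tsum_mul_left (a := exp _)]
  refine congrArg (I * ·) (tsum_congr fun n => ?_)
  rw [jacobiTheta₂_term, neg_one_zpow_eq_exp, ← exp_add, ← exp_add]
  ring_nf

/-- Up to a constant, T is the third Jacobi theta function, so evenness, periodicity and holomorphy
are inherited from `jacobiTheta₂`. -/
theorem evenTheta_eq_jacobiTheta₂ (τ z : ℂ) :
    evenTheta τ z = exp (-(Real.pi * I * τ / 4)) * jacobiTheta₂ z τ := by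
  rw [evenTheta, theta_eq_jacobiTheta₂,
    show z + 1 / 2 + τ / 2 + 1 / 2 - τ / 2 = z + 1 by ring, jacobiTheta₂_add_left]
  have h : exp (Real.pi * I * (τ / 4 - (z + 1 / 2 + τ / 2))) =
      exp (-(Real.pi * I * τ / 4)) * exp (-(Real.pi * I * z)) * exp (-(Real.pi / 2 * I)) := by
    rw [← exp_add, ← exp_add]
    ring_nf
  have h2 : exp (-(Real.pi / 2 * I)) = -I := by rw [exp_neg, exp_pi_div_two_mul_I, inv_I]
  rw [h, h2, exp_neg (Real.pi * I * z)]
  have h3 := exp_ne_zero (Real.pi * I * z)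
  field_simp
  linear_combination (-(jacobiTheta₂ z τ)) * I_sq

theorem evenTheta_neg (τ z : ℂ) : evenTheta τ (-z) = evenTheta τ z := by
  simp only [evenTheta_eq_jacobiTheta₂, jacobiTheta₂_neg_left]

theorem evenTheta_add_one (τ z : ℂ) : evenTheta τ (z + 1) = evenTheta τ z := by
  simp only [evenTheta_eq_jacobiTheta₂, jacobiTheta₂_add_left]

theorem evenTheta_add_tau (τ z : ℂ) :
    evenTheta τ (z + τ) = exp (-(Real.pi * I * (τ + 2 * z))) * evenTheta τ z := by
  simp only [evenTheta_eq_jacobiTheta₂, jacobiTheta₂_add_left']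
  ring_nf

theorem theta_eq_evenTheta (τ x : ℂ) :
    theta τ x = exp (-(Real.pi * I * (x - 1 / 2 - τ / 2))) * evenTheta τ (x - 1 / 2 - τ / 2) := by
  rw [evenTheta, ← mul_assoc, ← exp_add]
  ring_nf
  simp

theorem theta_add_half_period (τ z : ℂ) :
    theta τ (z + 1 / 2 + τ / 2) = exp (-(Real.pi * I * z)) * evenTheta τ z := by
  rw [evenTheta, ← mul_assoc, ← exp_add]
  simp

theorem theta_add_one (τ x : ℂ) : theta τ (x + 1) = -theta τ x := by
  rw [theta_eq_evenTheta τ (x + 1), theta_eq_evenTheta τ x,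
    show x + 1 - 1 / 2 - τ / 2 = x - 1 / 2 - τ / 2 + 1 by ring, evenTheta_add_one,
    show -(Real.pi * I * (x - 1 / 2 - τ / 2 + 1)) =
      -(Real.pi * I * (x - 1 / 2 - τ / 2)) - Real.pi * I by ring, exp_sub, exp_pi_mul_I]
  ring

theorem theta_add_tau (τ x : ℂ) :
    theta τ (x + τ) = -(exp (-(Real.pi * I * (τ + 2 * x))) * theta τ x) := by
  rw [theta_eq_evenTheta τ (x + τ), theta_eq_evenTheta τ x,
    show x + τ - 1 / 2 - τ / 2 = x - 1 / 2 - τ / 2 + τ by ring, evenTheta_add_tau]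
  simp only [← mul_assoc, ← exp_add]
  rw [show -(Real.pi * I * (x - 1 / 2 - τ / 2 + τ)) +
        -(Real.pi * I * (τ + 2 * (x - 1 / 2 - τ / 2))) =
      -(Real.pi * I * (τ + 2 * x)) + -(Real.pi * I * (x - 1 / 2 - τ / 2)) + Real.pi * I by ring,
    exp_add _ (Real.pi * I), exp_pi_mul_I]
  ring

theorem theta_neg (τ x : ℂ) : theta τ (-x) = -theta τ x := by
  have h : theta τ (-x) = theta τ (-x - 1 - τ + τ + 1) := by ring_nf
  rw [h, theta_add_one, theta_add_tau, theta_eq_evenTheta τ (-x - 1 - τ),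
    theta_eq_evenTheta τ x, neg_neg,
    show -x - 1 - τ - 1 / 2 - τ / 2 = -(x - 1 / 2 - τ / 2 + 2 + τ + τ) by ring, evenTheta_neg,
    evenTheta_add_tau, evenTheta_add_tau,
    show x - 1 / 2 - τ / 2 + 2 = x - 1 / 2 - τ / 2 + 1 + 1 by ring, evenTheta_add_one,
    evenTheta_add_one]
  simp only [← mul_assoc, ← exp_add]
  rw [← neg_mul (exp (-(Real.pi * I * (x - 1 / 2 - τ / 2)))), neg_eq_neg_one_mul (exp _),
    ← exp_pi_mul_I, ← exp_add]
  congr 1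
  rw [exp_eq_exp_iff_exists_int]
  refine ⟨-2, ?_⟩
  push_cast
  ring

theorem theta_zero (τ : ℂ) : theta τ 0 = 0 := by
  have h := theta_neg τ 0
  rw [neg_zero] at h
  linear_combination h / 2

theorem differentiable_evenTheta {τ : ℂ} (hτ : 0 < τ.im) : Differentiable ℂ (evenTheta τ) := by
  rw [show evenTheta τ = fun z => exp (-(Real.pi * I * τ / 4)) * jacobiTheta₂ z τ from
    funext (evenTheta_eq_jacobiTheta₂ τ)]
  exact fun z => (differentiableAt_jacobiTheta₂_fst z hτ).const_mul _

theorem differentiable_theta {τ : ℂ} (hτ : 0 < τ.im) : Differentiable ℂ (theta τ) := by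
  rw [show theta τ = fun x => exp (-(Real.pi * I * (x - 1 / 2 - τ / 2))) *
    evenTheta τ (x - 1 / 2 - τ / 2) from funext (theta_eq_evenTheta τ)]
  have := differentiable_evenTheta hτ
  fun_prop

theorem conj_evenTheta {τ : ℂ} (hτ : τ.re = 0) (z : ℂ) :
    (starRingEnd ℂ) (evenTheta τ z) = evenTheta τ ((starRingEnd ℂ) z) := by
  have hc : (starRingEnd ℂ) τ = -τ := by
    apply Complex.ext <;> simp [hτ]
  rw [evenTheta_eq_jacobiTheta₂, evenTheta_eq_jacobiTheta₂, map_mul, jacobiTheta₂_conj, hc,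
    ← exp_conj]
  simp only [map_neg, map_div₀, map_mul, conj_ofReal, conj_I, hc, neg_neg, map_ofNat]
  ring_nf

/-! ### Addition formulas. -/

/-- The pairs `(m, n)` of integers split according to the parity of `m + n`. -/
def intPairParity : (ℤ × ℤ) ⊕ (ℤ × ℤ) ≃ ℤ × ℤ where
  toFun := Sum.elim (fun x => (x.1 + x.2, x.1 - x.2)) (fun x => (x.1 + x.2 + 1, x.1 - x.2))
  invFun y := if (y.1 + y.2) % 2 = 0 then Sum.inl ((y.1 + y.2) / 2, (y.1 - y.2) / 2)
    else Sum.inr ((y.1 + y.2 - 1) / 2, (y.1 - y.2 - 1) / 2)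
  left_inv := by
    rintro (⟨i, j⟩ | ⟨i, j⟩)
    · have h : (i + j + (i - j)) % 2 = 0 := by omega
      refine (if_pos h).trans (congrArg Sum.inl (Prod.ext ?_ ?_))
      · show (i + j + (i - j)) / 2 = i
        omega
      · show (i + j - (i - j)) / 2 = j
        omega
    · have h : ¬(i + j + 1 + (i - j)) % 2 = 0 := by omega
      refine (if_neg h).trans (congrArg Sum.inr (Prod.ext ?_ ?_))
      · show (i + j + 1 + (i - j) - 1) / 2 = i
        omega
      · show (i + j + 1 - (i - j) - 1) / 2 = j
        omega
  right_inv := by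
    rintro ⟨m, n⟩
    dsimp only
    split_ifs with h
    · simp only [Sum.elim_inl]
      congr 1 <;> omega
    · simp only [Sum.elim_inr]
      congr 1 <;> omega

theorem summable_theta_term {τ : ℂ} (hτ : 0 < τ.im) (x : ℂ) :
    Summable fun n : ℤ => (-1 : ℂ) ^ n *
      exp (Real.pi * I * τ * ((n : ℂ) - 1 / 2) ^ 2 + Real.pi * I * (2 * (n : ℂ) - 1) * x) := by
  refine (((summable_jacobiTheta₂_term_iff (x + 1 / 2 - τ / 2) τ).2 hτ).mul_left
    (exp (Real.pi * I * (τ / 4 - x)))).congr fun n => ?_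
  rw [jacobiTheta₂_term, neg_one_zpow_eq_exp, ← exp_add, ← exp_add]
  ring_nf

/-- The addition formula `θ(x+y) θ(x-y) = A(x) B(y) - B(x) A(y)`. -/
theorem exists_theta_mul_theta_eq {τ : ℂ} (hτ : 0 < τ.im) : ∃ A B : ℂ → ℂ, ∀ x y : ℂ,
    theta τ (x + y) * theta τ (x - y) = A x * B y - B x * A y := by
  set A : ℂ → ℂ := fun x => ∑' i : ℤ, exp (2 * Real.pi * I * (τ * i ^ 2 + 2 * i * x)) with hA
  set B : ℂ → ℂ := fun x => ∑' i : ℤ,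
    exp (2 * Real.pi * I * (τ * (i + 1 / 2) ^ 2 + (2 * i + 1) * x)) with hB
  have hτ2 : 0 < (2 * τ).im := by simpa using hτ
  have sA : ∀ x, Summable fun i : ℤ => exp (2 * Real.pi * I * (τ * i ^ 2 + 2 * i * x)) := by
    intro x
    refine ((summable_jacobiTheta₂_term_iff (2 * x) (2 * τ)).2 hτ2).congr fun n => ?_
    rw [jacobiTheta₂_term]
    ring_nf
  have sB : ∀ x, Summable fun i : ℤ =>
      exp (2 * Real.pi * I * (τ * (i + 1 / 2) ^ 2 + (2 * i + 1) * x)) := by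
    intro x
    refine (((summable_jacobiTheta₂_term_iff (2 * x + τ) (2 * τ)).2 hτ2).mul_left
      (exp (2 * Real.pi * I * (τ / 4 + x)))).congr fun n => ?_
    rw [jacobiTheta₂_term, ← exp_add]
    ring_nf
  have sB' : ∀ x, Summable fun i : ℤ =>
      exp (2 * Real.pi * I * (τ * (i - 1 / 2) ^ 2 + (2 * i - 1) * x)) := by
    intro x
    refine ((Equiv.subRight (1 : ℤ)).summable_iff.2 (sB x)).congr fun n => ?_
    simp only [Function.comp, Equiv.subRight_apply]
    push_cast
    ring_nf
  have hB' : ∀ x, B x = ∑' i : ℤ,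
      exp (2 * Real.pi * I * (τ * (i - 1 / 2) ^ 2 + (2 * i - 1) * x)) := by
    intro x
    rw [hB]
    dsimp only
    rw [← (Equiv.subRight (1 : ℤ)).tsum_eq]
    congr 1
    ext n
    simp only [Equiv.subRight_apply]
    push_cast
    ring_nf
  refine ⟨A, B, fun x y => ?_⟩
  -- With m = i+j, n = i−j one has (m−1/2)² + (n−1/2)² = 2(i−1/2)² + 2j²; with m = i+j+1, n = i−j it
  -- is 2i² + 2(j+1/2)². The variables decouple in each parity class, and the sign (−1)^{m+n} is
  -- constant there.
  have hprod := tsum_mul_tsum_of_summable_norm (summable_theta_term hτ (x + y)).norm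
    (summable_theta_term hτ (x - y)).norm
  have hsum := summable_mul_of_summable_norm (summable_theta_term hτ (x + y)).norm
    (summable_theta_term hτ (x - y)).norm
  have hAB := tsum_mul_tsum_of_summable_norm (sA x).norm (sB y).norm
  have hBA := tsum_mul_tsum_of_summable_norm (sB' x).norm (sA y).norm
  have hsum' := intPairParity.summable_iff.2 hsum
  have hl : ∀ z : ℤ × ℤ, (-1 : ℂ) ^ (z.1 + z.2) * exp (Real.pi * I * τ * (((z.1 + z.2 : ℤ) : ℂ) - 1 / 2) ^ 2 +
        Real.pi * I * (2 * ((z.1 + z.2 : ℤ) : ℂ) - 1) * (x + y)) *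
      ((-1 : ℂ) ^ (z.1 - z.2) * exp (Real.pi * I * τ * (((z.1 - z.2 : ℤ) : ℂ) - 1 / 2) ^ 2 +
        Real.pi * I * (2 * ((z.1 - z.2 : ℤ) : ℂ) - 1) * (x - y))) =
      exp (2 * Real.pi * I * (τ * (z.1 - 1 / 2) ^ 2 + (2 * z.1 - 1) * x)) *
        exp (2 * Real.pi * I * (τ * z.2 ^ 2 + 2 * z.2 * y)) := by
    intro z
    rw [mul_mul_mul_comm, ← zpow_add₀ (by norm_num), Even.neg_one_zpow ⟨z.1, by ring⟩, one_mul,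
      ← exp_add, ← exp_add]
    push_cast
    ring_nf
  have hr : ∀ z : ℤ × ℤ, (-1 : ℂ) ^ (z.1 + z.2 + 1) *
        exp (Real.pi * I * τ * (((z.1 + z.2 + 1 : ℤ) : ℂ) - 1 / 2) ^ 2 +
          Real.pi * I * (2 * ((z.1 + z.2 + 1 : ℤ) : ℂ) - 1) * (x + y)) *
      ((-1 : ℂ) ^ (z.1 - z.2) * exp (Real.pi * I * τ * (((z.1 - z.2 : ℤ) : ℂ) - 1 / 2) ^ 2 +
        Real.pi * I * (2 * ((z.1 - z.2 : ℤ) : ℂ) - 1) * (x - y))) =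
      -(exp (2 * Real.pi * I * (τ * z.1 ^ 2 + 2 * z.1 * x)) *
        exp (2 * Real.pi * I * (τ * (z.2 + 1 / 2) ^ 2 + (2 * z.2 + 1) * y))) := by
    intro z
    rw [mul_mul_mul_comm, ← zpow_add₀ (by norm_num), Odd.neg_one_zpow ⟨z.1, by ring⟩, neg_one_mul,
      ← exp_add, ← exp_add]
    push_cast
    ring_nf
  have key := Summable.tsum_sum (hsum'.comp_injective Sum.inl_injective)
    (hsum'.comp_injective Sum.inr_injective)
  have e1 := tsum_congr (L := .unconditional _) hl
  have e2 := tsum_congr (L := .unconditional _) hr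
  rw [tsum_neg, ← hAB] at e2
  rw [← hBA, ← hB'] at e1
  have e0 := key.trans (congrArg₂ (· + ·) e1 e2)
  have e3 := hprod.trans ((intPairParity.tsum_eq _).symm.trans e0)
  simp only [theta]
  rw [mul_mul_mul_comm, I_mul_I, e3]
  ring

/-- By the addition formula θ(x+y)θ(x−y) is a 2×2 minor of the vectors (A, B) at x and y, so this is
the Plücker relation among the six minors of four vectors in the plane. -/
theorem theta_plucker {τ : ℂ} (hτ : 0 < τ.im) (x y m n : ℂ) :
    theta τ (x + m) * theta τ (x - m) * (theta τ (y + n) * theta τ (y - n)) -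
      theta τ (y + m) * theta τ (y - m) * (theta τ (x + n) * theta τ (x - n)) =
    theta τ (x + y) * theta τ (x - y) * (theta τ (m + n) * theta τ (m - n)) := by
  obtain ⟨A, B, h⟩ := exists_theta_mul_theta_eq hτ
  simp only [h]
  ring

/-- The three-term (Weierstrass) identity. -/
theorem theta_weierstrass {τ : ℂ} (hτ : 0 < τ.im) (u α₁ α₂ α₃ α₄ : ℂ)
    (hα : α₁ + α₂ + α₃ + α₄ = 0) :
    theta τ (u + α₁) * theta τ (u + α₂) * (theta τ (u + α₃) * theta τ (u + α₄)) -
      theta τ (-u + α₁) * theta τ (-u + α₂) * (theta τ (-u + α₃) * theta τ (-u + α₄)) =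
    theta τ (2 * u) * (theta τ (α₁ + α₂) * theta τ (α₁ + α₃) * theta τ (α₁ + α₄)) := by
  obtain rfl : α₄ = -(α₁ + α₂ + α₃) := by linear_combination hα
  -- The arguments are chosen so that x±m and y±n reproduce u+α₁, u+α₂ and, up to sign, the factors
  -- with α₃, α₄; x+y becomes 2u and x−y becomes α₁+α₂.
  have h := theta_plucker hτ (u + (α₁ + α₂) / 2) (u - (α₁ + α₂) / 2) ((α₁ - α₂) / 2)
    (α₃ + (α₁ + α₂) / 2)
  have e1 := theta_neg τ (u - α₁)
  have e2 := theta_neg τ (u - α₂)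
  have e3 := theta_neg τ (u - α₃)
  have e4 := theta_neg τ (u + α₁ + α₂ + α₃)
  ring_nf at h e1 e2 e3 e4 ⊢
  rw [e1, e2, e3, e4]
  linear_combination h

/-! ### Jacobi's triple product. -/

/-- The finite product `(q²;q²)_m`. -/
def qPochFin (q : ℝ) (m : ℕ) : ℝ := ∏ j ∈ Finset.range m, (1 - (q ^ 2) ^ (j + 1))

/-- The reciprocal of `(q²;q²)_j`, extended by zero to negative `j`. -/
noncomputable def qPochRec (q : ℝ) (j : ℤ) : ℝ := if 0 ≤ j then (qPochFin q j.toNat)⁻¹ else 0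

theorem one_sub_sq_pow_pos {q : ℝ} (h0 : 0 < q) (h1 : q < 1) (j : ℕ) : 0 < 1 - (q ^ 2) ^ (j + 1) := by
  have : (q ^ 2) ^ (j + 1) < 1 := pow_lt_one₀ (by positivity) (by nlinarith) (by omega)
  linarith

theorem qPochFin_pos {q : ℝ} (h0 : 0 < q) (h1 : q < 1) (m : ℕ) : 0 < qPochFin q m :=
  Finset.prod_pos fun j _ => one_sub_sq_pow_pos h0 h1 j

theorem qPochFin_succ (q : ℝ) (m : ℕ) :
    qPochFin q (m + 1) = qPochFin q m * (1 - (q ^ 2) ^ (m + 1)) := Finset.prod_range_succ _ _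

theorem qPochRec_natCast (q : ℝ) (m : ℕ) : qPochRec q m = (qPochFin q m)⁻¹ := by
  simp [qPochRec]

/-- The extension by zero makes the recursion hold for every integer, including j = 0, where the
factor 1 − q^{2j} vanishes. No boundary cases arise in the finite identity. -/
theorem qPochRec_sub_one {q : ℝ} (h0 : 0 < q) (h1 : q < 1) (j : ℤ) :
    qPochRec q (j - 1) = (1 - (q ^ 2) ^ j) * qPochRec q j := by
  rcases lt_trichotomy j 0 with h | rfl | h
  · simp [qPochRec, not_le.2 h, show ¬(1 ≤ j) by omega]
  · simp [qPochRec]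
  · obtain ⟨n, rfl⟩ : ∃ n : ℕ, j = ((n + 1 : ℕ) : ℤ) := ⟨(j - 1).toNat, by omega⟩
    rw [show ((n + 1 : ℕ) : ℤ) - 1 = (n : ℤ) by push_cast; ring, qPochRec_natCast,
      qPochRec_natCast, qPochFin_succ, zpow_natCast]
    have := (one_sub_sq_pow_pos h0 h1 n).ne'
    have := (qPochFin_pos h0 h1 n).ne'
    field_simp

/-- The coefficients in the finite form of the triple product identity. -/
noncomputable def tripleCoeff (q : ℝ) (m : ℕ) (n : ℤ) : ℝ :=
  qPochFin q (2 * m) * q ^ (n ^ 2) * qPochRec q (m + n) * qPochRec q (m - n)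

/-- Coefficient form of multiplication by (1 + wQ)(1 + w⁻¹Q) = 1 + Q² + Q(w + w⁻¹), where Q =
q^{2m+1}. -/
theorem tripleCoeff_succ {q : ℝ} (h0 : 0 < q) (h1 : q < 1) (m : ℕ) (n : ℤ) :
    tripleCoeff q (m + 1) n = (1 + q ^ (4 * m + 2)) * tripleCoeff q m n +
      q ^ (2 * m + 1) * (tripleCoeff q m (n - 1) + tripleCoeff q m (n + 1)) := by
  have a1 := qPochRec_sub_one h0 h1 (m + 1 + n)
  have a2 := qPochRec_sub_one h0 h1 (m + n)
  have b1 := qPochRec_sub_one h0 h1 (m + 1 - n)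
  have b2 := qPochRec_sub_one h0 h1 (m - n)
  rw [show (m : ℤ) + 1 + n - 1 = m + n by ring] at a1
  rw [show (m : ℤ) + 1 - n - 1 = m - n by ring] at b1
  rw [a1] at a2
  rw [b1] at b2
  have hq := h0.ne'
  simp only [tripleCoeff]
  rw [show (m : ℤ) + (n - 1) = m + n - 1 by ring, show (m : ℤ) - (n - 1) = m + 1 - n by ring,
    show (m : ℤ) + (n + 1) = m + 1 + n by ring, show (m : ℤ) - (n + 1) = m - n - 1 by ring,
    a1, a2, b1, b2, show 2 * (m + 1) = 2 * m + 1 + 1 by ring, qPochFin_succ, qPochFin_succ,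
    show (n - 1) ^ 2 = n ^ 2 - n - n + 1 by ring, show (n + 1) ^ 2 = n ^ 2 + n + n + 1 by ring]
  push_cast
  generalize qPochRec q (m + 1 + n) = R
  generalize qPochRec q (m + 1 - n) = S
  generalize qPochFin q (2 * m) = U
  simp only [← zpow_natCast, ← zpow_mul]
  push_cast
  simp only [mul_add, mul_sub, mul_one, two_mul, add_mul, sub_mul, one_mul]
  simp only [zpow_add₀ hq, zpow_sub₀ hq, zpow_one]
  have hX : q ^ n ≠ 0 := zpow_ne_zero _ hq
  rw [show (4 : ℤ) * m = m + m + m + m by ring]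
  simp only [zpow_add₀ hq, zpow_ofNat]
  generalize q ^ (m : ℤ) = P
  generalize q ^ (n ^ 2) = Y
  generalize q ^ n = X at hX ⊢
  field_simp
  ring

theorem hasSum_tripleCoeff {q : ℝ} (h0 : 0 < q) (h1 : q < 1) {w : ℂ} (hw : w ≠ 0) (m : ℕ) :
    HasSum (fun n : ℤ => (tripleCoeff q m n : ℂ) * w ^ n)
      (∏ j ∈ Finset.range m, (1 + w * q ^ (2 * j + 1)) * (1 + w⁻¹ * q ^ (2 * j + 1))) := by
  induction m with
  | zero =>
    convert hasSum_single (0 : ℤ) (fun n hn => ?_) using 1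
    · simp [tripleCoeff, qPochFin, qPochRec]
    · rcases lt_or_gt_of_ne hn with h | h
      · simp [tripleCoeff, qPochRec, not_le.2 h]
      · simp [tripleCoeff, qPochRec, not_le.2 h]
  | succ m ih =>
    have e1 := (Equiv.subRight (1 : ℤ)).hasSum_iff.2 (ih.mul_left w)
    have e2 := (Equiv.addRight (1 : ℤ)).hasSum_iff.2 (ih.mul_left w⁻¹)
    have e := (ih.mul_left (1 + (q : ℂ) ^ (4 * m + 2))).add
      ((e1.add e2).mul_left ((q : ℂ) ^ (2 * m + 1)))
    have hf : (fun n : ℤ => (tripleCoeff q (m + 1) n : ℂ) * w ^ n) = fun n : ℤ =>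
        (1 + (q : ℂ) ^ (4 * m + 2)) * ((tripleCoeff q m n : ℂ) * w ^ n) +
          (q : ℂ) ^ (2 * m + 1) * (w * ((tripleCoeff q m (n - 1) : ℂ) * w ^ (n - 1)) +
            w⁻¹ * ((tripleCoeff q m (n + 1) : ℂ) * w ^ (n + 1))) := by
      refine funext fun n => ?_
      rw [tripleCoeff_succ h0 h1]
      simp only [zpow_sub₀ hw, zpow_add₀ hw, zpow_one]
      push_cast
      field_simp
    rw [hf, Finset.prod_range_succ]
    refine (congrArg (HasSum _) ?_).mp e
    field_simp
    ring

theorem summable_pow_mul_geometric {q : ℝ} (h0 : 0 < q) (h1 : q < 1) (w : ℂ) :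
    Summable fun j : ℕ => ‖w * (q : ℂ) ^ (2 * j + 1)‖ := by
  have h2 : q ^ 2 < 1 := by nlinarith
  refine ((summable_geometric_of_lt_one (by positivity) h2).mul_left (‖w‖ * q)).congr fun j => ?_
  rw [norm_mul, norm_pow, norm_real, Real.norm_of_nonneg h0.le]
  ring

theorem multipliable_qPoch {q : ℝ} (h0 : 0 < q) (h1 : q < 1) :
    Multipliable fun j : ℕ => 1 - (q ^ 2) ^ (j + 1) := by
  have h2 : q ^ 2 < 1 := by nlinarith
  refine multipliable_one_add_of_summable (f := fun j : ℕ => -(q ^ 2) ^ (j + 1)) ?_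
  refine ((summable_geometric_of_lt_one (by positivity) h2).mul_left (q ^ 2)).congr fun j => ?_
  rw [norm_neg, Real.norm_of_nonneg (by positivity)]
  ring

theorem tendsto_qPochFin {q : ℝ} (h0 : 0 < q) (h1 : q < 1) :
    Filter.Tendsto (qPochFin q) Filter.atTop (nhds (∏' j : ℕ, (1 - (q ^ 2) ^ (j + 1)))) :=
  (multipliable_qPoch h0 h1).hasProd.tendsto_prod_nat

theorem qPochLim_pos {q : ℝ} (h0 : 0 < q) (h1 : q < 1) :
    0 < ∏' j : ℕ, (1 - (q ^ 2) ^ (j + 1)) := by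
  have h2 : q ^ 2 < 1 := by nlinarith
  refine lt_of_le_of_ne (ge_of_tendsto' (tendsto_qPochFin h0 h1) fun m => (qPochFin_pos h0 h1 m).le)
    (Ne.symm ?_)
  refine tprod_one_add_ne_zero_of_summable (f := fun j : ℕ => -(q ^ 2) ^ (j + 1))
    (fun j => (by have := one_sub_sq_pow_pos h0 h1 j; rw [← sub_eq_add_neg]; exact this.ne')) ?_
  refine ((summable_geometric_of_lt_one (by positivity) h2).mul_left (q ^ 2)).congr fun j => ?_
  rw [norm_neg, Real.norm_of_nonneg (by positivity)]
  ring

theorem antitone_qPochFin {q : ℝ} (h0 : 0 < q) (h1 : q < 1) : Antitone (qPochFin q) := by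
  refine antitone_nat_of_succ_le fun m => ?_
  rw [qPochFin_succ]
  have := qPochFin_pos h0 h1 m
  have : 0 < (q ^ 2) ^ (m + 1) := by positivity
  nlinarith

theorem qPochRec_nonneg {q : ℝ} (h0 : 0 < q) (h1 : q < 1) (j : ℤ) : 0 ≤ qPochRec q j := by
  rw [qPochRec]
  split_ifs
  · exact (inv_pos.2 (qPochFin_pos h0 h1 _)).le
  · exact le_rfl

theorem qPochRec_le {q : ℝ} (h0 : 0 < q) (h1 : q < 1) (j : ℤ) :
    qPochRec q j ≤ (∏' j : ℕ, (1 - (q ^ 2) ^ (j + 1)))⁻¹ := by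
  rw [qPochRec]
  split_ifs
  · exact inv_anti₀ (qPochLim_pos h0 h1) ((antitone_qPochFin h0 h1).le_of_tendsto
      (tendsto_qPochFin h0 h1) _)
  · exact (inv_pos.2 (qPochLim_pos h0 h1)).le

theorem tendsto_qPochRec {q : ℝ} (h0 : 0 < q) (h1 : q < 1) (n : ℤ) :
    Filter.Tendsto (fun m : ℕ => qPochRec q (m + n)) Filter.atTop
      (nhds (∏' j : ℕ, (1 - (q ^ 2) ^ (j + 1)))⁻¹) := by
  have h : Filter.Tendsto (fun m : ℕ => ((m : ℤ) + n).toNat) Filter.atTop Filter.atTop := by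
    refine Filter.tendsto_atTop.2 fun b => ?_
    filter_upwards [Filter.eventually_ge_atTop (b + n.natAbs)] with m hm
    omega
  refine (((tendsto_qPochFin h0 h1).comp h).inv₀ (qPochLim_pos h0 h1).ne').congr' ?_
  filter_upwards [Filter.eventually_ge_atTop n.natAbs] with m hm
  rw [qPochRec, if_pos (by omega)]
  rfl

theorem tendsto_tripleCoeff {q : ℝ} (h0 : 0 < q) (h1 : q < 1) (n : ℤ) :
    Filter.Tendsto (fun m : ℕ => tripleCoeff q m n) Filter.atTop
      (nhds ((∏' j : ℕ, (1 - (q ^ 2) ^ (j + 1)))⁻¹ * q ^ (n ^ 2))) := by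
  have h2 : Filter.Tendsto (fun m : ℕ => 2 * m) Filter.atTop Filter.atTop :=
    Filter.tendsto_id.const_mul_atTop' (by norm_num)
  have h := ((((tendsto_qPochFin h0 h1).comp h2).mul_const (q ^ (n ^ 2))).mul
    (tendsto_qPochRec h0 h1 n)).mul (tendsto_qPochRec h0 h1 (-n))
  have := (qPochLim_pos h0 h1).ne'
  refine (h.congr fun m => rfl).trans (le_of_eq (congrArg nhds ?_))
  field_simp

theorem abs_tripleCoeff_le {q : ℝ} (h0 : 0 < q) (h1 : q < 1) (m : ℕ) (n : ℤ) :
    |tripleCoeff q m n| ≤ ((∏' j : ℕ, (1 - (q ^ 2) ^ (j + 1)))⁻¹) ^ 2 * q ^ (n ^ 2) := by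
  have hm : qPochFin q (2 * m) ≤ 1 := by
    simpa [qPochFin] using antitone_qPochFin h0 h1 (Nat.zero_le (2 * m))
  have hp := (qPochFin_pos h0 h1 (2 * m)).le
  have a := qPochRec_nonneg h0 h1 (m + n)
  have b := qPochRec_nonneg h0 h1 (m - n)
  have a' := qPochRec_le h0 h1 (m + n)
  have b' := qPochRec_le h0 h1 (m - n)
  have hq : 0 ≤ q ^ (n ^ 2) := (zpow_pos h0 _).le
  rw [abs_of_nonneg (by rw [tripleCoeff]; exact mul_nonneg (mul_nonneg (mul_nonneg hp hq) a) b), tripleCoeff]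
  calc qPochFin q (2 * m) * q ^ (n ^ 2) * qPochRec q (m + n) * qPochRec q (m - n)
      ≤ 1 * q ^ (n ^ 2) * (∏' j : ℕ, (1 - (q ^ 2) ^ (j + 1)))⁻¹ *
        (∏' j : ℕ, (1 - (q ^ 2) ^ (j + 1)))⁻¹ := by
        have := (inv_pos.2 (qPochLim_pos h0 h1)).le
        have : 0 ≤ 1 * q ^ (n ^ 2) * (∏' j : ℕ, (1 - (q ^ 2) ^ (j + 1)))⁻¹ := by positivity
        gcongr
    _ = _ := by ring

theorem exp_pi_I_tau {τ : ℂ} (hτ : τ.re = 0) :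
    exp (Real.pi * I * τ) = (Real.exp (-(Real.pi * τ.im)) : ℝ) := by
  rw [ofReal_exp]
  congr 1
  apply Complex.ext <;> simp [hτ]

/-- Jacobi's triple product identity. -/
theorem jacobiTheta₂_eq_tprod {τ : ℂ} (hτ : τ.re = 0) (hτ' : 0 < τ.im) (z : ℂ) :
    jacobiTheta₂ z τ = qPochInf τ *
      ((∏' j : ℕ, (1 + exp (2 * Real.pi * I * z) * exp (Real.pi * I * τ) ^ (2 * j + 1))) *
        ∏' j : ℕ, (1 + (exp (2 * Real.pi * I * z))⁻¹ * exp (Real.pi * I * τ) ^ (2 * j + 1))) := by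
  set q : ℝ := Real.exp (-(Real.pi * τ.im)) with hq
  have h0 : 0 < q := Real.exp_pos _
  have h1 : q < 1 := Real.exp_lt_one_iff.2 (by have := Real.pi_pos; nlinarith)
  have hqc := exp_pi_I_tau hτ
  rw [← hq] at hqc
  set w := exp (2 * Real.pi * I * z) with hw
  have hw0 : w ≠ 0 := exp_ne_zero _
  set L := ∏' j : ℕ, (1 - (q ^ 2) ^ (j + 1)) with hL
  have hL0 := (qPochLim_pos h0 h1).ne'
  have hLq : qPochInf τ = L := by
    rw [qPochInf, hL, ← ofRealHom_eq_coe,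
      (multipliable_qPoch h0 h1).map_tprod ofRealHom continuous_ofReal]
    refine tprod_congr fun j => ?_
    simp only [ofRealHom_eq_coe]
    push_cast
    rw [← hqc, nome, ← pow_mul, ← exp_nat_mul, ← exp_nat_mul]
    push_cast
    ring_nf
  have hterm : ∀ n : ℤ, jacobiTheta₂_term n z τ = ((q ^ (n ^ 2) : ℝ) : ℂ) * w ^ n := by
    intro n
    push_cast
    rw [← hqc, hw, ← exp_int_mul, ← exp_int_mul, ← exp_add, jacobiTheta₂_term]
    push_cast
    ring_nf
  have hs := (summable_jacobiTheta₂_term_iff z τ).2 hτ'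
  -- The finite identity passes to the limit m → ∞: all coefficients are bounded by L⁻² q^{n²},
  -- uniformly in m, which is summable against w^n.
  have hlim := tendsto_tsum_of_dominated_convergence
    (f := fun (m : ℕ) (n : ℤ) => (tripleCoeff q m n : ℂ) * w ^ n)
    (g := fun n : ℤ => ((L⁻¹ * q ^ (n ^ 2) : ℝ) : ℂ) * w ^ n)
    (bound := fun n : ℤ => (L⁻¹) ^ 2 * ‖jacobiTheta₂_term n z τ‖) (𝓕 := Filter.atTop)
    (hs.norm.mul_left _)
    (fun n => ((continuous_ofReal.tendsto _).comp (tendsto_tripleCoeff h0 h1 n)).mul_const _)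
    (Filter.Eventually.of_forall fun m n => by
      rw [hterm, norm_mul, norm_mul, norm_real, norm_real, ← mul_assoc]
      refine mul_le_mul_of_nonneg_right ?_ (norm_nonneg _)
      rw [Real.norm_of_nonneg (zpow_pos h0 _).le]
      exact abs_tripleCoeff_le h0 h1 m n)
  have m1 := multipliable_one_add_of_summable (summable_pow_mul_geometric h0 h1 w)
  have m2 := multipliable_one_add_of_summable (summable_pow_mul_geometric h0 h1 w⁻¹)
  have hlim2 := m1.hasProd.tendsto_prod_nat.mul m2.hasProd.tendsto_prod_nat
  have := tendsto_nhds_unique hlim (hlim2.congr fun m => by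
    rw [(hasSum_tripleCoeff h0 h1 hw0 m).tsum_eq, Finset.prod_mul_distrib])
  rw [hqc, ← this, hLq, ← tsum_mul_left, jacobiTheta₂]
  refine tsum_congr fun n => ?_
  rw [hterm]
  push_cast
  have : (L : ℂ) ≠ 0 := by exact_mod_cast hL0
  field_simp

/-! ### Zeros of T and θ, and the value θ'(0). -/

theorem exists_int_of_one_add_eq_zero {τ z : ℂ} {j : ℕ}
    (h : 1 + exp (2 * Real.pi * I * z) * exp (Real.pi * I * τ) ^ (2 * j + 1) = 0) :
    ∃ n : ℤ, 2 * z + (2 * j + 1) * τ = 1 + 2 * n := by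
  have h1 : exp (2 * Real.pi * I * z + (2 * j + 1 : ℕ) * (Real.pi * I * τ)) =
      exp (Real.pi * I) := by
    rw [exp_add, exp_nat_mul, exp_pi_mul_I]
    linear_combination h
  obtain ⟨n, hn⟩ := exp_eq_exp_iff_exists_int.1 h1
  refine ⟨n, ?_⟩
  have hpi : (Real.pi : ℂ) * I ≠ 0 := by simp [Real.pi_ne_zero]
  apply mul_left_cancel₀ hpi
  push_cast at hn
  linear_combination hn

theorem nome_eq (τ : ℂ) : nome τ = exp (Real.pi * I * τ) ^ 2 := by
  rw [nome, ← exp_nat_mul]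
  push_cast
  ring_nf

theorem norm_nome_lt_one {τ : ℂ} (hτ' : 0 < τ.im) : ‖nome τ‖ < 1 := by
  rw [nome, norm_exp, Real.exp_lt_one_iff]
  have := Real.pi_pos
  simp
  positivity

theorem summable_nome {τ : ℂ} (hτ' : 0 < τ.im) (w : ℂ) :
    Summable fun j : ℕ => ‖-(w * nome τ ^ (j + 1))‖ := by
  refine ((summable_geometric_of_lt_one (norm_nonneg _) (norm_nome_lt_one hτ')).mul_left
    (‖w‖ * ‖nome τ‖)).congr fun j => ?_
  rw [norm_neg, norm_mul, norm_pow]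
  ring

/-- The infinite product `∏ (1 - w p^{j+1})`. -/
noncomputable def qPochShift (τ w : ℂ) : ℂ := ∏' j : ℕ, (1 + -(w * nome τ ^ (j + 1)))

theorem qPochShift_one (τ : ℂ) : qPochShift τ 1 = qPochInf τ := by
  simp [qPochShift, qPochInf, sub_eq_add_neg]

theorem qPochInf_ne_zero {τ : ℂ} (hτ' : 0 < τ.im) : qPochInf τ ≠ 0 := by
  rw [← qPochShift_one, qPochShift]
  refine tprod_one_add_ne_zero_of_summable (fun j h => ?_) (summable_nome hτ' 1)
  have h1 : nome τ ^ (j + 1) = 1 := by linear_combination -h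
  have h2 : ‖nome τ ^ (j + 1)‖ < 1 := by
    rw [norm_pow]
    exact pow_lt_one₀ (norm_nonneg _) (norm_nome_lt_one hτ') (by omega)
  rw [h1, norm_one] at h2
  exact lt_irrefl _ h2

theorem continuousAt_qPochShift {τ : ℂ} (hτ' : 0 < τ.im) : ContinuousAt (qPochShift τ) 1 := by
  have hu : Summable fun j : ℕ => 2 * ‖nome τ‖ ^ (j + 1) :=
    (((summable_nat_add_iff 1).2
      (summable_geometric_of_lt_one (norm_nonneg _) (norm_nome_lt_one hτ'))).mul_left 2)
  have h := hu.hasProdUniformlyOn_nat_one_add (f := fun j w => -(w * nome τ ^ (j + 1)))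
    (isCompact_closedBall (0 : ℂ) 2) (Filter.Eventually.of_forall fun n x hx => by
      rw [norm_neg, norm_mul, norm_pow]
      exact mul_le_mul_of_nonneg_right (by simpa using hx) (by positivity))
    (fun j => by fun_prop)
  have h2 := (hasProdUniformlyOn_iff_tendstoUniformlyOn.1 h).continuousOn
    (Filter.Frequently.of_forall fun s => by fun_prop)
  exact h2.continuousAt (Metric.closedBall_mem_nhds_of_mem (by simp))

/-- A factor of the triple product can vanish only if ±2z + (2j+1)τ is an odd integer. The strips
|Im z| < Im τ/2 and |Re z| < 1/2 avoid this, by comparing imaginary or real parts. -/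
theorem jacobiTheta₂_ne_zero {τ : ℂ} (hτ : τ.re = 0) (hτ' : 0 < τ.im) {z : ℂ}
    (h : ∀ (j : ℕ) (n : ℤ), 2 * z + (2 * j + 1) * τ ≠ 1 + 2 * n ∧
      -(2 * z) + (2 * j + 1) * τ ≠ 1 + 2 * n) : jacobiTheta₂ z τ ≠ 0 := by
  have h0 : 0 < Real.exp (-(Real.pi * τ.im)) := Real.exp_pos _
  have h1 : Real.exp (-(Real.pi * τ.im)) < 1 :=
    Real.exp_lt_one_iff.2 (by have := Real.pi_pos; nlinarith)
  rw [jacobiTheta₂_eq_tprod hτ hτ']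
  refine mul_ne_zero (qPochInf_ne_zero hτ') (mul_ne_zero ?_ ?_)
  · refine tprod_one_add_ne_zero_of_summable (fun j hj => ?_) ?_
    · obtain ⟨n, hn⟩ := exists_int_of_one_add_eq_zero hj
      exact (h j n).1 hn
    · rw [exp_pi_I_tau hτ]
      exact summable_pow_mul_geometric h0 h1 _
  · refine tprod_one_add_ne_zero_of_summable (fun j hj => ?_) ?_
    · rw [← exp_neg, ← mul_neg] at hj
      obtain ⟨n, hn⟩ := exists_int_of_one_add_eq_zero hj
      exact (h j n).2 (by linear_combination hn)
    · rw [exp_pi_I_tau hτ]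
      exact summable_pow_mul_geometric h0 h1 _

theorem evenTheta_ne_zero_of_im {τ : ℂ} (hτ : τ.re = 0) (hτ' : 0 < τ.im) {z : ℂ}
    (hz : |z.im| < τ.im / 2) : evenTheta τ z ≠ 0 := by
  rw [evenTheta_eq_jacobiTheta₂]
  refine mul_ne_zero (exp_ne_zero _) (jacobiTheta₂_ne_zero hτ hτ' fun j n => ?_)
  obtain ⟨h1, h2⟩ := abs_lt.1 hz
  have hj : 0 ≤ (j : ℝ) * τ.im := by positivity
  constructor <;> intro h <;> have h' := congrArg Complex.im h <;> simp at h' <;> nlinarith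

theorem evenTheta_ne_zero_of_re {τ : ℂ} (hτ : τ.re = 0) (hτ' : 0 < τ.im) {z : ℂ}
    (hz : |z.re| < 1 / 2) : evenTheta τ z ≠ 0 := by
  rw [evenTheta_eq_jacobiTheta₂]
  refine mul_ne_zero (exp_ne_zero _) (jacobiTheta₂_ne_zero hτ hτ' fun j n => ?_)
  obtain ⟨h1, h2⟩ := abs_lt.1 hz
  constructor <;> intro h <;> have h' := congrArg Complex.re h <;> simp [hτ] at h'
  · have h3 : -1 < 1 + 2 * (n : ℝ) := by linarith
    have h4 : 1 + 2 * (n : ℝ) < 1 := by linarith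
    norm_cast at h3 h4
    omega
  · have h3 : -1 < 1 + 2 * (n : ℝ) := by linarith
    have h4 : 1 + 2 * (n : ℝ) < 1 := by linarith
    norm_cast at h3 h4
    omega

/-- Subtracting (1+τ)/2 carries the strips 0 < Re < 1 and 0 < Im < Im τ into the zero-free strips of
T. Oddness covers the negative side, and only the origin remains. -/
theorem theta_ne_zero {τ : ℂ} (hτ : τ.re = 0) (hτ' : 0 < τ.im) {z : ℂ} (hz : z ≠ 0)
    (hre : |z.re| < 1) (him : |z.im| < τ.im) : theta τ z ≠ 0 := by
  obtain ⟨h1, h2⟩ := abs_lt.1 hre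
  obtain ⟨h3, h4⟩ := abs_lt.1 him
  have key : ∀ w : ℂ, (0 < w.re ∧ w.re < 1) ∨ (0 < w.im ∧ w.im < τ.im) → theta τ w ≠ 0 := by
    intro w hw
    rw [theta_eq_evenTheta]
    refine mul_ne_zero (exp_ne_zero _) ?_
    rcases hw with h | h
    · refine evenTheta_ne_zero_of_re hτ hτ' ?_
      simp only [sub_re, one_div, Complex.div_ofNat_re, hτ]
      norm_num
      rw [abs_lt]
      constructor <;> linarith
    · refine evenTheta_ne_zero_of_im hτ hτ' ?_
      simp only [sub_im, one_div, Complex.div_ofNat_im]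
      norm_num
      rw [abs_lt]
      constructor <;> linarith
  have key' : ∀ w : ℂ, theta τ (-w) ≠ 0 → theta τ w ≠ 0 := fun w h h' => h (by rw [theta_neg, h', neg_zero])
  rcases lt_trichotomy z.re 0 with h | h | h
  · exact key' z (key _ (Or.inl (by simp; constructor <;> linarith)))
  · rcases lt_trichotomy z.im 0 with h5 | h5 | h5
    · exact key' z (key _ (Or.inr (by simp; constructor <;> linarith)))
    · exact absurd (Complex.ext h h5) hz
    · exact key z (Or.inr ⟨h5, h4⟩)
  · exact key z (Or.inl ⟨h, h2⟩)

/-- The factor 1 − e^{2πix} isolates the zero at the origin, so that the rest of the product only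
has to be evaluated at x = 0. -/
theorem theta_eq_qPochShift {τ : ℂ} (hτ : τ.re = 0) (hτ' : 0 < τ.im) (x : ℂ) :
    theta τ x = (I * exp (Real.pi * I * (τ / 4 - x)) * (1 - exp (2 * Real.pi * I * x))) *
      (qPochInf τ * qPochShift τ (exp (2 * Real.pi * I * x)) *
        qPochShift τ (exp (-(2 * Real.pi * I * x)))) := by
  have hw : exp (2 * Real.pi * I * (x + 1 / 2 - τ / 2)) =
      -(exp (2 * Real.pi * I * x) * (exp (Real.pi * I * τ))⁻¹) := by
    rw [← exp_neg, ← exp_add, ← neg_one_mul, ← exp_pi_mul_I, ← exp_add]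
    ring_nf
  have hq := exp_ne_zero (Real.pi * I * τ)
  rw [theta_eq_jacobiTheta₂, jacobiTheta₂_eq_tprod hτ hτ', hw, exp_neg]
  have e1 : ∏' j : ℕ, (1 + -(exp (2 * Real.pi * I * x) * (exp (Real.pi * I * τ))⁻¹) *
      exp (Real.pi * I * τ) ^ (2 * j + 1)) =
      (1 - exp (2 * Real.pi * I * x)) * qPochShift τ (exp (2 * Real.pi * I * x)) := by
    have e : ∀ j : ℕ, 1 + -(exp (2 * Real.pi * I * x) * (exp (Real.pi * I * τ))⁻¹) *
      exp (Real.pi * I * τ) ^ (2 * j + 1) = 1 + -(exp (2 * Real.pi * I * x) * nome τ ^ j) := by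
      intro j
      rw [nome_eq]
      field_simp
      ring
    rw [tprod_congr e, tprod_eq_zero_mul' (f := fun j : ℕ =>
      1 + -(exp (2 * Real.pi * I * x) * nome τ ^ j))
      (multipliable_one_add_of_summable (summable_nome hτ' _)), qPochShift]
    simp [sub_eq_add_neg]
  have e2 : ∏' j : ℕ, (1 + (-(exp (2 * Real.pi * I * x) * (exp (Real.pi * I * τ))⁻¹))⁻¹ *
      exp (Real.pi * I * τ) ^ (2 * j + 1)) = qPochShift τ (exp (2 * Real.pi * I * x))⁻¹ := by
    rw [qPochShift]
    refine tprod_congr fun j => ?_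
    rw [nome_eq, inv_neg, mul_inv, inv_inv]
    ring
  rw [e1, e2]
  ring

/-- Since θ = f·g with f(0) = 0, the difference quotient is that of f times g. Continuity of g at 0
therefore suffices, and the infinite products need not be differentiated. -/
theorem deriv_theta_zero {τ : ℂ} (hτ : τ.re = 0) (hτ' : 0 < τ.im) :
    deriv (theta τ) 0 = 2 * Real.pi * exp (Real.pi * I * τ / 4) * qPochInf τ ^ 3 := by
  set f : ℂ → ℂ := fun x => I * exp (Real.pi * I * (τ / 4 - x)) * (1 - exp (2 * Real.pi * I * x))
  set g : ℂ → ℂ := fun x => qPochInf τ * qPochShift τ (exp (2 * Real.pi * I * x)) *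
        qPochShift τ (exp (-(2 * Real.pi * I * x)))
  have hfg : theta τ = fun x => f x * g x := funext (theta_eq_qPochShift hτ hτ')
  have hg0 : g 0 = qPochInf τ ^ 3 := by
    simp only [g, mul_zero, neg_zero, exp_zero, qPochShift_one]
    ring
  have hgc : ContinuousAt g 0 := by
    have hc := continuousAt_qPochShift hτ'
    have h1 : ContinuousAt (fun x : ℂ => qPochShift τ (exp (2 * Real.pi * I * x))) 0 :=
      ContinuousAt.comp (g := qPochShift τ) (by simpa using hc) (by fun_prop)
    have h2 : ContinuousAt (fun x : ℂ => qPochShift τ (exp (-(2 * Real.pi * I * x)))) 0 :=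
      ContinuousAt.comp (g := qPochShift τ) (by simpa using hc) (by fun_prop)
    exact (continuousAt_const.mul h1).mul h2
  have hf0 : f 0 = 0 := by simp [f]
  have hf : HasDerivAt f (2 * Real.pi * exp (Real.pi * I * τ / 4)) 0 := by
    have h1 : HasDerivAt (fun x : ℂ => 1 - exp (2 * Real.pi * I * x))
        (-(exp (2 * Real.pi * I * 0) * (2 * Real.pi * I * 1))) 0 :=
      (((hasDerivAt_id' (0 : ℂ)).const_mul _).cexp).const_sub _
    have h2 : HasDerivAt (fun x : ℂ => I * exp (Real.pi * I * (τ / 4 - x)))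
        (I * (exp (Real.pi * I * (τ / 4 - 0)) * (Real.pi * I * -1))) 0 :=
      (((hasDerivAt_id' (0 : ℂ)).const_sub _).const_mul _).cexp.const_mul _
    refine (congrArg (fun d => HasDerivAt f d 0) ?_).mp (h2.mul h1)
    simp only [mul_zero, exp_zero, sub_zero, sub_self, mul_one, one_mul, zero_add]
    rw [show (Real.pi : ℂ) * I * τ / 4 = Real.pi * I * (τ / 4) by ring]
    linear_combination (-(2 * Real.pi * exp (Real.pi * I * (τ / 4)))) * I_sq
  refine HasDerivAt.deriv ?_
  rw [hasDerivAt_iff_tendsto_slope] at hf ⊢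
  rw [← hg0]
  refine (hf.mul (hgc.tendsto.mono_left nhdsWithin_le_nhds)).congr fun x => ?_
  simp only [slope_def_field, hfg, hf0]
  ring

/-! ### Integrals over the torus and contour shifts. -/

/-- The integral of `K` over the torus `ℝ/ℤ × ℝ/tℤ`. -/
noncomputable def torusInt (t : ℝ) (K : ℝ → ℝ → ℂ) : ℂ :=
  ∫ y in (0 : ℝ)..t, ∫ x in (0 : ℝ)..1, K x y

/-- Cauchy's theorem on a rectangle gives the shift by the imaginary part of c, the vertical sides
cancelling by periodicity; the real part is a shift along a period. Only the strip swept out has to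
be free of singularities. -/
theorem integral_add_const_of_periodic {g : ℂ → ℂ} {P : ℝ} {c : ℂ}
    (hP : ∀ z : ℂ, z.im ∈ Set.uIcc 0 c.im → g (z + P) = g z)
    (hg : ∀ z : ℂ, z.im ∈ Set.uIcc 0 c.im → DifferentiableAt ℂ g z) :
    ∫ x in (0 : ℝ)..P, g (x + c) = ∫ x in (0 : ℝ)..P, g x := by
  have h1 := integral_boundary_rect_eq_zero_of_differentiableOn g 0 (P + c.im * I) (by
    intro z hz
    refine (hg z ?_).differentiableWithinAt
    simpa using hz.2)
  simp only [zero_re, zero_im, add_re, ofReal_re, mul_re, I_re, mul_zero, ofReal_im, I_im,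
    add_im, mul_im, zero_mul, mul_one, sub_self, add_zero, zero_add, ofReal_zero] at h1
  have h2 : ∫ y in (0 : ℝ)..c.im, g (P + y * I) = ∫ y in (0 : ℝ)..c.im, g (y * I) :=
    intervalIntegral.integral_congr fun y hy => by
      rw [add_comm (P : ℂ)]
      exact hP _ (by simpa using hy)
  rw [h2, add_sub_cancel_right] at h1
  have hper : Function.Periodic (fun x : ℝ => g (x + c.im * I)) P := fun x => by
    dsimp only
    rw [← hP (x + c.im * I) (by simp)]
    push_cast
    ring_nf
  have h3 := hper.intervalIntegral_add_eq c.re 0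
  rw [zero_add] at h3
  have h4 := intervalIntegral.integral_comp_add_right (fun x : ℝ => g (x + c.im * I)) c.re
    (a := 0) (b := P)
  rw [sub_eq_zero.1 h1, ← h3, add_comm c.re P, ← zero_add c.re, ← add_assoc, add_zero, ← h4]
  refine intervalIntegral.integral_congr fun x _ => ?_
  congr 1
  conv_lhs => rw [← re_add_im c]
  push_cast
  ring

theorem torusInt_swap {t : ℝ} {K : ℝ → ℝ → ℂ} (hK : Continuous fun p : ℝ × ℝ => K p.1 p.2) :
    torusInt t K = ∫ x in (0 : ℝ)..1, ∫ y in (0 : ℝ)..t, K x y := by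
  rw [torusInt, MeasureTheory.intervalIntegral_intervalIntegral_swap]
  have hK' : Continuous (Function.uncurry fun y x => K x y) := hK.comp continuous_swap
  refine (hK'.continuousOn.integrableOn_compact ((isCompact_uIcc (a := 0) (b := t)).prod
    (isCompact_uIcc (a := 0) (b := 1)))).mono_set ?_
  exact Set.prod_mono Set.uIoc_subset_uIcc Set.uIoc_subset_uIcc

/-- The one-variable shift is applied in x and then, after exchanging the integrals, in y. The two
shifts are complex and independent, which is what allows u to move while v stays fixed. -/
theorem torusInt_add_const {t : ℝ} {K : ℂ → ℂ → ℂ} {c d : ℂ} (hx : ∀ x y, K (x + 1) y = K x y)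
    (hy : ∀ x y, K x (y + t) = K x y)
    (hdx : ∀ x y : ℂ, x.im ∈ Set.uIcc 0 c.im → y.im ∈ Set.uIcc 0 d.im →
      DifferentiableAt ℂ (fun x => K x y) x)
    (hdy : ∀ x y : ℂ, x.im ∈ Set.uIcc 0 c.im → y.im ∈ Set.uIcc 0 d.im →
      DifferentiableAt ℂ (K x) y)
    (hc : Continuous fun p : ℝ × ℝ => K p.1 (p.2 + d))
    (hc' : Continuous fun p : ℝ × ℝ => K p.1 p.2) :
    torusInt t (fun x y => K (x + c) (y + d)) = torusInt t (fun x y => K x y) := by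
  have h1 : torusInt t (fun x y => K (x + c) (y + d)) = torusInt t (fun x y => K x (y + d)) := by
    refine intervalIntegral.integral_congr fun y _ => ?_
    have := integral_add_const_of_periodic (g := fun x => K x (y + d)) (P := 1) (c := c)
      (fun z _ => by simpa using hx z _) (fun z hz => hdx z _ hz (by simp))
    simpa using this
  rw [h1, torusInt_swap hc, torusInt_swap hc']
  refine intervalIntegral.integral_congr fun x _ => ?_
  exact integral_add_const_of_periodic (g := K x) (fun z _ => hy _ z) (fun z hz => hdy x z (by simp) hz)

theorem integral_comp_neg_of_periodic {g : ℝ → ℂ} {P : ℝ} (hP : Function.Periodic g P) :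
    ∫ x in (0 : ℝ)..P, g (-x) = ∫ x in (0 : ℝ)..P, g x := by
  rw [intervalIntegral.integral_comp_neg]
  have := hP.intervalIntegral_add_eq (-P) 0
  simpa using this

theorem torusInt_neg {t : ℝ} {K : ℝ → ℝ → ℂ} (hx : ∀ x y, K (x + 1) y = K x y)
    (hy : ∀ x y, K x (y + t) = K x y) :
    torusInt t (fun x y => K (-x) (-y)) = torusInt t K := by
  have h : Function.Periodic (fun y => ∫ x in (0 : ℝ)..1, K x y) t := fun y => by simp only [hy]
  rw [torusInt, torusInt, ← integral_comp_neg_of_periodic h]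
  refine intervalIntegral.integral_congr fun y _ => ?_
  exact integral_comp_neg_of_periodic (g := fun x => K x (-y)) fun x => hx _ _

theorem torusInt_add {t : ℝ} {K L : ℝ → ℝ → ℂ} (hK : Continuous fun p : ℝ × ℝ => K p.1 p.2)
    (hL : Continuous fun p : ℝ × ℝ => L p.1 p.2) :
    torusInt t (fun x y => K x y + L x y) = torusInt t K + torusInt t L := by
  have hK' : Continuous (Function.uncurry fun y x => K x y) := hK.comp continuous_swap
  have hL' : Continuous (Function.uncurry fun y x => L x y) := hL.comp continuous_swap
  rw [torusInt, torusInt, torusInt, ← intervalIntegral.integral_add]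
  · refine intervalIntegral.integral_congr fun y _ => ?_
    refine intervalIntegral.integral_add ?_ ?_
    · exact (hK'.comp (Continuous.prodMk_right y)).intervalIntegrable _ _
    · exact (hL'.comp (Continuous.prodMk_right y)).intervalIntegrable _ _
  · exact (intervalIntegral.continuous_parametric_intervalIntegral_of_continuous' hK' _ _).intervalIntegrable _ _
  · exact (intervalIntegral.continuous_parametric_intervalIntegral_of_continuous' hL' _ _).intervalIntegrable _ _

theorem torusInt_const_mul {t : ℝ} (a : ℂ) (K : ℝ → ℝ → ℂ) :
    torusInt t (fun x y => a * K x y) = a * torusInt t K := by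
  simp only [torusInt, intervalIntegral.integral_const_mul]

theorem torusInt_congr {t : ℝ} {K L : ℝ → ℝ → ℂ} (h : ∀ x y, K x y = L x y) :
    torusInt t K = torusInt t L := by
  rw [show K = L from funext₂ h]

/-! ### The weight as a product over symmetric grids. -/

/-- The product `∏_{k<m} T(s + (2k-m+1)η)` over a symmetric grid. -/
noncomputable def gridProd (τ η : ℂ) (m : ℕ) (s : ℂ) : ℂ :=
  ∏ k ∈ Finset.range m, evenTheta τ (s + (2 * k - (m - 1)) * η)

theorem sum_range_two_mul_sub (m : ℕ) (a : ℂ) :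
    ∑ k ∈ Finset.range m, (2 * (k : ℂ) - a) = m * (m - 1) - m * a := by
  induction m with
  | zero => simp
  | succ m ih =>
    rw [Finset.sum_range_succ, ih]
    push_cast
    ring

theorem gridProd_add_one (τ η : ℂ) (m : ℕ) (s : ℂ) :
    gridProd τ η m (s + 1) = gridProd τ η m s := by
  refine Finset.prod_congr rfl fun k _ => ?_
  rw [add_right_comm, evenTheta_add_one]

/-- The grid is symmetric about 0, so the contributions of η to the exponent cancel. Hence the
multipliers of `gridProd` do not depend on η. -/
theorem prod_exp_grid (a b η : ℂ) (m : ℕ) :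
    ∏ k ∈ Finset.range m, exp (a + b * ((2 * k - (m - 1)) * η)) = exp (m * a) := by
  rw [← exp_sum, Finset.sum_add_distrib, ← Finset.mul_sum, ← Finset.sum_mul,
    sum_range_two_mul_sub]
  simp

theorem gridProd_add_tau (τ η : ℂ) (m : ℕ) (s : ℂ) :
    gridProd τ η m (s + τ) = exp (-(Real.pi * I * m * (τ + 2 * s))) * gridProd τ η m s := by
  have h := prod_exp_grid (-(Real.pi * I * (τ + 2 * s))) (-(2 * Real.pi * I)) η m
  rw [show -(Real.pi * I * m * (τ + 2 * s)) = m * -(Real.pi * I * (τ + 2 * s)) by ring, ← h,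
    gridProd, gridProd, ← Finset.prod_mul_distrib]
  refine Finset.prod_congr rfl fun k _ => ?_
  rw [add_right_comm, evenTheta_add_tau]
  ring_nf

theorem gridProd_neg (τ η : ℂ) (m : ℕ) (s : ℂ) : gridProd τ η m (-s) = gridProd τ η m s := by
  rw [gridProd, gridProd, ← Finset.prod_range_reflect]
  refine Finset.prod_congr rfl fun k hk => ?_
  have hk := Finset.mem_range.1 hk
  rw [← evenTheta_neg, show ((m - 1 - k : ℕ) : ℂ) = m - 1 - k by
    rw [Nat.cast_sub (by omega), Nat.cast_sub (by omega)]; simp]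
  ring_nf

theorem gridProd_succ (τ η : ℂ) (m : ℕ) (s : ℂ) :
    gridProd τ η (m + 1) s = gridProd τ η m (s - η) * evenTheta τ (s + m * η) := by
  rw [gridProd, Finset.prod_range_succ, gridProd]
  congr 1
  · refine Finset.prod_congr rfl fun k hk => ?_
    push_cast
    ring_nf
  · push_cast
    ring_nf

theorem differentiable_gridProd {τ : ℂ} (hτ' : 0 < τ.im) (η : ℂ) (m : ℕ) :
    Differentiable ℂ (gridProd τ η m) := by
  have h := differentiable_evenTheta hτ'
  have e : gridProd τ η m = fun s => ∏ k ∈ Finset.range m, evenTheta τ (s + (2 * k - (m - 1)) * η) := rfl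
  rw [e]
  fun_prop

theorem abs_grid_le {m k : ℕ} (hk : k < m) : |2 * (k : ℝ) - (m - 1)| ≤ m - 1 := by
  have h : (k : ℝ) + 1 ≤ m := by exact_mod_cast hk
  have h0 : (0 : ℝ) ≤ k := Nat.cast_nonneg k
  rw [abs_le]
  constructor <;> linarith

theorem gridProd_ne_zero_of_im {τ : ℂ} (hτ : τ.re = 0) (hτ' : 0 < τ.im) {η : ℂ} {m : ℕ} {s : ℂ}
    (hs : |s.im| + (m - 1) * |η.im| < τ.im / 2) : gridProd τ η m s ≠ 0 := by
  refine Finset.prod_ne_zero_iff.2 fun k hk => evenTheta_ne_zero_of_im hτ hτ' ?_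
  have h1 : (s + (2 * k - (m - 1)) * η).im = s.im + (2 * k - (m - 1)) * η.im := by simp
  rw [h1]
  refine lt_of_le_of_lt (abs_add_le _ _) (lt_of_le_of_lt ?_ hs)
  rw [abs_mul]
  gcongr
  exact abs_grid_le (Finset.mem_range.1 hk)

theorem gridProd_ne_zero_of_re {τ : ℂ} (hτ : τ.re = 0) (hτ' : 0 < τ.im) {η : ℂ} {m : ℕ} {s : ℂ}
    (hs : |s.re| + (m - 1) * |η.re| < 1 / 2) : gridProd τ η m s ≠ 0 := by
  refine Finset.prod_ne_zero_iff.2 fun k hk => evenTheta_ne_zero_of_re hτ hτ' ?_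
  have h1 : (s + (2 * k - (m - 1)) * η).re = s.re + (2 * k - (m - 1)) * η.re := by simp
  rw [h1]
  refine lt_of_le_of_lt (abs_add_le _ _) (lt_of_le_of_lt ?_ hs)
  rw [abs_mul]
  gcongr
  exact abs_grid_le (Finset.mem_range.1 hk)

/-- Each half-period shift costs an exponential; by symmetry of the grid their product is
e^{−2πiu(N+2)}, exactly what the prefactor of the weight removes. -/
theorem weight_eq (τ η : ℂ) (N : ℕ) (u v : ℂ) :
    weight τ η N u v = theta τ (2 * u) * theta τ (2 * v) /
      (gridProd τ η (N + 2) (u + v) * gridProd τ η (N + 2) (u - v)) := by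
  have h := prod_exp_grid (-(2 * Real.pi * I * u)) (-(2 * Real.pi * I)) η (N + 2)
  have h2 : ∏ k ∈ Finset.range (N + 2),
        (theta τ (u + v + (2 * k - N - 1) * η + 1 / 2 + τ / 2) *
          theta τ (u - v + (2 * k - N - 1) * η + 1 / 2 + τ / 2)) =
      exp (-(2 * Real.pi * I * u * (N + 2))) *
        (gridProd τ η (N + 2) (u + v) * gridProd τ η (N + 2) (u - v)) := by
    rw [show -(2 * Real.pi * I * u * (N + 2)) = ((N + 2 : ℕ) : ℂ) * -(2 * Real.pi * I * u) by
      push_cast; ring, ← h, gridProd, gridProd, ← Finset.prod_mul_distrib,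
      ← Finset.prod_mul_distrib]
    refine Finset.prod_congr rfl fun k _ => ?_
    rw [theta_add_half_period, theta_add_half_period, mul_mul_mul_comm, ← exp_add]
    push_cast
    ring_nf
  rw [weight, h2, ← mul_assoc, ← exp_add]
  simp

/-- The integrand of the bilinear form attached to the invariant metric. -/
noncomputable def pairKer (τ η : ℂ) (N : ℕ) (F G : ℂ → ℂ) (u v : ℂ) : ℂ :=
  F u * G v * (theta τ (2 * u) * theta τ (2 * v)) /
    (gridProd τ η (N + 2) (u + v) * gridProd τ η (N + 2) (u - v))

/-- The bilinear form attached to the invariant metric. -/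
noncomputable def pairing (τ η : ℂ) (N : ℕ) (F G : ℂ → ℂ) : ℂ :=
  torusInt τ.im fun x y => pairKer τ η N F G (x + I * y) (x - I * y)

/-! ### Lowering operators and their adjoints. -/

theorem evenTheta_mul_evenTheta (τ A u v : ℂ) :
    evenTheta τ (u + v + A) * evenTheta τ (u - v + A) =
      -(exp (2 * Real.pi * I * v) * (theta τ (u + (v + A + 1 / 2 + τ / 2)) *
        theta τ (u + (-v + A - 1 / 2 - τ / 2)))) := by
  have h := theta_add_half_period τ (u + v + A)
  have h2 := theta_add_half_period τ (-(u - v + A))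
  rw [evenTheta_neg, show -(u - v + A) + 1 / 2 + τ / 2 = -(u + (-v + A - 1 / 2 - τ / 2)) by ring,
    theta_neg] at h2
  rw [show u + (v + A + 1 / 2 + τ / 2) = u + v + A + 1 / 2 + τ / 2 by ring, h,
    neg_eq_iff_eq_neg.1 h2]
  have e : exp (2 * Real.pi * I * v) * (exp (-(Real.pi * I * (u + v + A))) *
      exp (-(Real.pi * I * -(u - v + A)))) = 1 := by
    rw [← exp_add, ← exp_add]
    ring_nf
    simp
  linear_combination (-(evenTheta τ (u + v + A) * evenTheta τ (u - v + A))) * e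

/-- The three-term identity behind the adjointness of lowering operators and multiplication. -/
theorem theta_evenTheta_three_term {τ : ℂ} (hτ' : 0 < τ.im) (A c u v : ℂ) :
    theta τ (u + (c - A)) * theta τ (u + (-c - A)) *
        (evenTheta τ (u + v + A) * evenTheta τ (u - v + A)) -
      theta τ (-u + (c - A)) * theta τ (-u + (-c - A)) *
        (evenTheta τ (-u + v + A) * evenTheta τ (-u - v + A)) =
    -(theta τ (2 * A) * (theta τ (2 * u) * (evenTheta τ (c + v) * evenTheta τ (c - v)))) := by
  have h := theta_weierstrass hτ' u (c - A) (-c - A) (v + A + 1 / 2 + τ / 2)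
    (-v + A - 1 / 2 - τ / 2) (by ring)
  have h3 := evenTheta_mul_evenTheta τ 0 c v
  have e := theta_neg τ (2 * A)
  rw [show c - A + (-c - A) = -(2 * A) by ring, e,
    show c - A + (v + A + 1 / 2 + τ / 2) = c + (v + 0 + 1 / 2 + τ / 2) by ring,
    show c - A + (-v + A - 1 / 2 - τ / 2) = c + (-v + 0 - 1 / 2 - τ / 2) by ring] at h
  rw [evenTheta_mul_evenTheta, evenTheta_mul_evenTheta]
  rw [add_zero, add_zero] at h3
  rw [h3]
  linear_combination (-exp (2 * Real.pi * I * v)) * h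

theorem tau_eq {τ : ℂ} (hτ : τ.re = 0) : τ = I * (τ.im : ℂ) := by
  apply Complex.ext <;> simp [hτ]

theorem ThetaSpace_sub_tau {τ : ℂ} {N : ℕ} {G : ℂ → ℂ} (hG : G ∈ ThetaSpace τ N) (v : ℂ) :
    G (v - τ) = exp (2 * Real.pi * I * N * (2 * v - τ)) * G v := by
  have h := hG.2.2.1 (v - τ)
  rw [sub_add_cancel] at h
  rw [h, ← mul_assoc, ← exp_add]
  ring_nf
  simp

theorem theta_two_mul_sub_two_tau (τ v : ℂ) :
    theta τ (2 * (v - τ)) = exp (4 * Real.pi * I * (2 * v - τ)) * theta τ (2 * v) := by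
  have h := theta_add_tau τ (2 * (v - τ) + τ)
  rw [show 2 * (v - τ) + τ + τ = 2 * v by ring, theta_add_tau] at h
  have e : exp (4 * Real.pi * I * (2 * v - τ)) * (exp (-(Real.pi * I * (τ + 2 * (2 * (v - τ) + τ)))) *
      exp (-(Real.pi * I * (τ + 2 * (2 * (v - τ)))))) = 1 := by
    rw [← exp_add, ← exp_add]
    ring_nf
    simp
  rw [h]
  linear_combination (-theta τ (2 * (v - τ))) * e

theorem theta_add_two (τ x : ℂ) : theta τ (x + 2) = theta τ x := by
  rw [show x + 2 = x + 1 + 1 by ring, theta_add_one, theta_add_one, neg_neg]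

theorem gridProd_add_two (τ η : ℂ) (m : ℕ) (s : ℂ) :
    gridProd τ η m (s + 2) = gridProd τ η m s := by
  rw [show s + 2 = s + 1 + 1 by ring, gridProd_add_one, gridProd_add_one]

theorem gridProd_add_two_tau (τ η : ℂ) (m : ℕ) (s : ℂ) :
    gridProd τ η m (s + 2 * τ) = exp (-(4 * Real.pi * I * m * (s + τ))) * gridProd τ η m s := by
  rw [show s + 2 * τ = s + τ + τ by ring, gridProd_add_tau, gridProd_add_tau, ← mul_assoc,
    ← exp_add]
  ring_nf

/-- The coefficient `θ(u+c-(n+1)η) θ(u-c-(n+1)η)` of the lowering operator with parameter `c`. -/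
noncomputable def lowerCoeff (τ η : ℂ) (n : ℕ) (c u : ℂ) : ℂ :=
  theta τ (u + c - (n + 1) * η) * theta τ (u - c - (n + 1) * η)

/-- One half of the integrand of the form paired with a lowering operator. -/
noncomputable def lowerKer (τ η : ℂ) (n : ℕ) (c : ℂ) (F G : ℂ → ℂ) (u v : ℂ) : ℂ :=
  lowerCoeff τ η n c u * F (u + η) * G v * theta τ (2 * v) /
    (gridProd τ η (n + 2) (u + v) * gridProd τ η (n + 2) (u - v))

theorem lowerKer_add_one {τ η : ℂ} {n : ℕ} {c : ℂ} {F G : ℂ → ℂ} (hF : F ∈ ThetaSpace τ (n + 1))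
    (hG : G ∈ ThetaSpace τ n) (u v : ℂ) :
    lowerKer τ η n c F G (u + 1) (v + 1) = lowerKer τ η n c F G u v := by
  rw [lowerKer, lowerKer, lowerCoeff, lowerCoeff, hG.2.1, show u + 1 + η = u + η + 1 by ring,
    hF.2.1, show u + 1 + c - (n + 1) * η = u + c - (n + 1) * η + 1 by ring,
    show u + 1 - c - (n + 1) * η = u - c - (n + 1) * η + 1 by ring, theta_add_one, theta_add_one,
    show 2 * (v + 1) = 2 * v + 2 by ring, theta_add_two, show u + 1 + (v + 1) = u + v + 2 by ring,
    gridProd_add_two, show u + 1 - (v + 1) = u - v by ring]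
  ring

/-- As τ = i Im τ, this joint shift is y → y + Im τ in the torus coordinates. The multipliers of the
coefficient, of F, of G and of θ(2v) together match that of the grid product in u−v. -/
theorem lowerKer_add_tau {τ η : ℂ} {n : ℕ} {c : ℂ} {F G : ℂ → ℂ} (hF : F ∈ ThetaSpace τ (n + 1))
    (hG : G ∈ ThetaSpace τ n) (u v : ℂ) :
    lowerKer τ η n c F G (u + τ) (v - τ) = lowerKer τ η n c F G u v := by
  rw [lowerKer, lowerKer, lowerCoeff, lowerCoeff, ThetaSpace_sub_tau hG,
    show u + τ + η = u + η + τ by ring,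
    hF.2.2.1, show u + τ + c - (n + 1) * η = u + c - (n + 1) * η + τ by ring,
    show u + τ - c - (n + 1) * η = u - c - (n + 1) * η + τ by ring, theta_add_tau, theta_add_tau,
    theta_two_mul_sub_two_tau, show u + τ + (v - τ) = u + v by ring,
    show u + τ - (v - τ) = u - v + 2 * τ by ring, gridProd_add_two_tau]
  have e : exp (-(Real.pi * I * (τ + 2 * (u + c - (n + 1) * η)))) *
      exp (-(Real.pi * I * (τ + 2 * (u - c - (n + 1) * η)))) *
      exp (-(2 * Real.pi * I * ((n + 1 : ℕ) : ℂ) * (2 * (u + η) + τ))) *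
      exp (2 * Real.pi * I * n * (2 * v - τ)) * exp (4 * Real.pi * I * (2 * v - τ)) =
      exp (-(4 * Real.pi * I * ((n + 2 : ℕ) : ℂ) * (u - v + τ))) := by
    simp only [← exp_add]
    congr 1
    push_cast
    ring
  rw [← e]
  have h1 := exp_ne_zero (-(Real.pi * I * (τ + 2 * (u + c - (n + 1) * η))))
  have h2 := exp_ne_zero (-(Real.pi * I * (τ + 2 * (u - c - (n + 1) * η))))
  have h3 := exp_ne_zero (-(2 * Real.pi * I * ((n + 1 : ℕ) : ℂ) * (2 * (u + η) + τ)))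
  have h4 := exp_ne_zero (2 * Real.pi * I * n * (2 * v - τ))
  have h5 := exp_ne_zero (4 * Real.pi * I * (2 * v - τ))
  generalize exp (-(Real.pi * I * (τ + 2 * (u + c - (n + 1) * η)))) = E1 at *
  generalize exp (-(Real.pi * I * (τ + 2 * (u - c - (n + 1) * η)))) = E2 at *
  generalize exp (-(2 * Real.pi * I * ((n + 1 : ℕ) : ℂ) * (2 * (u + η) + τ))) = E3 at *
  generalize exp (2 * Real.pi * I * n * (2 * v - τ)) = E4 at *
  generalize exp (4 * Real.pi * I * (2 * v - τ)) = E5 at *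
  rw [show gridProd τ η (n + 2) (u + v) * (E1 * E2 * E3 * E4 * E5 * gridProd τ η (n + 2) (u - v)) =
    (E1 * E2 * E3 * E4 * E5) * (gridProd τ η (n + 2) (u + v) * gridProd τ η (n + 2) (u - v)) by ring,
    ← mul_div_mul_left _ (gridProd τ η (n + 2) (u + v) * gridProd τ η (n + 2) (u - v))
      (show E1 * E2 * E3 * E4 * E5 ≠ 0 by positivity)]
  congr 1
  ring

theorem pairKer_eq_lowerKer_add {τ η : ℂ} {n : ℕ} {c : ℂ} {F F' G : ℂ → ℂ}
    (hG : G ∈ ThetaSpace τ n) (hF : ∀ x, F (-x) = F x)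
    (hFF' : ∀ u, theta τ (2 * u) * F' u =
      lowerCoeff τ η n c u * F (u + η) - lowerCoeff τ η n c (-u) * F (u - η)) (u v : ℂ) :
    pairKer τ η n F' G u v = lowerKer τ η n c F G u v + lowerKer τ η n c F G (-u) (-v) := by
  rw [pairKer, lowerKer, lowerKer, hG.2.2.2, mul_neg, theta_neg, ← hF (-u + η),
    show -(-u + η) = u - η by ring, show -u + -v = -(u + v) by ring,
    show -u - -v = -(u - v) by ring, gridProd_neg, gridProd_neg, ← add_div]
  congr 1
  linear_combination G v * theta τ (2 * v) * hFF' u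

/-- The shifted grid of length n+2 lacks one end point of the symmetric grid of length n+3.
Supplying that factor brings the shifted kernel over the denominator of level n+1. -/
theorem lowerKer_sub {τ η : ℂ} {n : ℕ} {c : ℂ} {F G : ℂ → ℂ} {u v : ℂ}
    (h1 : evenTheta τ (u + v + ((n + 2 : ℕ) : ℂ) * η) ≠ 0)
    (h2 : evenTheta τ (u - v + ((n + 2 : ℕ) : ℂ) * η) ≠ 0) :
    lowerKer τ η n c F G (u - η) v = lowerCoeff τ η n c (u - η) *
      (evenTheta τ (u + v + ((n + 2 : ℕ) : ℂ) * η) *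
        evenTheta τ (u - v + ((n + 2 : ℕ) : ℂ) * η)) * F u * G v * theta τ (2 * v) /
      (gridProd τ η (n + 3) (u + v) * gridProd τ η (n + 3) (u - v)) := by
  rw [gridProd_succ τ η (n + 2) (u + v), gridProd_succ τ η (n + 2) (u - v), lowerKer, show u - η + v = u + v - η by ring,
    show u - η - v = u - v - η by ring, sub_add_cancel,
    ← mul_div_mul_right _ _ (mul_ne_zero h1 h2)]
  congr 1 <;> ring

/-- After the shift both halves have the same denominator, and the sum of their numerators is the
left side of the three-term identity with A = (n+2)η. -/
theorem lowerKer_sub_add {τ η : ℂ} (hτ' : 0 < τ.im) {n : ℕ} {c : ℂ} {F G : ℂ → ℂ}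
    (hG : G ∈ ThetaSpace τ n) (hF : ∀ x, F (-x) = F x) {u v : ℂ}
    (h1 : evenTheta τ (u + v + ((n + 2 : ℕ) : ℂ) * η) ≠ 0)
    (h2 : evenTheta τ (u - v + ((n + 2 : ℕ) : ℂ) * η) ≠ 0)
    (h3 : evenTheta τ (-u + -v + ((n + 2 : ℕ) : ℂ) * η) ≠ 0)
    (h4 : evenTheta τ (-u - -v + ((n + 2 : ℕ) : ℂ) * η) ≠ 0) :
    lowerKer τ η n c F G (u - η) v + lowerKer τ η n c F G (-u - η) (-v) =
      -theta τ (2 * ((n + 2) * η)) * pairKer τ η (n + 1) F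
        (fun v => evenTheta τ (c + v) * evenTheta τ (c - v) * G v) u v := by
  rw [lowerKer_sub h1 h2, lowerKer_sub h3 h4, pairKer, hG.2.2.2, mul_neg, theta_neg, hF,
    show -u + -v = -(u + v) by ring,
    show -u - -v = -(u - v) by ring, gridProd_neg, gridProd_neg, ← add_div, ← mul_div_assoc]
  congr 1
  have h := theta_evenTheta_three_term hτ' ((n + 2) * η) c u v
  simp only [lowerCoeff]
  push_cast
  ring_nf at h ⊢
  linear_combination F u * G v * theta τ (v * 2) * h

theorem abs_le_of_mem_uIcc {a b : ℝ} (h : a ∈ Set.uIcc 0 b) : |a| ≤ |b| := by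
  have := Set.abs_sub_left_of_mem_uIcc h
  simpa using this

/-- The adjoint of a lowering operator is a multiplication operator. -/
theorem pairing_lowering {τ : ℂ} (hτ : τ.re = 0) (hτ' : 0 < τ.im) {η : ℂ} {n : ℕ}
    (hre : (n + 2) * |η.re| < 1 / 2) (him : (n + 2) * |η.im| < τ.im / 2) {F F' G : ℂ → ℂ}
    (hF : F ∈ ThetaSpace τ (n + 1)) (hG : G ∈ ThetaSpace τ n) (c : ℂ)
    (hFF' : ∀ u, theta τ (2 * u) * F' u =
      lowerCoeff τ η n c u * F (u + η) - lowerCoeff τ η n c (-u) * F (u - η)) :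
    pairing τ η n F' G = -(theta τ (2 * ((n + 2) * η)) *
      pairing τ η (n + 1) F (fun v => evenTheta τ (c + v) * evenTheta τ (c - v) * G v)) := by
  set J := lowerKer τ η n c F G with hJ
  -- In the variables x, y the two grid products depend on x alone and on y alone, since u+v = 2x
  -- and u−v = 2iy. The strip free of poles can then be checked for each variable separately.
  set K : ℂ → ℂ → ℂ := fun x y => J (x + I * y) (x - I * y) with hK
  have dT := differentiable_theta hτ'
  have dg := differentiable_gridProd hτ' η (n + 2)
  have dF := hF.1
  have dG := hG.1
  have hKx : ∀ x y, K (x + 1) y = K x y := fun x y => by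
    simp only [hK, hJ]
    rw [← lowerKer_add_one hF hG (x + I * y)]
    ring_nf
  have hKy : ∀ x y, K x (y + τ.im) = K x y := fun x y => by
    simp only [hK, hJ]
    rw [← lowerKer_add_tau hF hG (x + I * y), mul_add, ← tau_eq hτ]
    ring_nf
  have hn : ((n + 2 : ℕ) : ℝ) = n + 2 := by push_cast; ring
  -- Moving x by half of η moves the grid argument 2x by η; the grid of length n+2 already reaches
  -- (n+1)η, so the bound with n+2 is just what is needed.
  have nzx : ∀ x : ℂ, |x.im| ≤ |η.im| / 2 → gridProd τ η (n + 2) (2 * x) ≠ 0 := fun x hx => by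
    refine gridProd_ne_zero_of_im hτ hτ' (lt_of_le_of_lt ?_ him)
    simp only [mul_im, re_ofNat, im_ofNat, zero_mul, add_zero, abs_mul, hn]
    norm_num
    linarith
  have nzy : ∀ y : ℂ, |y.im| ≤ |η.re| / 2 → gridProd τ η (n + 2) (2 * (I * y)) ≠ 0 := fun y hy => by
    refine gridProd_ne_zero_of_re hτ hτ' (lt_of_le_of_lt ?_ hre)
    simp only [mul_re, re_ofNat, im_ofNat, zero_mul, I_re, I_im, hn]
    norm_num
    linarith
  have nz : ∀ x y : ℂ, |x.im| ≤ |η.im| / 2 → |y.im| ≤ |η.re| / 2 →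
      gridProd τ η (n + 2) (x + I * y + (x - I * y)) *
        gridProd τ η (n + 2) (x + I * y - (x - I * y)) ≠ 0 := fun x y hx hy => by
    rw [show x + I * y + (x - I * y) = 2 * x by ring,
      show x + I * y - (x - I * y) = 2 * (I * y) by ring]
    exact mul_ne_zero (nzx x hx) (nzy y hy)
  have hcx : (-(η / 2)).im = -(η.im / 2) := by simp
  have hdy : (I * η / 2).im = η.re / 2 := by simp
  have bx : ∀ x : ℂ, x.im ∈ Set.uIcc 0 (-(η / 2)).im → |x.im| ≤ |η.im| / 2 := fun x hx => by
    have := abs_le_of_mem_uIcc hx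
    rwa [hcx, abs_neg, abs_div, abs_two] at this
  have bY : ∀ y : ℂ, y.im ∈ Set.uIcc 0 (I * η / 2).im → |y.im| ≤ |η.re| / 2 := fun y hy => by
    have := abs_le_of_mem_uIcc hy
    rwa [hdy, abs_div, abs_two] at this
  have cont : ∀ c₁ d₁ : ℂ, |c₁.im| ≤ |η.im| / 2 → |d₁.im| ≤ |η.re| / 2 →
      Continuous fun p : ℝ × ℝ => K (p.1 + c₁) (p.2 + d₁) := fun c₁ d₁ h1 h2 => by
    have := dT.continuous
    have := dg.continuous
    have := dF.continuous
    have := dG.continuous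
    simp only [hK, hJ]
    unfold lowerKer lowerCoeff
    refine Continuous.div (by fun_prop) (by fun_prop) fun p => nz _ _ ?_ ?_
    · simpa using h1
    · simpa using h2
  have c00 : Continuous fun p : ℝ × ℝ => K p.1 p.2 := by
    simpa using cont 0 0 (by simp; positivity) (by simp; positivity)
  -- Here u = x + iy becomes u − η, while v = x − iy is unchanged.
  have shift : torusInt τ.im (fun x y => K (x + -(η / 2)) (y + I * η / 2)) =
      torusInt τ.im (fun x y => K x y) := by
    refine torusInt_add_const hKx hKy ?_ ?_ ?_ c00
    · intro x y hx hy
      simp only [hK, hJ]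
      unfold lowerKer lowerCoeff
      exact DifferentiableAt.fun_div (by fun_prop) (by fun_prop) (nz _ _ (bx x hx) (bY y hy))
    · intro x y hx hy
      simp only [hK, hJ]
      unfold lowerKer lowerCoeff
      exact DifferentiableAt.fun_div (by fun_prop) (by fun_prop) (nz _ _ (bx x hx) (bY y hy))
    · simpa using cont 0 (I * η / 2) (by simp; positivity) (by rw [hdy, abs_div, abs_two])
  have rx : ∀ x y : ℝ, K ((x + 1 : ℝ) : ℂ) y = K x y := fun x y => by
    rw [ofReal_add, ofReal_one, hKx]
  have ry : ∀ x y : ℝ, K x ((y + τ.im : ℝ) : ℂ) = K x y := fun x y => by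
    rw [ofReal_add, hKy]
  have cs := cont (-(η / 2)) (I * η / 2) (by rw [hcx, abs_neg, abs_div, abs_two])
    (by rw [hdy, abs_div, abs_two])
  set L : ℝ → ℝ → ℂ := fun x y => K (x + -(η / 2)) (y + I * η / 2) with hL
  have n1 : torusInt τ.im (fun x y => K (-x : ℝ) (-y : ℝ)) = torusInt τ.im (fun x y => K x y) :=
    torusInt_neg (K := fun x y => K x y) rx ry
  have n2 : torusInt τ.im (fun x y => L (-x) (-y)) = torusInt τ.im L := by
    refine torusInt_neg (fun x y => ?_) (fun x y => ?_)
    · rw [hL]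
      dsimp only
      rw [← hKx (x + -(η / 2))]
      push_cast
      ring_nf
    · rw [hL]
      dsimp only
      rw [← hKy _ (y + I * η / 2)]
      push_cast
      ring_nf
  -- The reflection (x, y) ↦ (−x, −y) preserves the torus integral, so the pairing is twice the
  -- integral of one half. The same symmetrization is undone after the shift in `L2`.
  have L1 : pairing τ η n F' G =
      torusInt τ.im (fun x y => K x y) + torusInt τ.im (fun x y => K (-x : ℝ) (-y : ℝ)) := by
    rw [← torusInt_add c00 (c00.comp (continuous_neg (G := ℝ × ℝ))), pairing]
    refine torusInt_congr fun x y => ?_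
    rw [pairKer_eq_lowerKer_add hG hF.2.2.2 hFF']
    simp only [hK, hJ]
    push_cast
    ring_nf
  have L2 : torusInt τ.im L + torusInt τ.im (fun x y => L (-x) (-y)) = -theta τ (2 * ((n + 2) * η)) *
      pairing τ η (n + 1) F (fun v => evenTheta τ (c + v) * evenTheta τ (c - v) * G v) := by
    rw [← torusInt_add cs (cs.comp (continuous_neg (G := ℝ × ℝ))), pairing, ← torusInt_const_mul]
    refine torusInt_congr fun x y => ?_
    have hT1 : ∀ x : ℝ, evenTheta τ (2 * x + ((n + 2 : ℕ) : ℂ) * η) ≠ 0 := fun x => by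
      refine evenTheta_ne_zero_of_im hτ hτ' ?_
      simp [abs_mul]
      rwa [abs_of_nonneg (by positivity)]
    have hT2 : ∀ y : ℝ, evenTheta τ (2 * (I * y) + ((n + 2 : ℕ) : ℂ) * η) ≠ 0 := fun y => by
      refine evenTheta_ne_zero_of_re hτ hτ' ?_
      simp [abs_mul]
      rw [abs_of_nonneg (by positivity)]
      simpa using hre
    have e1 := hT1 x
    have e2 := hT2 y
    have e3 := hT1 (-x)
    have e4 := hT2 (-y)
    push_cast at e1 e2 e3 e4
    rw [← lowerKer_sub_add hτ' hG hF.2.2.2]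
    · simp only [hL, hK, hJ]
      push_cast
      ring_nf
      simp only [I_sq]
      ring_nf
    · convert e1 using 2
      push_cast
      ring
    · convert e2 using 2
      push_cast
      ring
    · convert e3 using 2
      push_cast
      ring
    · convert e4 using 2
      push_cast
      ring
  rw [L1, n1, ← shift, ← neg_mul, ← L2, n2]

/-! ### The case N = 0. -/

theorem deriv_evenTheta_neg (τ z : ℂ) : deriv (evenTheta τ) (-z) = -deriv (evenTheta τ) z := by
  have h : (fun z => evenTheta τ (-z)) = evenTheta τ := funext (evenTheta_neg τ)
  have h2 := deriv_comp_neg (evenTheta τ) z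
  rw [h] at h2
  rw [h2, neg_neg]

theorem logDeriv_evenTheta_add_one (τ z : ℂ) :
    logDeriv (evenTheta τ) (z + 1) = logDeriv (evenTheta τ) z := by
  have h : (fun z => evenTheta τ (z + 1)) = evenTheta τ := funext (evenTheta_add_one τ)
  have h2 := deriv_comp_add_const (evenTheta τ) 1 z
  rw [h] at h2
  rw [logDeriv_apply, logDeriv_apply, ← h2, evenTheta_add_one]

theorem logDeriv_evenTheta_add_tau {τ : ℂ} (hτ' : 0 < τ.im) {z : ℂ} (hz : evenTheta τ z ≠ 0) :
    logDeriv (evenTheta τ) (z + τ) = logDeriv (evenTheta τ) z - 2 * Real.pi * I := by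
  have hT := differentiable_evenTheta hτ'
  have h : (fun z => evenTheta τ (z + τ)) =
    fun z => exp (-(Real.pi * I * (τ + 2 * z))) * evenTheta τ z := funext (evenTheta_add_tau τ)
  have h2 := deriv_comp_add_const (evenTheta τ) τ z
  have h3 : HasDerivAt (fun z => exp (-(Real.pi * I * (τ + 2 * z))))
      (exp (-(Real.pi * I * (τ + 2 * z))) * -(Real.pi * I * (2 * 1))) z :=
    ((((hasDerivAt_id' z).const_mul 2).const_add τ).const_mul _).neg.cexp
  rw [h, (h3.fun_mul (hT z).hasDerivAt).deriv] at h2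
  rw [logDeriv_apply, logDeriv_apply, ← h2, evenTheta_add_tau]
  have := exp_ne_zero (-(Real.pi * I * (τ + 2 * z)))
  field_simp
  ring

/-- A Weierstrass identity shows that f(u) − f(−u) is a constant multiple of θ(2u). Comparing
derivatives at u = 0 and dividing by f(0), which by evenness is the denominator on the left,
separates the variables s and t. -/
theorem logDeriv_evenTheta_four_term {τ : ℂ} (hτ' : 0 < τ.im) {η s t : ℂ}
    (h1 : evenTheta τ (s + η) ≠ 0) (h2 : evenTheta τ (s - η) ≠ 0)
    (h3 : evenTheta τ (t + η) ≠ 0) (h4 : evenTheta τ (t - η) ≠ 0) :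
    exp (-(Real.pi * I * τ)) * deriv (theta τ) 0 * theta τ (2 * η) *
      (theta τ (s + t) * theta τ (s - t) / (evenTheta τ (s - η) * evenTheta τ (s + η) *
        (evenTheta τ (t - η) * evenTheta τ (t + η)))) =
    (logDeriv (evenTheta τ) (s + η) - logDeriv (evenTheta τ) (s + -η)) -
      (logDeriv (evenTheta τ) (t + η) - logDeriv (evenTheta τ) (t + -η)) := by
  have hT := differentiable_evenTheta hτ'
  set f : ℂ → ℂ := fun u => evenTheta τ (u + s + η) * evenTheta τ (u - s + η) *
    (evenTheta τ (u + t + -η) * evenTheta τ (u - t + -η)) with hf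
  have key : ∀ u, f u - f (-u) = exp (-(Real.pi * I * τ)) * theta τ (2 * η) *
      (theta τ (s + t) * theta τ (s - t)) * theta τ (2 * u) := by
    intro u
    have hw := theta_weierstrass hτ' u (s + η + 1 / 2 + τ / 2) (-s + η - 1 / 2 - τ / 2)
      (t + -η + 1 / 2 + τ / 2) (-t + -η - 1 / 2 - τ / 2) (by ring)
    rw [show s + η + 1 / 2 + τ / 2 + (-s + η - 1 / 2 - τ / 2) = 2 * η by ring,
      show s + η + 1 / 2 + τ / 2 + (t + -η + 1 / 2 + τ / 2) = s + t + τ + 1 by ring,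
      show s + η + 1 / 2 + τ / 2 + (-t + -η - 1 / 2 - τ / 2) = s - t by ring,
      theta_add_one, theta_add_tau] at hw
    have e : exp (2 * Real.pi * I * s) * exp (2 * Real.pi * I * t) *
        exp (-(Real.pi * I * (τ + 2 * (s + t)))) = exp (-(Real.pi * I * τ)) := by
      rw [← exp_add, ← exp_add]
      ring_nf
    simp only [hf, evenTheta_mul_evenTheta]
    rw [← e]
    linear_combination exp (2 * Real.pi * I * s) * exp (2 * Real.pi * I * t) * hw
  have dT : ∀ a : ℂ, HasDerivAt (fun u => evenTheta τ (u + a)) (deriv (evenTheta τ) a) 0 :=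
    fun a => by
      have := (hT (0 + a)).hasDerivAt.comp_add_const 0 a
      rwa [zero_add] at this
  have e1 := dT (s + η)
  have e2 := dT (-s + η)
  have e3 := dT (t + -η)
  have e4 := dT (-t + -η)
  have df := (e1.mul e2).mul (e3.mul e4)
  have hff : f = ((fun u => evenTheta τ (u + (s + η))) * fun u => evenTheta τ (u + (-s + η))) *
      ((fun u => evenTheta τ (u + (t + -η))) * fun u => evenTheta τ (u + (-t + -η))) := by
    funext u
    simp only [hf, Pi.mul_apply]
    ring_nf
  rw [← hff] at df
  have df' := HasDerivAt.comp (h₂ := f) (0 : ℂ) (by rw [neg_zero]; exact df) (hasDerivAt_neg (0 : ℂ))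
  have dth : HasDerivAt (fun u => exp (-(Real.pi * I * τ)) * theta τ (2 * η) *
      (theta τ (s + t) * theta τ (s - t)) * theta τ (2 * u)) (exp (-(Real.pi * I * τ)) *
      theta τ (2 * η) * (theta τ (s + t) * theta τ (s - t)) * (deriv (theta τ) 0 * (2 * 1))) 0 := by
    refine HasDerivAt.const_mul _ ?_
    refine HasDerivAt.comp (h₂ := theta τ) (0 : ℂ) ?_ ((hasDerivAt_id' (0 : ℂ)).const_mul 2)
    rw [mul_zero]
    exact (differentiable_theta hτ' 0).hasDerivAt
  have hd := (df.sub df').unique (dth.congr_of_eventuallyEq (Filter.Eventually.of_forall key))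
  simp only [Pi.mul_apply, zero_add] at hd
  rw [show -s + η = -(s - η) by ring, show -t + -η = -(t + η) by ring, evenTheta_neg,
    evenTheta_neg, deriv_evenTheta_neg, deriv_evenTheta_neg, ← sub_eq_add_neg] at hd
  rw [← sub_eq_add_neg, ← sub_eq_add_neg]
  simp only [logDeriv_apply]
  field_simp
  linear_combination (-1 / 2) * hd

theorem differentiableAt_logDeriv_evenTheta {τ : ℂ} (hτ' : 0 < τ.im) {z : ℂ}
    (hz : evenTheta τ z ≠ 0) : DifferentiableAt ℂ (logDeriv (evenTheta τ)) z := by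
  have hT := differentiable_evenTheta hτ'
  have : logDeriv (evenTheta τ) = fun z => deriv (evenTheta τ) z / evenTheta τ z := by
    funext z
    rw [logDeriv_apply]
  rw [this]
  exact (hT.deriv z).fun_div (hT z) hz

theorem integral_logDeriv_evenTheta_re {τ : ℂ} (hτ : τ.re = 0) (hτ' : 0 < τ.im) {δ : ℂ}
    (hδ : |δ.im| < τ.im / 2) :
    ∫ x in (0 : ℝ)..1, logDeriv (evenTheta τ) (2 * x + δ) =
      ∫ x in (0 : ℝ)..1, logDeriv (evenTheta τ) (2 * x) := by
  have h := integral_add_const_of_periodic (g := fun z => logDeriv (evenTheta τ) (2 * z)) (P := 1)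
    (c := δ / 2) (fun z _ => by
      rw [show 2 * (z + (1 : ℝ)) = 2 * z + 1 + 1 by push_cast; ring, logDeriv_evenTheta_add_one,
        logDeriv_evenTheta_add_one]) (fun z hz => by
      have h1 := abs_le_of_mem_uIcc hz
      have h2 : evenTheta τ (2 * z) ≠ 0 := evenTheta_ne_zero_of_im hτ hτ' (by
        simp [abs_mul] at h1 ⊢
        rw [abs_div, abs_two] at h1
        linarith)
      exact DifferentiableAt.comp z (differentiableAt_logDeriv_evenTheta hτ' h2) (by fun_prop))
  rw [← h]
  refine intervalIntegral.integral_congr fun x _ => ?_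
  ring_nf

/-- T'/T is not τ-periodic but drops by 2πi, so the contour shift does not leave the integral
unchanged: the correction −2πδ is the source of the factor η in the constant C. -/
theorem integral_logDeriv_evenTheta_im {τ : ℂ} (hτ : τ.re = 0) (hτ' : 0 < τ.im) {δ : ℂ}
    (hδ : |δ.re| < 1 / 2) :
    ∫ y in (0 : ℝ)..τ.im, logDeriv (evenTheta τ) (2 * (I * y) + δ) =
      (∫ y in (0 : ℝ)..τ.im, logDeriv (evenTheta τ) (2 * (I * y))) - 2 * Real.pi * δ := by
  have hne : ∀ z : ℂ, |z.im| ≤ |δ.re| / 2 → evenTheta τ (2 * (I * z)) ≠ 0 := fun z hz =>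
    evenTheta_ne_zero_of_re hτ hτ' (by
      simp [abs_mul]
      linarith)
  have ht : (τ.im : ℂ) ≠ 0 := by exact_mod_cast hτ'.ne'
  have hcim : |(-(I * δ / 2)).im| = |δ.re| / 2 := by simp [abs_div]
  have c1 : Continuous fun y : ℝ => logDeriv (evenTheta τ) (2 * (I * y) + δ) :=
    continuous_iff_continuousAt.2 fun y => ContinuousAt.comp (g := logDeriv (evenTheta τ))
      (differentiableAt_logDeriv_evenTheta hτ' (evenTheta_ne_zero_of_re hτ hτ'
        (by simpa using hδ))).continuousAt (by fun_prop)
  have c2 : Continuous fun y : ℝ => logDeriv (evenTheta τ) (2 * (I * y)) :=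
    continuous_iff_continuousAt.2 fun y => ContinuousAt.comp (g := logDeriv (evenTheta τ))
      (differentiableAt_logDeriv_evenTheta hτ' (evenTheta_ne_zero_of_re hτ hτ'
        (by simp))).continuousAt (by fun_prop)
  -- When y grows by Im τ, the argument 2iy grows by 2τ and the logarithmic derivative drops by 4πi.
  -- The linear term restores periodicity.
  set h : ℂ → ℂ := fun z => logDeriv (evenTheta τ) (2 * (I * z)) + 4 * Real.pi * I * z / τ.im with hh
  have key : ∫ y in (0 : ℝ)..τ.im, h (y + -(I * δ / 2)) = ∫ y in (0 : ℝ)..τ.im, h y := by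
    have hs : ∀ z : ℂ, z.im ∈ Set.uIcc 0 (-(I * δ / 2)).im → evenTheta τ (2 * (I * z)) ≠ 0 :=
      fun z hz => hne z (hcim ▸ abs_le_of_mem_uIcc hz)
    refine integral_add_const_of_periodic (fun z hz => ?_) (fun z hz => ?_)
    · have hz1 := hs z hz
      have hz2 : evenTheta τ (2 * (I * z) + τ) ≠ 0 := by
        rw [evenTheta_add_tau]
        exact mul_ne_zero (exp_ne_zero _) hz1
      simp only [hh]
      rw [show 2 * (I * (z + τ.im)) = 2 * (I * z) + τ + τ by
        linear_combination (-2 : ℂ) * tau_eq hτ, logDeriv_evenTheta_add_tau hτ' hz2,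
        logDeriv_evenTheta_add_tau hτ' hz1]
      field_simp
      ring
    · exact (DifferentiableAt.comp z (differentiableAt_logDeriv_evenTheta hτ' (hs z hz))
        (by fun_prop)).add (by fun_prop)
  have l1 : ∫ y in (0 : ℝ)..τ.im, h (y + -(I * δ / 2)) =
      ((∫ y in (0 : ℝ)..τ.im, logDeriv (evenTheta τ) (2 * (I * y) + δ)) +
        ∫ y in (0 : ℝ)..τ.im, 4 * Real.pi * I * y / τ.im) + 2 * Real.pi * δ := by
    have : ∀ y : ℝ, h (y + -(I * δ / 2)) = (logDeriv (evenTheta τ) (2 * (I * y) + δ) +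
        4 * Real.pi * I * y / τ.im) + 2 * Real.pi * δ / τ.im := fun y => by
      simp only [hh]
      rw [show 2 * (I * (y + -(I * δ / 2))) = 2 * (I * y) + δ by linear_combination (-δ) * I_sq]
      linear_combination (-2 * Real.pi * δ / τ.im) * I_sq
    simp only [this]
    rw [intervalIntegral.integral_add, intervalIntegral.integral_add,
      intervalIntegral.integral_const]
    · simp
      field_simp
    · exact c1.intervalIntegrable _ _
    · exact Continuous.intervalIntegrable (by fun_prop) _ _
    · exact Continuous.intervalIntegrable (by fun_prop) _ _
    · exact Continuous.intervalIntegrable (by fun_prop) _ _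
  have l2 : ∫ y in (0 : ℝ)..τ.im, h y =
      (∫ y in (0 : ℝ)..τ.im, logDeriv (evenTheta τ) (2 * (I * y))) +
        ∫ y in (0 : ℝ)..τ.im, 4 * Real.pi * I * y / τ.im := by
    rw [← intervalIntegral.integral_add (c2.intervalIntegrable _ _)
      (Continuous.intervalIntegrable (by fun_prop) _ _)]
  linear_combination key - l1 + l2

theorem pairing_zero_one {τ : ℂ} (hτ : τ.re = 0) (hτ' : 0 < τ.im) {η : ℂ}
    (hre : |η.re| < 1 / 2) (him : |η.im| < τ.im / 2) :
    exp (-(Real.pi * I * τ)) * deriv (theta τ) 0 * theta τ (2 * η) *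
      pairing τ η 0 (fun _ => 1) (fun _ => 1) = 4 * Real.pi * η := by
  have hx : ∀ (x : ℝ) (δ : ℂ), |δ.im| < τ.im / 2 → evenTheta τ (2 * x + δ) ≠ 0 := fun x δ hδ =>
    evenTheta_ne_zero_of_im hτ hτ' (by simpa using hδ)
  have hy : ∀ (y : ℝ) (δ : ℂ), |δ.re| < 1 / 2 → evenTheta τ (2 * (I * y) + δ) ≠ 0 := fun y δ hδ =>
    evenTheta_ne_zero_of_re hτ hτ' (by simpa using hδ)
  have him' : |(-η).im| < τ.im / 2 := by simpa using him
  have hre' : |(-η).re| < 1 / 2 := by simpa using hre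
  have e : ∀ x y : ℝ, exp (-(Real.pi * I * τ)) * deriv (theta τ) 0 * theta τ (2 * η) *
      pairKer τ η 0 (fun _ => 1) (fun _ => 1) (x + I * y) (x - I * y) =
      (logDeriv (evenTheta τ) (2 * x + η) - logDeriv (evenTheta τ) (2 * x + -η)) -
      (logDeriv (evenTheta τ) (2 * (I * y) + η) - logDeriv (evenTheta τ) (2 * (I * y) + -η)) := by
    intro x y
    rw [← logDeriv_evenTheta_four_term hτ' (hx x η him) (hx x (-η) him') (hy y η hre)
      (hy y (-η) hre')]
    simp only [pairKer, gridProd, Finset.prod_range_succ, Finset.prod_range_zero]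
    push_cast
    ring_nf
  have cx : ∀ δ : ℂ, |δ.im| < τ.im / 2 →
      Continuous fun x : ℝ => logDeriv (evenTheta τ) (2 * x + δ) := fun δ hδ =>
    continuous_iff_continuousAt.2 fun x => ContinuousAt.comp (g := logDeriv (evenTheta τ))
      (differentiableAt_logDeriv_evenTheta hτ' (hx x δ hδ)).continuousAt (by fun_prop)
  have cy : ∀ δ : ℂ, |δ.re| < 1 / 2 →
      Continuous fun y : ℝ => logDeriv (evenTheta τ) (2 * (I * y) + δ) := fun δ hδ =>
    continuous_iff_continuousAt.2 fun y => ContinuousAt.comp (g := logDeriv (evenTheta τ))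
      (differentiableAt_logDeriv_evenTheta hτ' (hy y δ hδ)).continuousAt (by fun_prop)
  have c1 := cx η him
  have c2 := cx (-η) him'
  have c3 := cy η hre
  have c4 := cy (-η) hre'
  rw [pairing, ← torusInt_const_mul, torusInt_congr e, torusInt]
  have inner : ∀ y : ℝ, ∫ x in (0 : ℝ)..1,
      ((logDeriv (evenTheta τ) (2 * x + η) - logDeriv (evenTheta τ) (2 * x + -η)) -
      (logDeriv (evenTheta τ) (2 * (I * y) + η) - logDeriv (evenTheta τ) (2 * (I * y) + -η))) =
      -(logDeriv (evenTheta τ) (2 * (I * y) + η) - logDeriv (evenTheta τ) (2 * (I * y) + -η)) := by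
    intro y
    rw [intervalIntegral.integral_sub (Continuous.intervalIntegrable (by fun_prop) _ _)
        (Continuous.intervalIntegrable (by fun_prop) _ _),
      intervalIntegral.integral_sub (c1.intervalIntegrable _ _) (c2.intervalIntegrable _ _),
      integral_logDeriv_evenTheta_re hτ hτ' him, integral_logDeriv_evenTheta_re hτ hτ' him']
    simp
  simp only [inner]
  rw [intervalIntegral.integral_neg, intervalIntegral.integral_sub (c3.intervalIntegrable _ _)
    (c4.intervalIntegrable _ _), integral_logDeriv_evenTheta_im hτ hτ' hre,
    integral_logDeriv_evenTheta_im hτ hτ' hre']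
  ring

/-! ### Strings of theta factors and the action of lowering operators on them. -/

theorem ThetaSpace_mul {τ : ℂ} {m n : ℕ} {f g : ℂ → ℂ} (hf : f ∈ ThetaSpace τ m)
    (hg : g ∈ ThetaSpace τ n) : f * g ∈ ThetaSpace τ (m + n) := by
  refine ⟨hf.1.mul hg.1, fun x => ?_, fun x => ?_, fun x => ?_⟩
  · simp only [Pi.mul_apply, hf.2.1, hg.2.1]
  · simp only [Pi.mul_apply, hf.2.2.1, hg.2.2.1]
    rw [mul_mul_mul_comm, ← exp_add]
    push_cast
    ring_nf
  · simp only [Pi.mul_apply, hf.2.2.2, hg.2.2.2]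

theorem one_mem_ThetaSpace (τ : ℂ) : (fun _ => 1 : ℂ → ℂ) ∈ ThetaSpace τ 0 :=
  ⟨differentiable_const 1, fun _ => rfl, fun x => by simp, fun _ => rfl⟩

theorem theta_sub_tau (τ x : ℂ) :
    theta τ (x - τ) = -(exp (-(Real.pi * I * (τ - 2 * x))) * theta τ x) := by
  rw [← neg_sub, theta_neg, show τ - x = -x + τ by ring, theta_add_tau, theta_neg]
  ring_nf

theorem evenTheta_sub_tau (τ x : ℂ) :
    evenTheta τ (x - τ) = exp (-(Real.pi * I * (τ - 2 * x))) * evenTheta τ x := by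
  rw [← evenTheta_neg, neg_sub, show τ - x = -x + τ by ring, evenTheta_add_tau, evenTheta_neg]
  ring_nf

theorem theta_mul_theta_mem {τ : ℂ} (hτ' : 0 < τ.im) (a : ℂ) :
    (fun x => theta τ (a + x) * theta τ (a - x)) ∈ ThetaSpace τ 1 := by
  have := differentiable_theta hτ'
  refine ⟨by fun_prop, fun x => ?_, fun x => ?_, fun x => ?_⟩
  · have h := theta_add_one τ (a - x - 1)
    rw [sub_add_cancel] at h
    dsimp only
    rw [← add_assoc, theta_add_one, ← sub_sub, h]
    ring
  · dsimp only
    rw [← add_assoc, theta_add_tau, ← sub_sub, theta_sub_tau, neg_mul_neg, mul_mul_mul_comm,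
      ← exp_add]
    push_cast
    ring_nf
  · ring_nf

theorem evenTheta_mul_evenTheta_mem {τ : ℂ} (hτ' : 0 < τ.im) (a : ℂ) :
    (fun x => evenTheta τ (a + x) * evenTheta τ (a - x)) ∈ ThetaSpace τ 1 := by
  have := differentiable_evenTheta hτ'
  refine ⟨by fun_prop, fun x => ?_, fun x => ?_, fun x => ?_⟩
  · have h := evenTheta_add_one τ (a - x - 1)
    rw [sub_add_cancel] at h
    dsimp only
    rw [← add_assoc, evenTheta_add_one, ← sub_sub, h]
  · dsimp only
    rw [← add_assoc, evenTheta_add_tau, ← sub_sub, evenTheta_sub_tau, mul_mul_mul_comm,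
      ← exp_add]
    push_cast
    ring_nf
  · ring_nf

/-- The product `∏_{j<k} θ(z + 2jη)`. -/
noncomputable def thetaFac (τ η : ℂ) (k : ℕ) (z : ℂ) : ℂ :=
  ∏ j ∈ Finset.range k, theta τ (z + 2 * j * η)

theorem thetaFac_succ (τ η : ℂ) (k : ℕ) (z : ℂ) :
    thetaFac τ η (k + 1) z = thetaFac τ η k z * theta τ (z + 2 * k * η) :=
  Finset.prod_range_succ _ _

theorem thetaFac_succ' (τ η : ℂ) (k : ℕ) (z : ℂ) :
    thetaFac τ η (k + 1) z = theta τ z * thetaFac τ η k (z + 2 * η) := by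
  rw [thetaFac, Finset.prod_range_succ', mul_comm, thetaFac]
  congr 1
  · simp
  · refine Finset.prod_congr rfl fun j _ => ?_
    push_cast
    ring_nf

/-- The product `∏_{j<k} θ(a ± x + 2jη)`. -/
noncomputable def thetaStr (τ η : ℂ) (k : ℕ) (a x : ℂ) : ℂ :=
  thetaFac τ η k (a + x) * thetaFac τ η k (a - x)

theorem eFun_eq (τ η : ℂ) (N k : ℕ) (a b : ℂ) :
    eFun τ η N k a b = thetaStr τ η k a * thetaStr τ η (N - k) b := by
  funext x
  simp only [eFun, thetaStr, thetaFac, Pi.mul_apply, Finset.prod_mul_distrib]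

theorem thetaStr_mem {τ : ℂ} (hτ' : 0 < τ.im) (η : ℂ) (k : ℕ) (a : ℂ) :
    thetaStr τ η k a ∈ ThetaSpace τ k := by
  induction k with
  | zero =>
    convert one_mem_ThetaSpace τ using 1
    funext x
    simp [thetaStr, thetaFac]
  | succ k ih =>
    convert ThetaSpace_mul ih (theta_mul_theta_mem hτ' (a + 2 * k * η)) using 1
    funext x
    simp only [thetaStr, thetaFac_succ, Pi.mul_apply]
    ring_nf

/-- The product `∏_{i<k} T(c - 2iη ± x)`. -/
noncomputable def evenStr (τ η : ℂ) (k : ℕ) (c x : ℂ) : ℂ :=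
  ∏ i ∈ Finset.range k, evenTheta τ (c - 2 * i * η + x) * evenTheta τ (c - 2 * i * η - x)

theorem evenStr_succ' (τ η : ℂ) (k : ℕ) (c x : ℂ) : evenStr τ η (k + 1) c x =
    evenTheta τ (c + x) * evenTheta τ (c - x) * evenStr τ η k (c - 2 * η) x := by
  rw [evenStr, Finset.prod_range_succ', mul_comm, evenStr]
  congr 1
  · simp
  · refine Finset.prod_congr rfl fun j _ => ?_
    push_cast
    ring_nf

theorem evenStr_mem {τ : ℂ} (hτ' : 0 < τ.im) (η : ℂ) (k : ℕ) (c : ℂ) :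
    evenStr τ η k c ∈ ThetaSpace τ k := by
  induction k generalizing c with
  | zero =>
    convert one_mem_ThetaSpace τ using 1
    funext x
    simp [evenStr]
  | succ k ih =>
    convert ThetaSpace_mul (ih (c - 2 * η)) (evenTheta_mul_evenTheta_mem hτ' c) using 1
    funext x
    rw [evenStr_succ', mul_comm]
    rfl

/-- Multiplying by θ(u+a−η) completes a string of length k+1, from which the last factor is split
off instead of the first. -/
theorem thetaStr_add (τ η : ℂ) (k : ℕ) (a u : ℂ) :
    theta τ (u + a - η) * thetaStr τ η k a (u + η) =
      theta τ (u + a + (2 * k - 1) * η) * thetaStr τ η k (a - η) u := by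
  have h := thetaFac_succ τ η k (u + a - η)
  rw [thetaFac_succ'] at h
  rw [thetaStr, thetaStr, ← mul_assoc, show a + (u + η) = u + a - η + 2 * η by ring, h,
    show u + a - η + 2 * k * η = u + a + (2 * k - 1) * η by ring]
  ring_nf

theorem thetaStr_succ_add (τ η : ℂ) (m : ℕ) (b u : ℂ) :
    thetaStr τ η (m + 1) b (u + η) = theta τ (b - u - η) * theta τ (u + b + (2 * m + 1) * η) *
      thetaStr τ η m (b + η) u := by
  rw [thetaStr, thetaStr, thetaFac_succ, thetaFac_succ']
  ring_nf

theorem thetaStr_neg (τ η : ℂ) (k : ℕ) (a u : ℂ) : thetaStr τ η k a (-u) = thetaStr τ η k a u := by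
  rw [thetaStr, thetaStr, mul_comm]
  ring_nf

theorem lowerCoeff_eq (τ η : ℂ) (n : ℕ) (a u : ℂ) :
    lowerCoeff τ η n (a + n * η) u =
      theta τ (u + a - η) * theta τ (u + (-a - (2 * n + 1) * η)) := by
  rw [lowerCoeff]
  ring_nf

/-- With c = a + nη one factor of the coefficient prolongs the shifted a-string at its lower end.
Both halves then share the even factor made of the two new strings. What remains is a pair of
fourfold θ-products with arguments summing to zero, and Weierstrass evaluates their difference as
θ(2u) times constants. -/
theorem lower_thetaStr {τ η : ℂ} (hτ' : 0 < τ.im) {k m n : ℕ} (hn : k + m = n) (a b u : ℂ) :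
    theta τ (2 * u) * (theta τ (2 * (m + 1) * η) * theta τ (a + b + 2 * n * η) *
        theta τ (a - b + 2 * k * η) * (thetaStr τ η k (a - η) * thetaStr τ η m (b + η)) u) =
      lowerCoeff τ η n (a + n * η) u * (thetaStr τ η k a * thetaStr τ η (m + 1) b) (u + η) -
      lowerCoeff τ η n (a + n * η) (-u) * (thetaStr τ η k a * thetaStr τ η (m + 1) b) (u - η) := by
  have half : ∀ u, lowerCoeff τ η n (a + n * η) u *
      (thetaStr τ η k a * thetaStr τ η (m + 1) b) (u + η) =
      -(theta τ (u + (-b + η)) * theta τ (u + (-a - (2 * n + 1) * η)) *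
        (theta τ (u + (a + (2 * k - 1) * η)) * theta τ (u + (b + (2 * m + 1) * η))) *
        (thetaStr τ η k (a - η) u * thetaStr τ η m (b + η) u)) := by
    intro u
    have h1 := thetaStr_add τ η k a u
    have h2 := thetaStr_succ_add τ η m b u
    rw [show b - u - η = -(u + (-b + η)) by ring, theta_neg] at h2
    rw [lowerCoeff_eq, Pi.mul_apply, h2, ← add_assoc u a, ← add_assoc u b]
    linear_combination (-theta τ (u + (-a - (2 * n + 1) * η)) * theta τ (u + (-b + η)) *
      theta τ (u + b + (2 * m + 1) * η) * thetaStr τ η m (b + η) u) * h1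
  have hm : ∀ u, (thetaStr τ η k a * thetaStr τ η (m + 1) b) (-u) =
    (thetaStr τ η k a * thetaStr τ η (m + 1) b) u := fun u => by
      simp only [Pi.mul_apply, thetaStr_neg]
  have h3 := half (-u)
  rw [show -u + η = -(u - η) by ring, hm, thetaStr_neg, thetaStr_neg] at h3
  rw [half, h3]
  have hw := theta_weierstrass hτ' u (-b + η) (-a - (2 * n + 1) * η) (a + (2 * k - 1) * η)
    (b + (2 * m + 1) * η) (by rw [← hn]; push_cast; ring)
  rw [show -b + η + (-a - (2 * n + 1) * η) = -(a + b + 2 * n * η) by ring, theta_neg,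
    show -b + η + (a + (2 * k - 1) * η) = a - b + 2 * k * η by ring,
    show -b + η + (b + (2 * m + 1) * η) = 2 * (m + 1) * η by ring] at hw
  rw [Pi.mul_apply]
  linear_combination (thetaStr τ η k (a - η) u * thetaStr τ η m (b + η) u) * hw

/-- Without b-factors, prolonging the a-string makes both halves the same product, so the difference
vanishes. This is the origin of orthogonality. -/
theorem lower_thetaStr_zero {τ η : ℂ} (n : ℕ) (a b u : ℂ) :
    theta τ (2 * u) * 0 =
      lowerCoeff τ η n (a + n * η) u * (thetaStr τ η (n + 1) a * thetaStr τ η 0 b) (u + η) -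
      lowerCoeff τ η n (a + n * η) (-u) * (thetaStr τ η (n + 1) a * thetaStr τ η 0 b) (u - η) := by
  have h0 : ∀ u, thetaStr τ η 0 b u = 1 := fun u => by simp [thetaStr, thetaFac]
  have h1 := thetaStr_add τ η (n + 1) a u
  have h2 := thetaStr_add τ η (n + 1) a (-u)
  rw [thetaStr_neg, show -u + η = -(u - η) by ring, thetaStr_neg] at h2
  rw [Pi.mul_apply, Pi.mul_apply, h0, h0, lowerCoeff_eq, lowerCoeff_eq]
  have h3 := theta_neg τ (u + (-a - (2 * n + 1) * η))
  have h4 := theta_neg τ (u + a + (2 * ((n + 1 : ℕ) : ℂ) - 1) * η)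
  rw [show -(u + (-a - (2 * n + 1) * η)) = -u + a + (2 * ((n + 1 : ℕ) : ℂ) - 1) * η by
    push_cast; ring] at h3
  rw [show -(u + a + (2 * ((n + 1 : ℕ) : ℂ) - 1) * η) = -u + (-a - (2 * n + 1) * η) by
    push_cast; ring] at h4
  rw [h4]
  rw [h3] at h2
  linear_combination (-theta τ (u + (-a - (2 * n + 1) * η))) * h1 -
    theta τ (u + a + (2 * ((n + 1 : ℕ) : ℂ) - 1) * η) * h2

theorem pairing_const_mul (τ η : ℂ) (n : ℕ) (r : ℂ) (F G : ℂ → ℂ) :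
    pairing τ η n (fun u => r * F u) G = r * pairing τ η n F G := by
  rw [pairing, pairing, ← torusInt_const_mul]
  refine torusInt_congr fun x y => ?_
  simp only [pairKer]
  ring

/-- The product of `T`-strings dual to the product of strings `∏ θ(a ± x + 2jη) ∏ θ(b ± x + 2jη)`
of total length `N`. -/
noncomputable def dualStr (τ η : ℂ) (N P Q : ℕ) (a b : ℂ) : ℂ → ℂ :=
  evenStr τ η P (a + N * η - η) * evenStr τ η Q (b + N * η - η)

theorem dualStr_comm (τ η : ℂ) (N P Q : ℕ) (a b : ℂ) :
    dualStr τ η N P Q a b = dualStr τ η N Q P b a := mul_comm _ _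

/-- The top factor of the dual a-string is exactly the multiplier adjoint to lowering with c = a +
nη, and the remaining factors form the dual string for the lowered parameters a−η, b+η. -/
theorem dualStr_succ (τ η : ℂ) (n P Q : ℕ) (a b : ℂ) : dualStr τ η (n + 1) (P + 1) Q a b =
    fun v => evenTheta τ (a + n * η + v) * evenTheta τ (a + n * η - v) *
      dualStr τ η n P Q (a - η) (b + η) v := by
  funext v
  simp only [dualStr, Pi.mul_apply, evenStr_succ']
  push_cast
  ring_nf

theorem dualStr_mem {τ η : ℂ} (hτ' : 0 < τ.im) {n P Q : ℕ} (h : P + Q = n) (a b : ℂ) :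
    dualStr τ η n P Q a b ∈ ThetaSpace τ n := by
  subst h
  exact ThetaSpace_mul (evenStr_mem hτ' η P _) (evenStr_mem hτ' η Q _)

theorem thetaStr_mul_mem {τ η : ℂ} (hτ' : 0 < τ.im) {n k m : ℕ} (h : k + m = n) (a b : ℂ) :
    thetaStr τ η k a * thetaStr τ η m b ∈ ThetaSpace τ n := by
  subst h
  exact ThetaSpace_mul (thetaStr_mem hτ' η k _) (thetaStr_mem hτ' η m _)

/-! ### Recursion for the pairing of strings with dual strings. -/

/-- Adjunction trades one T-factor of the dual a-string for one θ-pair of the b-string, at the cost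
of the constants of `lower_thetaStr`. -/
theorem pairing_dualStr_succ {τ η : ℂ} (hτ : τ.re = 0) (hτ' : 0 < τ.im) {n k m P Q : ℕ}
    (hre : (n + 2) * |η.re| < 1 / 2)
    (him : (n + 2) * |η.im| < τ.im / 2) (hkm : k + m = n) (hPQ : P + Q = n) (a b : ℂ) :
    -(theta τ (2 * ((n + 2) * η)) * pairing τ η (n + 1) (thetaStr τ η k a * thetaStr τ η (m + 1) b)
      (dualStr τ η (n + 1) (P + 1) Q a b)) =
    theta τ (2 * (m + 1) * η) * theta τ (a + b + 2 * n * η) * theta τ (a - b + 2 * k * η) *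
      pairing τ η n (thetaStr τ η k (a - η) * thetaStr τ η m (b + η))
        (dualStr τ η n P Q (a - η) (b + η)) := by
  rw [← pairing_const_mul τ η n, dualStr_succ]
  exact (pairing_lowering hτ hτ' hre him (thetaStr_mul_mem hτ' (by omega) a b)
    (dualStr_mem hτ' hPQ _ _) (a + n * η) (lower_thetaStr hτ' hkm a b)).symm

theorem pairing_dualStr_zero {τ η : ℂ} (hτ : τ.re = 0) (hτ' : 0 < τ.im) {n P Q : ℕ}
    (hre : (n + 2) * |η.re| < 1 / 2)
    (him : (n + 2) * |η.im| < τ.im / 2) (hPQ : P + Q = n) (a b : ℂ) :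
    -(theta τ (2 * ((n + 2) * η)) * pairing τ η (n + 1) (thetaStr τ η (n + 1) a * thetaStr τ η 0 b)
      (dualStr τ η (n + 1) (P + 1) Q a b)) = 0 := by
  rw [dualStr_succ, ← pairing_lowering hτ hτ' hre him (thetaStr_mul_mem hτ' (by omega) a b)
    (dualStr_mem hτ' hPQ _ _) (a + n * η) (lower_thetaStr_zero n a b)]
  simp [pairing, pairKer, torusInt]

theorem theta_two_mul_ne_zero {τ η : ℂ} (hτ : τ.re = 0) (hτ' : 0 < τ.im) (hη : η ≠ 0) {r : ℝ}
    (hr : 0 < r) (hre : r * |η.re| < 1 / 2) (him : r * |η.im| < τ.im / 2) :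
    theta τ (2 * (r * η)) ≠ 0 := by
  refine theta_ne_zero hτ hτ' ?_ ?_ ?_
  · have : (r : ℂ) ≠ 0 := by exact_mod_cast hr.ne'
    exact mul_ne_zero two_ne_zero (mul_ne_zero this hη)
  · simp [abs_mul, abs_of_pos hr]
    linarith
  · simp [abs_mul, abs_of_pos hr]
    linarith

theorem mul_abs_lt_of_succ {n : ℕ} {x y : ℝ} (h : (((n + 1 : ℕ) : ℝ) + 1) * |x| < y) :
    ((n : ℝ) + 1) * |x| < y ∧ ((n : ℝ) + 2) * |x| < y := by
  have := abs_nonneg x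
  push_cast at h
  constructor <;> nlinarith

/-- Each of the P factors of the dual a-string consumes one of the m factors of the b-string; if P >
m, the b-string runs out and the next lowering gives zero. -/
theorem pairing_dualStr_eq_zero_of_lt {τ η : ℂ} (hτ : τ.re = 0) (hτ' : 0 < τ.im) (hη : η ≠ 0)
    {k m P Q N : ℕ} (hre : ((N : ℝ) + 1) * |η.re| < 1 / 2)
    (him : ((N : ℝ) + 1) * |η.im| < τ.im / 2) (hkm : k + m = N) (hPQ : P + Q = N) (h : m < P)
    (a b : ℂ) :
    pairing τ η N (thetaStr τ η k a * thetaStr τ η m b) (dualStr τ η N P Q a b) = 0 := by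
  induction m generalizing N P a b with
  | zero =>
    obtain ⟨P, rfl⟩ : ∃ P', P = P' + 1 := ⟨P - 1, by omega⟩
    obtain ⟨n, rfl⟩ : ∃ n, N = n + 1 := ⟨P + Q, by omega⟩
    have hre' := mul_abs_lt_of_succ hre
    have him' := mul_abs_lt_of_succ him
    obtain rfl : k = n + 1 := by omega
    have h0 := pairing_dualStr_zero hτ hτ' (P := P) (Q := Q) hre'.2 him'.2 (by omega) a b
    have h1 := theta_two_mul_ne_zero hτ hτ' hη (r := n + 2) (by positivity) hre'.2 him'.2
    push_cast at h1
    exact (mul_eq_zero.1 (neg_eq_zero.1 h0)).resolve_left h1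
  | succ m ih =>
    obtain ⟨P, rfl⟩ : ∃ P', P = P' + 1 := ⟨P - 1, by omega⟩
    obtain ⟨n, rfl⟩ : ∃ n, N = n + 1 := ⟨P + Q, by omega⟩
    have hre' := mul_abs_lt_of_succ hre
    have him' := mul_abs_lt_of_succ him
    have h0 := pairing_dualStr_succ hτ hτ' (k := k) (m := m) (P := P) (Q := Q) hre'.2 him'.2
      (by omega) (by omega) a b
    rw [ih hre'.1 him'.1 (by omega) (by omega) (by omega), mul_zero] at h0
    have h1 := theta_two_mul_ne_zero hτ hτ' hη (r := n + 2) (by positivity) hre'.2 him'.2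
    push_cast at h1
    exact (mul_eq_zero.1 (neg_eq_zero.1 h0)).resolve_left h1

/-- As the total lengths agree, k ≠ Q means that either m < P or k < Q; the second case is the first
with a and b exchanged. -/
theorem pairing_dualStr_eq_zero {τ η : ℂ} (hτ : τ.re = 0) (hτ' : 0 < τ.im) (hη : η ≠ 0)
    {k m P Q N : ℕ} (hre : ((N : ℝ) + 1) * |η.re| < 1 / 2)
    (him : ((N : ℝ) + 1) * |η.im| < τ.im / 2) (hkm : k + m = N) (hPQ : P + Q = N) (h : k ≠ Q)
    (a b : ℂ) :
    pairing τ η N (thetaStr τ η k a * thetaStr τ η m b) (dualStr τ η N P Q a b) = 0 := by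
  rcases lt_or_gt_of_ne (show m ≠ P by omega) with h | h
  · exact pairing_dualStr_eq_zero_of_lt hτ hτ' hη hre him hkm hPQ h a b
  · rw [mul_comm, dualStr_comm]
    exact pairing_dualStr_eq_zero_of_lt hτ hτ' hη hre him (by omega) (by omega) (by omega) b a

/-- The product formula for the pairing of dual strings, up to normalization. -/
noncomputable def diagVal (τ η : ℂ) (N k m : ℕ) (a b : ℂ) : ℂ :=
  pairing τ η 0 (fun _ => 1) (fun _ => 1) * (∏ i ∈ Finset.range N, theta τ (a + b + 2 * i * η)) *
    ((∏ p ∈ Finset.range m, theta τ (2 * (p + 1) * η)) *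
      ∏ p ∈ Finset.range m, theta τ (a - b + 2 * (k - p) * η)) *
    ((∏ p ∈ Finset.range k, theta τ (2 * (p + 1) * η)) *
      ∏ p ∈ Finset.range k, theta τ (b - a + 2 * (m - p) * η))

theorem diagVal_comm (τ η : ℂ) (N k m : ℕ) (a b : ℂ) :
    diagVal τ η N k m a b = diagVal τ η N m k b a := by
  simp only [diagVal, add_comm b a]
  ring

theorem diagVal_succ (τ η : ℂ) (n k m : ℕ) (a b : ℂ) : diagVal τ η (n + 1) k (m + 1) a b =
    theta τ (2 * (m + 1) * η) * theta τ (a + b + 2 * n * η) * theta τ (a - b + 2 * k * η) *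
      diagVal τ η n k m (a - η) (b + η) := by
  have e1 : ∏ p ∈ Finset.range (m + 1), theta τ (a - b + 2 * (k - p) * η) =
      (∏ p ∈ Finset.range m, theta τ (a - η - (b + η) + 2 * (k - p) * η)) *
        theta τ (a - b + 2 * k * η) := by
    rw [Finset.prod_range_succ']
    congr 1
    · refine Finset.prod_congr rfl fun p _ => ?_
      push_cast
      ring_nf
    · simp
  have e2 : ∏ p ∈ Finset.range k, theta τ (b - a + 2 * (((m + 1 : ℕ) : ℂ) - p) * η) =
      ∏ p ∈ Finset.range k, theta τ (b + η - (a - η) + 2 * (m - p) * η) := by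
    refine Finset.prod_congr rfl fun p _ => ?_
    push_cast
    ring_nf
  rw [diagVal, diagVal, e1, e2, Finset.prod_range_succ, Finset.prod_range_succ _ m,
    show a - η + (b + η) = a + b by ring]
  ring

theorem pairing_dualStr_diag_aux {τ η : ℂ} (hτ : τ.re = 0) (hτ' : 0 < τ.im) {k : ℕ}
    (hbase : ((k : ℝ) + 1) * |η.re| < 1 / 2 → ((k : ℝ) + 1) * |η.im| < τ.im / 2 → ∀ a b,
      (∏ j ∈ Finset.range k, -theta τ (2 * ((j + 2) * η))) *
        pairing τ η k (thetaStr τ η k a * thetaStr τ η 0 b) (dualStr τ η k 0 k a b) =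
          diagVal τ η k k 0 a b)
    {m N : ℕ} (hre : ((N : ℝ) + 1) * |η.re| < 1 / 2)
    (him : ((N : ℝ) + 1) * |η.im| < τ.im / 2) (hkm : k + m = N) (a b : ℂ) :
    (∏ j ∈ Finset.range N, -theta τ (2 * ((j + 2) * η))) *
      pairing τ η N (thetaStr τ η k a * thetaStr τ η m b) (dualStr τ η N m k a b) =
        diagVal τ η N k m a b := by
  induction m generalizing N a b with
  | zero =>
    obtain rfl : k = N := by omega
    exact hbase hre him a b
  | succ m ih =>
    obtain ⟨n, rfl⟩ : ∃ n, N = n + 1 := ⟨k + m, by omega⟩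
    have hre' := mul_abs_lt_of_succ hre
    have him' := mul_abs_lt_of_succ him
    have h0 := pairing_dualStr_succ hτ hτ' (k := k) (m := m) (P := m) (Q := k) hre'.2 him'.2
      (by omega) (by omega) a b
    have h1 := ih hre'.1 him'.1 (by omega) (a - η) (b + η)
    rw [diagVal_succ, ← h1, Finset.prod_range_succ]
    linear_combination (∏ j ∈ Finset.range n, -theta τ (2 * ((j + 2) * η))) * h0

/-- The b-string is peeled off completely, then the roles of a and b are exchanged and the a-string
is peeled off, ending at the pairing of constants. The factors θ(2(j+2)η) stay on the left, so no
assumption η ≠ 0 enters yet. -/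
theorem pairing_dualStr_diag {τ η : ℂ} (hτ : τ.re = 0) (hτ' : 0 < τ.im)
    {k m N : ℕ} (hre : ((N : ℝ) + 1) * |η.re| < 1 / 2)
    (him : ((N : ℝ) + 1) * |η.im| < τ.im / 2) (hkm : k + m = N) (a b : ℂ) :
    (∏ j ∈ Finset.range N, -theta τ (2 * ((j + 2) * η))) *
      pairing τ η N (thetaStr τ η k a * thetaStr τ η m b) (dualStr τ η N m k a b) =
        diagVal τ η N k m a b := by
  refine pairing_dualStr_diag_aux hτ hτ' (fun h1 h2 a b => ?_) hre him hkm a b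
  rw [diagVal_comm, mul_comm (thetaStr τ η k a), dualStr_comm]
  refine pairing_dualStr_diag_aux hτ hτ' (fun h1 h2 a b => ?_) h1 h2 (by omega) b a
  have e1 : thetaStr τ η 0 a * thetaStr τ η 0 b = fun _ => 1 := by
    funext x
    simp [thetaStr, thetaFac]
  have e2 : dualStr τ η 0 0 0 a b = fun _ => 1 := by
    funext x
    simp [dualStr, evenStr]
  rw [e1, e2]
  simp [diagVal]

/-! ### The involution σ, complex conjugation and the passage from the metric to the bilinear form.
-/

/-- For imaginary τ the exponent 2πiτ is real, hence lies in the principal branch of the logarithm.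
-/
theorem nome_cpow {τ : ℂ} (hτ : τ.re = 0) (c : ℂ) :
    nome τ ^ c = exp (2 * Real.pi * I * τ * c) := by
  rw [nome, cpow_def_of_ne_zero (exp_ne_zero _), log_exp]
  · simp [hτ, Real.pi_pos]
  · simp [hτ, Real.pi_pos.le]

theorem pairing_zero_one_eq {τ : ℂ} (hτ : τ.re = 0) (hτ' : 0 < τ.im) {η : ℂ}
    (hre : |η.re| < 1 / 2) (him : |η.im| < τ.im / 2) :
    pairing τ η 0 (fun _ => 1) (fun _ => 1) * (theta τ (2 * η) * qPochInf τ ^ 3) =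
      2 * η * nome τ ^ (3 / 8 : ℂ) := by
  have h := pairing_zero_one hτ hτ' hre him
  rw [deriv_theta_zero hτ hτ'] at h
  rw [nome_cpow hτ]
  have e : exp (2 * Real.pi * I * τ * (3 / 8)) * exp (-(Real.pi * I * τ)) *
      exp (Real.pi * I * τ / 4) = 1 := by
    rw [← exp_add, ← exp_add]
    ring_nf
    simp
  have hpi : (Real.pi : ℂ) ≠ 0 := by exact_mod_cast Real.pi_ne_zero
  apply mul_left_cancel₀ (mul_ne_zero two_ne_zero hpi)
  linear_combination exp (2 * Real.pi * I * τ * (3 / 8)) * h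
    - 2 * Real.pi * pairing τ η 0 (fun _ => 1) (fun _ => 1) * (theta τ (2 * η) * qPochInf τ ^ 3) * e

/-- Each θ-pair, shifted by the half period, becomes a T-pair up to −e^{−2πix}. The sign of η flips
because the θ-strings ascend while `evenStr` descends. -/
theorem prod_theta_shift (τ η c x : ℂ) (k : ℕ) :
    exp (2 * Real.pi * I * x) ^ k * ∏ j ∈ Finset.range k,
      theta τ (c + (x + 1 / 2 + τ / 2) + 2 * j * η) * theta τ (c - (x + 1 / 2 + τ / 2) + 2 * j * η) =
    (-1) ^ k * evenStr τ (-η) k c x := by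
  rw [evenStr, ← Finset.card_range k, ← Finset.prod_const, ← Finset.prod_const, Finset.card_range,
    ← Finset.prod_mul_distrib, ← Finset.prod_mul_distrib]
  refine Finset.prod_congr rfl fun j _ => ?_
  have h := evenTheta_mul_evenTheta τ 0 (c + 2 * j * η) x
  rw [show c - 2 * j * -η + x = c + 2 * j * η + x + 0 by ring,
    show c - 2 * j * -η - x = c + 2 * j * η - x + 0 by ring, h]
  ring_nf

theorem sigma_eFun {τ η : ℂ} {N k : ℕ} (hk : k ≤ N) (A B : ℂ) :
    sigma τ N (eFun τ η N k A B) =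
      ((-1) ^ N * exp (2 * Real.pi * I * N * (1 / 4 + τ / 4))) •
        (evenStr τ (-η) k A * evenStr τ (-η) (N - k) B) := by
  funext x
  have h1 := prod_theta_shift τ η A x k
  have h2 := prod_theta_shift τ η B x (N - k)
  have e : exp (2 * Real.pi * I * N * (1 / 4 + τ / 4 + x)) =
      exp (2 * Real.pi * I * N * (1 / 4 + τ / 4)) * (exp (2 * Real.pi * I * x) ^ k *
        exp (2 * Real.pi * I * x) ^ (N - k)) := by
    rw [← pow_add, Nat.add_sub_cancel' hk, ← exp_nat_mul, ← exp_add]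
    ring_nf
  have e2 : (-1 : ℂ) ^ N = (-1) ^ k * (-1) ^ (N - k) := by rw [← pow_add, Nat.add_sub_cancel' hk]
  rw [sigma, eFun, e, e2]
  simp only [Pi.smul_apply, Pi.mul_apply, smul_eq_mul]
  linear_combination (exp (2 * Real.pi * I * N * (1 / 4 + τ / 4)) *
    (exp (2 * Real.pi * I * x) ^ (N - k) * ∏ j ∈ Finset.range (N - k),
      theta τ (B + (x + 1 / 2 + τ / 2) + 2 * j * η) *
        theta τ (B - (x + 1 / 2 + τ / 2) + 2 * j * η))) * h1 +
    (exp (2 * Real.pi * I * N * (1 / 4 + τ / 4)) * (-1) ^ k * evenStr τ (-η) k A x) * h2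

theorem sigma_eFun_mem {τ : ℂ} (hτ' : 0 < τ.im) (η : ℂ) {N k : ℕ} (hk : k ≤ N) (A B : ℂ) :
    sigma τ N (eFun τ η N k A B) ∈ ThetaSpace τ N := by
  rw [sigma_eFun hk]
  refine Submodule.smul_mem _ _ ?_
  have := ThetaSpace_mul (evenStr_mem hτ' (-η) k A) (evenStr_mem hτ' (-η) (N - k) B)
  rwa [Nat.add_sub_cancel' hk] at this

/-- For imaginary τ conjugation commutes with T. If s = 1, the sign of η̄ already reverses the
string; if s = −1, evenness of T absorbs the sign and exchanges the two factors of each pair. -/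
theorem conj_evenStr {τ : ℂ} (hτ : τ.re = 0) {η s : ℂ} (hs : s = -1 ∨ s = 1)
    (hη : s * (starRingEnd ℂ) η = -η) (k : ℕ) (c x : ℂ) :
    (starRingEnd ℂ) (evenStr τ (-η) k (s * (starRingEnd ℂ) c) x) =
      evenStr τ η k c ((starRingEnd ℂ) x) := by
  rw [evenStr, evenStr, map_prod]
  refine Finset.prod_congr rfl fun j _ => ?_
  rw [map_mul, conj_evenTheta hτ, conj_evenTheta hτ]
  simp only [map_add, map_sub, map_mul, map_neg, map_natCast, map_ofNat, RingHomCompTriple.comp_apply, RingHom.id_apply]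
  rcases hs with rfl | rfl
  · have h : (starRingEnd ℂ) η = η := by linear_combination -hη
    rw [h, ← evenTheta_neg, mul_comm, ← evenTheta_neg]
    simp only [map_neg, map_one]
    ring_nf
  · have h : (starRingEnd ℂ) η = -η := by linear_combination hη
    rw [h]
    simp only [map_one]
    ring_nf

theorem conj_sigma_eFun {τ : ℂ} (hτ : τ.re = 0) {η s : ℂ} (hs : s = -1 ∨ s = 1)
    (hη : s * (starRingEnd ℂ) η = -η) {N k : ℕ} (hk : k ≤ N) (a₁ a₂ x : ℂ) :
    (starRingEnd ℂ) (sigma τ N (eFun τ η N k (s * (starRingEnd ℂ) a₂ - 1 / 2 * N * η + η)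
      (s * (starRingEnd ℂ) a₁ - 1 / 2 * N * η + η)) x) =
    ((-1) ^ N * exp (Real.pi * I * N * (τ - 1) / 2)) *
      dualStr τ η N (N - k) k (a₁ - 1 / 2 * N * η) (a₂ - 1 / 2 * N * η) ((starRingEnd ℂ) x) := by
  have shift : ∀ a, s * (starRingEnd ℂ) a - 1 / 2 * N * η + η =
      s * (starRingEnd ℂ) (a - 1 / 2 * N * η + N * η - η) := fun a => by
    simp only [map_add, map_sub, map_mul, map_natCast, map_div₀, map_one, map_ofNat]
    linear_combination (-(1 / 2 * N) + 1) * hη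
  have hc : (starRingEnd ℂ) τ = -τ := by
    apply Complex.ext <;> simp [hτ]
  rw [sigma_eFun hk, Pi.smul_apply, smul_eq_mul, map_mul, Pi.mul_apply, map_mul, map_mul, shift, shift,
    conj_evenStr hτ hs hη, conj_evenStr hτ hs hη, dualStr, Pi.mul_apply, ← exp_conj]
  simp only [map_add, map_mul, map_natCast, map_div₀, map_one, map_ofNat, map_pow, map_neg, conj_I,
    conj_ofReal, hc]
  rw [show 2 * Real.pi * -I * N * (1 / 4 + -τ / 4) = Real.pi * I * N * (τ - 1) / 2 by ring]
  ring

theorem gridProd_mul_gridProd_ne_zero {τ : ℂ} (hτ : τ.re = 0) (hτ' : 0 < τ.im) {η : ℂ} {N : ℕ}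
    (hre : ((N : ℝ) + 1) * |η.re| < 1 / 2) (him : ((N : ℝ) + 1) * |η.im| < τ.im / 2) (x y : ℝ) :
    gridProd τ η (N + 2) (x + I * y + (x - I * y)) *
      gridProd τ η (N + 2) (x + I * y - (x - I * y)) ≠ 0 := by
  refine mul_ne_zero (gridProd_ne_zero_of_im hτ hτ' ?_) (gridProd_ne_zero_of_re hτ hτ' ?_)
  · push_cast
    rw [show (N : ℝ) + 2 - 1 = N + 1 by ring]
    simpa using him
  · push_cast
    rw [show (N : ℝ) + 2 - 1 = N + 1 by ring]
    simpa using hre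

theorem continuous_pairKer {τ : ℂ} (hτ : τ.re = 0) (hτ' : 0 < τ.im) {η : ℂ} {N : ℕ}
    (hre : ((N : ℝ) + 1) * |η.re| < 1 / 2) (him : ((N : ℝ) + 1) * |η.im| < τ.im / 2)
    {F G : ℂ → ℂ} (hF : Continuous F) (hG : Continuous G) :
    Continuous fun p : ℝ × ℝ => pairKer τ η N F G (p.1 + I * p.2) (p.1 - I * p.2) := by
  have := (differentiable_theta hτ').continuous
  have := (differentiable_gridProd hτ' η (N + 2)).continuous
  unfold pairKer
  exact Continuous.div (by fun_prop) (by fun_prop)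
    fun p => gridProd_mul_gridProd_ne_zero hτ hτ' hre him _ _

theorem metricIntegrand_eq {τ η : ℂ} {N : ℕ} {f g G : ℂ → ℂ}
    (hG : ∀ x, (starRingEnd ℂ) (g x) = G ((starRingEnd ℂ) x)) (u : ℂ) :
    metricIntegrand τ η N f g u =
      pairKer τ η N f G (u.re + I * u.im) (u.re - I * u.im) := by
  have h1 : (u.re + I * u.im : ℂ) = u := by rw [mul_comm, re_add_im]
  have h2 : (u.re - I * u.im : ℂ) = (starRingEnd ℂ) u := by
    apply Complex.ext <;> simp
  rw [h1, h2, metricIntegrand, weight_eq, hG, pairKer, ← mul_div_assoc]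

theorem fundRect_eq_preimage (τ : ℂ) :
    fundRect τ = measurableEquivRealProd ⁻¹' (Set.Ico 0 1 ×ˢ Set.Ico 0 τ.im) := rfl

theorem integrableOn_fundRect {τ : ℂ} {K : ℝ → ℝ → ℂ} (hK : Continuous fun p : ℝ × ℝ => K p.1 p.2) :
    MeasureTheory.IntegrableOn (fun u : ℂ => K u.re u.im) (fundRect τ) := by
  rw [fundRect_eq_preimage]
  have h : MeasureTheory.IntegrableOn (fun p : ℝ × ℝ => K p.1 p.2)
      (Set.Ico 0 1 ×ˢ Set.Ico 0 τ.im) :=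
    (hK.continuousOn.integrableOn_compact (isCompact_Icc.prod isCompact_Icc)).mono_set
      (Set.prod_mono Set.Ico_subset_Icc_self Set.Ico_subset_Icc_self)
  exact (volume_preserving_equiv_real_prod.integrableOn_comp_preimage
    measurableEquivRealProd.measurableEmbedding).2 h

theorem integral_fundRect {τ : ℂ} (hτ' : 0 < τ.im) {K : ℝ → ℝ → ℂ}
    (hK : Continuous fun p : ℝ × ℝ => K p.1 p.2) :
    ∫ u in fundRect τ, K u.re u.im = torusInt τ.im K := by
  have h : MeasureTheory.IntegrableOn (fun p : ℝ × ℝ => K p.1 p.2)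
      (Set.Ico 0 1 ×ˢ Set.Ico 0 τ.im) :=
    (hK.continuousOn.integrableOn_compact (isCompact_Icc.prod isCompact_Icc)).mono_set
      (Set.prod_mono Set.Ico_subset_Icc_self Set.Ico_subset_Icc_self)
  rw [fundRect_eq_preimage, torusInt_swap hK]
  have e := volume_preserving_equiv_real_prod.setIntegral_preimage_emb
    measurableEquivRealProd.measurableEmbedding (fun p : ℝ × ℝ => K p.1 p.2)
    (Set.Ico 0 1 ×ˢ Set.Ico 0 τ.im)
  refine Eq.trans e ?_
  rw [MeasureTheory.Measure.volume_eq_prod] at h ⊢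
  rw [MeasureTheory.setIntegral_prod _ h, intervalIntegral.integral_of_le zero_le_one,
    MeasureTheory.integral_Ico_eq_integral_Ioc]
  simp only [intervalIntegral.integral_of_le hτ'.le, MeasureTheory.integral_Ico_eq_integral_Ioc]

theorem integrableOn_metricIntegrand {τ : ℂ} (hτ : τ.re = 0) (hτ' : 0 < τ.im) {η : ℂ} {N : ℕ}
    (hre : ((N : ℝ) + 1) * |η.re| < 1 / 2) (him : ((N : ℝ) + 1) * |η.im| < τ.im / 2)
    {f g G : ℂ → ℂ} (hf : Continuous f) (hGc : Continuous G)
    (hG : ∀ x, (starRingEnd ℂ) (g x) = G ((starRingEnd ℂ) x)) :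
    MeasureTheory.IntegrableOn (metricIntegrand τ η N f g) (fundRect τ) := by
  rw [funext (metricIntegrand_eq (τ := τ) (η := η) (N := N) (f := f) hG)]
  exact integrableOn_fundRect
    (K := fun x y => pairKer τ η N f G (x + I * y) (x - I * y))
    (continuous_pairKer hτ hτ' hre him hf hGc)

theorem metric_eq_pairing {τ : ℂ} (hτ : τ.re = 0) (hτ' : 0 < τ.im) {η : ℂ} {N : ℕ}
    (hre : ((N : ℝ) + 1) * |η.re| < 1 / 2) (him : ((N : ℝ) + 1) * |η.im| < τ.im / 2)
    {f g G : ℂ → ℂ} (hf : Continuous f) (hGc : Continuous G)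
    (hG : ∀ x, (starRingEnd ℂ) (g x) = G ((starRingEnd ℂ) x)) :
    metric τ η N f g = pairing τ η N f G := by
  rw [metric, funext (metricIntegrand_eq (τ := τ) (η := η) (N := N) (f := f) hG)]
  exact integral_fundRect hτ'
    (K := fun x y => pairKer τ η N f G (x + I * y) (x - I * y))
    (continuous_pairKer hτ hτ' hre him hf hGc)

/-! ### The closed formula for η ≠ 0. -/

theorem theta_natCast_mul_ne_zero {τ η : ℂ} (hτ : τ.re = 0) (hτ' : 0 < τ.im) (hη : η ≠ 0) {N j : ℕ}
    (hre : ((N : ℝ) + 1) * |η.re| < 1 / 2) (him : ((N : ℝ) + 1) * |η.im| < τ.im / 2)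
    (hj : 0 < j) (hjN : j ≤ N + 1) : theta τ (2 * j * η) ≠ 0 := by
  have hj' : (j : ℝ) ≤ N + 1 := by exact_mod_cast hjN
  have h := theta_two_mul_ne_zero hτ hτ' hη (r := j) (by exact_mod_cast hj)
    (lt_of_le_of_lt (by gcongr) hre) (lt_of_le_of_lt (by gcongr) him)
  rw [mul_assoc]
  exact_mod_cast h

/-- The product formula for the pairing of dual strings. -/
noncomputable def diagFormula (τ η : ℂ) (N k m : ℕ) (a b : ℂ) : ℂ :=
  (-1) ^ N * (2 * η * nome τ ^ (3 / 8 : ℂ) / (theta τ (2 * (N + 1) * η) * qPochInf τ ^ 3)) *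
    (∏ j ∈ Finset.range k, theta τ (2 * (j + 1) * η) / theta τ (2 * (N - j) * η)) *
    ((∏ p ∈ Finset.range k, theta τ (b - a + 2 * (m - p) * η)) *
      ∏ p ∈ Finset.range m, theta τ (a - b + 2 * (k - p) * η)) *
    ∏ i ∈ Finset.range N, theta τ (a + b + 2 * i * η)

theorem pairing_dualStr_eq {τ η : ℂ} (hτ : τ.re = 0) (hτ' : 0 < τ.im) (hη : η ≠ 0) {k m N : ℕ}
    (hre : ((N : ℝ) + 1) * |η.re| < 1 / 2) (him : ((N : ℝ) + 1) * |η.im| < τ.im / 2)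
    (hkm : k + m = N) (a b : ℂ) :
    pairing τ η N (thetaStr τ η k a * thetaStr τ η m b) (dualStr τ η N m k a b) =
      diagFormula τ η N k m a b := by
  have hN : (0 : ℝ) ≤ N := Nat.cast_nonneg N
  have h0 := pairing_zero_one_eq hτ hτ' (η := η)
    (by have := abs_nonneg η.re; nlinarith) (by have := abs_nonneg η.im; nlinarith)
  have hd := pairing_dualStr_diag hτ hτ' hre him hkm a b
  set A := ∏ p ∈ Finset.range k, theta τ (2 * (p + 1) * η) with hA
  set B := ∏ p ∈ Finset.range m, theta τ (2 * (p + 1) * η) with hB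
  set Z := ∏ j ∈ Finset.range k, theta τ (2 * (N - j) * η) with hZ
  set V := ∏ j ∈ Finset.range N, theta τ (2 * (j + 2) * η) with hV
  have hU : Z * B = ∏ j ∈ Finset.range N, theta τ (2 * (j + 1) * η) := by
    rw [← hkm, add_comm k m, Finset.prod_range_add, mul_comm, hZ, ← Finset.prod_range_reflect]
    congr 1
    refine Finset.prod_congr rfl fun j hj => ?_
    have hj := Finset.mem_range.1 hj
    rw [show ((k - 1 - j : ℕ) : ℂ) = k - 1 - j by
      rw [Nat.cast_sub (by omega), Nat.cast_sub (by omega)]; simp]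
    push_cast [← hkm]
    ring_nf
  -- Telescoping: V and Z·B are products of θ(2jη) over 2 ≤ j ≤ N+1 and 1 ≤ j ≤ N. The surplus θ(2η)
  -- cancels against the value for N = 0, leaving θ(2(N+1)η) in the denominator of C.
  have hUV : V * theta τ (2 * η) = Z * B * theta τ (2 * (N + 1) * η) := by
    rw [hU, ← Finset.prod_range_succ (fun j : ℕ => theta τ (2 * (j + 1) * η)),
      Finset.prod_range_succ', hV]
    congr 1
    · refine Finset.prod_congr rfl fun j _ => ?_
      push_cast
      ring_nf
    · simp
  have hZ0 : Z ≠ 0 := Finset.prod_ne_zero_iff.2 fun j hj => by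
    have hj := Finset.mem_range.1 hj
    have := theta_natCast_mul_ne_zero hτ hτ' hη hre him (j := N - j) (by omega) (by omega)
    rwa [Nat.cast_sub (by omega)] at this
  have hV0 : V ≠ 0 := Finset.prod_ne_zero_iff.2 fun j hj => by
    have hj := Finset.mem_range.1 hj
    have := theta_natCast_mul_ne_zero hτ hτ' hη hre him (j := j + 2) (by omega) (by omega)
    push_cast at this
    exact this
  have hT0 : theta τ (2 * (N + 1) * η) ≠ 0 := by
    have := theta_natCast_mul_ne_zero hτ hτ' hη hre him (j := N + 1) (by omega) le_rfl
    push_cast at this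
    exact this
  have hq := qPochInf_ne_zero hτ'
  have hs : ((-1 : ℂ) ^ N) * (-1) ^ N = 1 := by rw [← mul_pow]; simp
  have e : ∏ j ∈ Finset.range N, -theta τ (2 * (((j : ℕ) + 2) * η)) = (-1) ^ N * V := by
    rw [Finset.prod_neg, Finset.card_range, hV]
    simp only [mul_assoc]
  rw [e, diagVal, ← hA, ← hB] at hd
  rw [diagFormula, Finset.prod_div_distrib, ← hA, ← hZ, ← h0]
  generalize pairing τ η 0 (fun _ => 1) (fun _ => 1) = P0 at *
  generalize ∏ p ∈ Finset.range m, theta τ (a - b + 2 * (k - p) * η) = X at *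
  generalize ∏ p ∈ Finset.range k, theta τ (b - a + 2 * (m - p) * η) = Y at *
  generalize ∏ i ∈ Finset.range N, theta τ (a + b + 2 * i * η) = S at *
  generalize pairing τ η N (thetaStr τ η k a * thetaStr τ η m b) (dualStr τ η N m k a b) = P at *
  generalize theta τ (2 * (N + 1) * η) = T at *
  generalize theta τ (2 * η) = T' at *
  field_simp
  apply mul_left_cancel₀ hV0
  linear_combination (T * Z * (-1) ^ N) * hd
    - ((-1) ^ N * P0 * A * Y * X * S) * hUV - (V * T * Z * P) * hs

theorem prod_range_neg (k : ℕ) (f : ℕ → ℂ) :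
    ∏ j ∈ Finset.range k, -f j = (-1) ^ k * ∏ j ∈ Finset.range k, f j := by
  rw [Finset.prod_neg, Finset.card_range]

theorem ellNum_lam_add {τ η : ℂ} (hη : η ≠ 0) (N : ℕ) (a₁ a₂ r : ℂ) :
    ellNum τ η (lam η N a₁ a₂ + r) = theta τ (a₁ - a₂ + 2 * (r - N) * η) := by
  rw [ellNum, lam]
  congr 1
  field_simp
  ring

theorem prod_erase_range {M : Type*} [CommMonoid M] {k m N : ℕ} (hkm : k + m = N) (g : ℕ → M) :
    ∏ j ∈ (Finset.range (N + 1)).erase k, g j =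
      (∏ j ∈ Finset.range k, g j) * ∏ j ∈ Finset.range m, g (k + 1 + j) := by
  have h : (Finset.range (N + 1)).erase k = Finset.range k ∪ Finset.Ico (k + 1) (N + 1) := by
    ext j
    simp only [Finset.mem_erase, Finset.mem_range, Finset.mem_union, Finset.mem_Ico]
    omega
  rw [h, Finset.prod_union, Finset.prod_Ico_eq_prod_range, show N + 1 - (k + 1) = m by omega]
  rw [Finset.disjoint_left]
  intro j
  simp only [Finset.mem_range, Finset.mem_Ico]
  omega

/-- The factors with j < k in the product over λ+k+j are the b−a factors up to (−1)^k, which cancels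
the sign of [−N]_k; the factors with j > k, in reversed order, are the a−b factors. -/
theorem constC_mul_gammaCancelled {τ η : ℂ} (hη : η ≠ 0) {k m N : ℕ} (hkm : k + m = N)
    (a₁ a₂ : ℂ) :
    constC τ η N * gammaCancelled τ η N k a₁ a₂ =
      (-1) ^ N * exp (Real.pi * I * N * (τ - 1) / 2) *
        diagFormula τ η N k m (a₁ - 1 / 2 * N * η) (a₂ - 1 / 2 * N * η) := by
  have e1 : ellFac τ η 1 k = ∏ j ∈ Finset.range k, theta τ (2 * (j + 1) * η) := by
    refine Finset.prod_congr rfl fun j _ => ?_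
    rw [ellNum]
    ring_nf
  have e2 : ellFac τ η (-N) k = (-1) ^ k * ∏ j ∈ Finset.range k, theta τ (2 * (N - j) * η) := by
    rw [← prod_range_neg]
    refine Finset.prod_congr rfl fun j _ => ?_
    rw [ellNum, ← theta_neg]
    ring_nf
  have e3 : ∏ j ∈ Finset.range k, theta τ (a₁ - a₂ + 2 * (k + j - N) * η) = (-1) ^ k *
      ∏ p ∈ Finset.range k, theta τ (a₂ - a₁ + 2 * (m - p) * η) := by
    rw [← prod_range_neg]
    refine Finset.prod_congr rfl fun j _ => ?_
    rw [← theta_neg]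
    push_cast [← hkm]
    ring_nf
  have e4 : ∏ j ∈ Finset.range m, theta τ (a₁ - a₂ + 2 * (k + ((k + 1 + j : ℕ) : ℂ) - N) * η) =
      ∏ p ∈ Finset.range m, theta τ (a₁ - a₂ + 2 * (k - p) * η) := by
    rw [← Finset.prod_range_reflect]
    refine Finset.prod_congr rfl fun j hj => ?_
    have hj := Finset.mem_range.1 hj
    rw [show k + 1 + (m - 1 - j) = N - j by omega, Nat.cast_sub (by omega)]
    ring_nf
  have e5 : ellFac τ η ((a₁ + a₂ - N * η) / (2 * η)) N =
      ∏ i ∈ Finset.range N, theta τ (a₁ + a₂ - N * η + 2 * i * η) := by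
    refine Finset.prod_congr rfl fun j _ => ?_
    rw [ellNum]
    congr 1
    field_simp
  have hs : ((-1 : ℂ) ^ N) * (-1) ^ N = 1 := by rw [← mul_pow]; simp
  simp only [gammaCancelled, add_assoc, ellNum_lam_add hη]
  rw [prod_erase_range hkm, e3, e4, e1, e2, e5, constC, if_neg hη, diagFormula,
    Finset.prod_div_distrib, show a₂ - 1 / 2 * N * η - (a₁ - 1 / 2 * N * η) = a₂ - a₁ by ring,
    show a₁ - 1 / 2 * N * η - (a₂ - 1 / 2 * N * η) = a₁ - a₂ by ring,
    show a₁ - 1 / 2 * N * η + (a₂ - 1 / 2 * N * η) = a₁ + a₂ - N * η by ring]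
  have hk : ((-1 : ℂ) ^ k) * (-1) ^ k = 1 := by rw [← mul_pow]; simp
  have hd : ∀ A Z : ℂ, A / ((-1) ^ k * Z) = (-1) ^ k * (A / Z) := fun A Z => by
    rw [← div_div, div_eq_mul_inv _ ((-1 : ℂ) ^ k), ← eq_inv_of_mul_eq_one_left hk]
    ring
  rw [hd]
  generalize ∏ j ∈ Finset.range k, theta τ (2 * (j + 1) * η) = A
  generalize ∏ j ∈ Finset.range k, theta τ (2 * (N - j) * η) = Z
  generalize ∏ p ∈ Finset.range m, theta τ (a₁ - a₂ + 2 * (k - p) * η) = X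
  generalize ∏ p ∈ Finset.range k, theta τ (a₂ - a₁ + 2 * (m - p) * η) = Y
  generalize ∏ i ∈ Finset.range N, theta τ (a₁ + a₂ - N * η + 2 * i * η) = S
  generalize 2 * η * nome τ ^ (3 / 8 : ℂ) / (theta τ (2 * (N + 1) * η) * qPochInf τ ^ 3) = C
  linear_combination (C * exp (Real.pi * I * N * (τ - 1) / 2) * (A / Z) * Y * X * S) * (hk - hs)

theorem constGamma_eq {τ η : ℂ} (hη : η ≠ 0) {k N : ℕ} (hk : k ≤ N) (a₁ a₂ : ℂ) :
    constGamma τ η N k a₁ a₂ = gammaCancelled τ η N k a₁ a₂ := by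
  rw [constGamma, if_neg hη]
  split_ifs with h
  · exact (gammaCancelled_eq τ η N k hk a₁ a₂ h).symm
  · rfl

/-! ### The limit η → 0. -/

open Filter Topology

theorem continuous_torusInt {t : ℝ} {K : ℝ → ℝ → ℝ → ℂ}
    (hK : Continuous fun p : ℝ × ℝ × ℝ => K p.1 p.2.1 p.2.2) :
    Continuous fun r => torusInt t (K r) := by
  unfold torusInt
  have h1 : Continuous (Function.uncurry fun (p : ℝ × ℝ) x => K p.1 x p.2) := by
    refine hK.comp (f := fun q : (ℝ × ℝ) × ℝ => (q.1.1, q.2, q.1.2)) ?_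
    fun_prop
  have h2 : Continuous (Function.uncurry fun (r : ℝ) y => ∫ x in (0 : ℝ)..1, K r x y) :=
    intervalIntegral.continuous_parametric_intervalIntegral_of_continuous' h1 0 1
  exact intervalIntegral.continuous_parametric_intervalIntegral_of_continuous' h2 0 t

theorem continuous_pairing {τ : ℂ} (hτ : τ.re = 0) (hτ' : 0 < τ.im) {N k m P Q : ℕ} {h : ℝ → ℂ}
    (hc : Continuous h) (hre : ∀ r, ((N : ℝ) + 1) * |(h r).re| < 1 / 2)
    (him : ∀ r, ((N : ℝ) + 1) * |(h r).im| < τ.im / 2) (a₁ a₂ : ℂ) :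
    Continuous fun r => pairing τ (h r) N
      (thetaStr τ (h r) k (a₁ - 1 / 2 * N * h r) * thetaStr τ (h r) m (a₂ - 1 / 2 * N * h r))
      (dualStr τ (h r) N P Q (a₁ - 1 / 2 * N * h r) (a₂ - 1 / 2 * N * h r)) := by
  have h1 := (differentiable_theta hτ').continuous
  have h2 := (differentiable_evenTheta hτ').continuous
  unfold pairing
  refine continuous_torusInt (K := fun r x y => pairKer τ (h r) N
      (thetaStr τ (h r) k (a₁ - 1 / 2 * N * h r) * thetaStr τ (h r) m (a₂ - 1 / 2 * N * h r))
      (dualStr τ (h r) N P Q (a₁ - 1 / 2 * N * h r) (a₂ - 1 / 2 * N * h r))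
      (x + I * y) (x - I * y)) ?_
  unfold pairKer
  refine Continuous.div ?_ ?_
    fun p => gridProd_mul_gridProd_ne_zero hτ hτ' (hre _) (him _) _ _
  · simp only [Pi.mul_apply, dualStr, thetaStr, thetaFac, evenStr]
    fun_prop
  · simp only [gridProd]
    fun_prop

theorem tendsto_inv_mul_theta {τ : ℂ} (hτ' : 0 < τ.im) (c : ℂ) :
    Tendsto (fun η => η⁻¹ * theta τ (2 * c * η)) (𝓝[≠] 0) (𝓝 (2 * c * deriv (theta τ) 0)) := by
  have h : HasDerivAt (fun η => theta τ (2 * c * η)) (deriv (theta τ) 0 * (2 * c * 1)) 0 := by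
    have h1 : HasDerivAt (theta τ) (deriv (theta τ) 0) (2 * c * (0 : ℂ)) := by
      rw [mul_zero]
      exact (differentiable_theta hτ' 0).hasDerivAt
    exact h1.comp 0 ((hasDerivAt_id' (0 : ℂ)).const_mul (2 * c))
  have h2 := hasDerivAt_iff_tendsto_slope_zero.1 h
  simp only [zero_add, mul_zero, theta_zero, sub_zero, smul_eq_mul] at h2
  convert h2 using 2
  ring

theorem deriv_theta_zero_ne_zero {τ : ℂ} (hτ : τ.re = 0) (hτ' : 0 < τ.im) :
    deriv (theta τ) 0 ≠ 0 := by
  rw [deriv_theta_zero hτ hτ']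
  exact mul_ne_zero (mul_ne_zero (mul_ne_zero two_ne_zero (by exact_mod_cast Real.pi_ne_zero))
    (exp_ne_zero _)) (pow_ne_zero _ (qPochInf_ne_zero hτ'))

theorem tendsto_theta_div_theta {τ : ℂ} (hτ : τ.re = 0) (hτ' : 0 < τ.im) (c : ℂ) {d : ℂ}
    (hd : d ≠ 0) :
    Tendsto (fun η => theta τ (2 * c * η) / theta τ (2 * d * η)) (𝓝[≠] 0) (𝓝 (c / d)) := by
  have h0 := deriv_theta_zero_ne_zero hτ hτ'
  have h := (tendsto_inv_mul_theta hτ' c).div (tendsto_inv_mul_theta hτ' d)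
    (mul_ne_zero (mul_ne_zero two_ne_zero hd) h0)
  rw [show 2 * c * deriv (theta τ) 0 / (2 * d * deriv (theta τ) 0) = c / d by field_simp] at h
  refine h.congr' ?_
  filter_upwards [self_mem_nhdsWithin] with η hη
  exact mul_div_mul_left _ _ (inv_ne_zero hη)

theorem prod_range_succ_div_sub {k N : ℕ} (hk : k ≤ N) :
    ∏ j ∈ Finset.range k, ((j + 1 : ℂ) / (N - j)) = 1 / (N.choose k : ℂ) := by
  induction k with
  | zero => simp
  | succ k ih =>
    have h1 := congrArg (Nat.cast (R := ℂ)) (Nat.choose_succ_right_eq N k)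
    have h2 : ((N - k : ℕ) : ℂ) ≠ 0 := Nat.cast_ne_zero.2 (by omega)
    have h3 : (N.choose k : ℂ) ≠ 0 := Nat.cast_ne_zero.2 (Nat.choose_pos (by omega)).ne'
    have h4 : (N.choose (k + 1) : ℂ) ≠ 0 := Nat.cast_ne_zero.2 (Nat.choose_pos hk).ne'
    rw [Finset.prod_range_succ, ih (by omega), ← Nat.cast_sub (by omega)]
    push_cast [Nat.cast_sub (show k ≤ N by omega)] at h1 h2 ⊢
    field_simp
    linear_combination h1

theorem tendsto_diagFormula {τ : ℂ} (hτ : τ.re = 0) (hτ' : 0 < τ.im) {k m N : ℕ}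
    (hkm : k + m = N) (a₁ a₂ : ℂ) :
    Tendsto (fun η => (-1) ^ N * exp (Real.pi * I * N * (τ - 1) / 2) *
        diagFormula τ η N k m (a₁ - 1 / 2 * N * η) (a₂ - 1 / 2 * N * η)) (𝓝[≠] 0)
      (𝓝 (constC τ 0 N * constGamma τ 0 N k a₁ a₂)) := by
  have hT := (differentiable_theta hτ').continuous
  have hq := qPochInf_ne_zero hτ'
  have hN : (N + 1 : ℂ) ≠ 0 := by exact_mod_cast Nat.succ_ne_zero N
  have hpi : (Real.pi : ℂ) ≠ 0 := by exact_mod_cast Real.pi_ne_zero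
  have hE := exp_ne_zero (Real.pi * I * τ / 4)
  have hd0 := deriv_theta_zero_ne_zero hτ hτ'
  have t1 : Tendsto (fun η => 2 * η * nome τ ^ (3 / 8 : ℂ) /
      (theta τ (2 * (N + 1) * η) * qPochInf τ ^ 3)) (𝓝[≠] 0) (𝓝 (constC τ 0 N)) := by
    have h := (tendsto_inv_mul_theta hτ' (N + 1)).inv₀
      (mul_ne_zero (mul_ne_zero two_ne_zero hN) hd0)
    have h2 := h.const_mul (2 * nome τ ^ (3 / 8 : ℂ) / qPochInf τ ^ 3)
    convert h2 using 2 with η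
    · rw [mul_inv, inv_inv]
      ring
    · rw [constC, if_pos rfl, deriv_theta_zero hτ hτ', nome_cpow hτ, nome_cpow hτ]
      -- The surplus p^{1/8} = e^{πiτ/4} cancels against the same factor in θ'(0), which leaves
      -- p^{1/4}.
      have e : exp (2 * Real.pi * I * τ * (3 / 8)) =
          exp (2 * Real.pi * I * τ * (1 / 4)) * exp (Real.pi * I * τ / 4) := by
        rw [← exp_add]
        ring_nf
      rw [e]
      field_simp
  have t2 : Tendsto (fun η => ∏ j ∈ Finset.range k,
      theta τ (2 * (j + 1) * η) / theta τ (2 * (N - j) * η)) (𝓝[≠] 0)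
      (𝓝 (1 / (N.choose k : ℂ))) := by
    rw [← prod_range_succ_div_sub (show k ≤ N by omega)]
    refine tendsto_finsetProd _ fun j hj => tendsto_theta_div_theta hτ hτ' _ ?_
    have hj := Finset.mem_range.1 hj
    have : ((N - j : ℕ) : ℂ) ≠ 0 := Nat.cast_ne_zero.2 (by omega)
    rwa [Nat.cast_sub (by omega)] at this
  have t3 : Tendsto (fun η => ((∏ p ∈ Finset.range k,
      theta τ (a₂ - 1 / 2 * N * η - (a₁ - 1 / 2 * N * η) + 2 * (m - p) * η)) *
      ∏ p ∈ Finset.range m,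
        theta τ (a₁ - 1 / 2 * N * η - (a₂ - 1 / 2 * N * η) + 2 * (k - p) * η)) *
      ∏ i ∈ Finset.range N,
        theta τ (a₁ - 1 / 2 * N * η + (a₂ - 1 / 2 * N * η) + 2 * i * η)) (𝓝[≠] 0)
      (𝓝 ((-1) ^ k * theta τ (a₁ - a₂) ^ N * theta τ (a₁ + a₂) ^ N)) := by
    refine Tendsto.mono_left ?_ nhdsWithin_le_nhds
    refine Continuous.tendsto' (by fun_prop) _ _ ?_
    simp only [mul_zero, sub_zero, add_zero, Finset.prod_const, Finset.card_range]
    rw [← neg_sub a₁ a₂, theta_neg, neg_pow, mul_assoc ((-1) ^ k), ← pow_add, hkm]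
  have t := ((t1.mul t2).mul t3).const_mul (exp (Real.pi * I * N * (τ - 1) / 2))
  have hs : ((-1 : ℂ) ^ N) * (-1) ^ N = 1 := by rw [← mul_pow]; simp
  convert t using 2 with η
  · rw [diagFormula]
    generalize (∏ i ∈ Finset.range N,
        theta τ (a₁ - 1 / 2 * N * η + (a₂ - 1 / 2 * N * η) + 2 * i * η)) = S
    generalize (∏ j ∈ Finset.range k,
      theta τ (2 * (j + 1) * η) / theta τ (2 * (N - j) * η)) = A
    generalize 2 * η * nome τ ^ (3 / 8 : ℂ) / (theta τ (2 * (N + 1) * η) * qPochInf τ ^ 3) = C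
    generalize (∏ p ∈ Finset.range k,
      theta τ (a₂ - 1 / 2 * N * η - (a₁ - 1 / 2 * N * η) + 2 * (m - p) * η)) *
      ∏ p ∈ Finset.range m,
        theta τ (a₁ - 1 / 2 * N * η - (a₂ - 1 / 2 * N * η) + 2 * (k - p) * η) = Y
    linear_combination (exp (Real.pi * I * N * (τ - 1) / 2) * C * A * Y * S) * hs
  · rw [constGamma, if_pos rfl]
    ring

/-- The pairing is continuous along a path into η = 0, so its value there is the limit of the
right-hand side, for which only a limit and no value at 0 is required. -/
theorem pairing_eq_of_tendsto {τ : ℂ} (hτ : τ.re = 0) (hτ' : 0 < τ.im) {N k m P Q : ℕ} {a₁ a₂ : ℂ}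
    {R : ℂ → ℂ} {r c : ℂ} (hR : Tendsto R (𝓝[≠] 0) (𝓝 r))
    (h : ∀ η : ℂ, η ≠ 0 → ((N : ℝ) + 1) * |η.re| < 1 / 2 → ((N : ℝ) + 1) * |η.im| < τ.im / 2 →
      c * pairing τ η N
        (thetaStr τ η k (a₁ - 1 / 2 * N * η) * thetaStr τ η m (a₂ - 1 / 2 * N * η))
        (dualStr τ η N P Q (a₁ - 1 / 2 * N * η) (a₂ - 1 / 2 * N * η)) = R η) :
    c * pairing τ 0 N
      (thetaStr τ 0 k (a₁ - 1 / 2 * N * 0) * thetaStr τ 0 m (a₂ - 1 / 2 * N * 0))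
      (dualStr τ 0 N P Q (a₁ - 1 / 2 * N * 0) (a₂ - 1 / 2 * N * 0)) = r := by
  set δ : ℝ := 1 / (4 * (N + 1)) with hδ
  have hδ0 : 0 < δ := by positivity
  -- A path through 0 staying in the admissible range for every real time, since (N+1)δ = 1/4;
  -- boundedness of the sine makes the integrand continuous for all parameters. The nonzero
  -- derivative at 0 keeps the path away from η = 0 at nearby times.
  set h' : ℝ → ℂ := fun t => ((δ * Real.sin t : ℝ) : ℂ) with hh'
  have h0 : h' 0 = 0 := by simp [hh']
  have hc : Continuous h' := by fun_prop
  have hre : ∀ t, ((N : ℝ) + 1) * |(h' t).re| < 1 / 2 := fun t => by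
    have h1 := Real.abs_sin_le_one t
    have h2 : ((N : ℝ) + 1) * δ = 1 / 4 := by
      rw [hδ]
      field_simp
    rw [hh']
    dsimp only
    rw [ofReal_re, abs_mul, abs_of_pos hδ0]
    nlinarith
  have him : ∀ t, ((N : ℝ) + 1) * |(h' t).im| < τ.im / 2 := fun t => by
    rw [hh']
    dsimp only
    rw [ofReal_im]
    simpa using hτ'
  have hne : Tendsto h' (𝓝[≠] 0) (𝓝[≠] 0) := by
    have hd : HasDerivAt h' ((δ * Real.cos 0 : ℝ) : ℂ) 0 :=
      ((Real.hasDerivAt_sin 0).const_mul δ).ofReal_comp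
    have := hd.tendsto_nhdsNE (by simp [hδ0.ne'])
    rwa [h0] at this
  have l1 := (((continuous_pairing hτ hτ' (k := k) (m := m) (P := P) (Q := Q) hc hre him a₁ a₂).tendsto
    0).const_mul c).mono_left (nhdsWithin_le_nhds (s := {0}ᶜ))
  rw [h0] at l1
  refine tendsto_nhds_unique l1 ((hR.comp hne).congr' ?_)
  filter_upwards [hne self_mem_nhdsWithin] with t ht
  exact (h _ ht (hre t) (him t)).symm

theorem pairing_dualStr {τ : ℂ} (hτ : τ.re = 0) (hτ' : 0 < τ.im) {η : ℂ} {N k l : ℕ}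
    (hre : ((N : ℝ) + 1) * |η.re| < 1 / 2) (him : ((N : ℝ) + 1) * |η.im| < τ.im / 2)
    (hk : k ≤ N) (hl : l ≤ N) (a₁ a₂ : ℂ) :
    ((-1) ^ N * exp (Real.pi * I * N * (τ - 1) / 2)) * pairing τ η N
      (thetaStr τ η k (a₁ - 1 / 2 * N * η) * thetaStr τ η (N - k) (a₂ - 1 / 2 * N * η))
      (dualStr τ η N (N - l) l (a₁ - 1 / 2 * N * η) (a₂ - 1 / 2 * N * η)) =
    if k = l then constC τ η N * constGamma τ η N k a₁ a₂ else 0 := by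
  split_ifs with hkl
  · subst hkl
    rcases eq_or_ne η 0 with rfl | hη
    · refine pairing_eq_of_tendsto hτ hτ' (tendsto_diagFormula hτ hτ'
        (Nat.add_sub_cancel' hk) a₁ a₂) fun η hη hre him => ?_
      rw [pairing_dualStr_eq hτ hτ' hη hre him (Nat.add_sub_cancel' hk)]
    · rw [constGamma_eq hη hk, constC_mul_gammaCancelled hη (Nat.add_sub_cancel' hk),
        pairing_dualStr_eq hτ hτ' hη hre him (Nat.add_sub_cancel' hk)]
  · have off : ∀ η : ℂ, η ≠ 0 → ((N : ℝ) + 1) * |η.re| < 1 / 2 →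
        ((N : ℝ) + 1) * |η.im| < τ.im / 2 →
      ((-1) ^ N * exp (Real.pi * I * N * (τ - 1) / 2)) * pairing τ η N
        (thetaStr τ η k (a₁ - 1 / 2 * N * η) * thetaStr τ η (N - k) (a₂ - 1 / 2 * N * η))
        (dualStr τ η N (N - l) l (a₁ - 1 / 2 * N * η) (a₂ - 1 / 2 * N * η)) = 0 :=
      fun η hη hre him => by
        rw [pairing_dualStr_eq_zero hτ hτ' hη hre him (Nat.add_sub_cancel' hk)
          (Nat.sub_add_cancel hl) hkl, mul_zero]
    rcases eq_or_ne η 0 with rfl | hη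
    · exact pairing_eq_of_tendsto hτ hτ' tendsto_const_nhds off
    · exact off η hη hre him

/-! ### Non-vanishing of the constants. -/

theorem evenTheta_zero_ne_zero {τ : ℂ} (hτ : τ.re = 0) (hτ' : 0 < τ.im) : evenTheta τ 0 ≠ 0 :=
  evenTheta_ne_zero_of_im hτ hτ' (by simpa using hτ')

/-- Θ_N has no base point: powers of T(c+x)T(c−x) do not vanish at a given x for suitable c, as two
entire functions of c with zero product cannot both be nonzero functions. -/
theorem exists_mem_ThetaSpace_ne_zero {τ : ℂ} (hτ : τ.re = 0) (hτ' : 0 < τ.im) (N : ℕ) (x : ℂ) :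
    ∃ F ∈ ThetaSpace τ N, F x ≠ 0 := by
  have hT := differentiable_evenTheta hτ'
  obtain ⟨c, hc⟩ : ∃ c, evenTheta τ (c + x) * evenTheta τ (c - x) ≠ 0 := by
    by_contra! h
    have hf : AnalyticOnNhd ℂ (fun c => evenTheta τ (c + x)) Set.univ :=
      fun z _ => (hT.comp (differentiable_id.add_const x)).analyticAt z
    have hg : AnalyticOnNhd ℂ (fun c => evenTheta τ (c - x)) Set.univ :=
      fun z _ => (hT.comp (differentiable_id.sub_const x)).analyticAt z
    rcases hf.eq_zero_or_eq_zero_of_mul_eq_zero hg (fun z _ => h z) isPreconnected_univ with h | h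
    · exact evenTheta_zero_ne_zero hτ hτ' (by simpa using h (-x) trivial)
    · exact evenTheta_zero_ne_zero hτ hτ' (by simpa using h x trivial)
  refine ⟨evenStr τ 0 N c, evenStr_mem hτ' 0 N c, Finset.prod_ne_zero_iff.2 fun j _ => ?_⟩
  simpa using hc

theorem exists_ne_zero_of_span {τ : ℂ} (hτ : τ.re = 0) (hτ' : 0 < τ.im) {N : ℕ} {ι : Type*}
    {e : ι → ℂ → ℂ} (he : Submodule.span ℂ (Set.range e) = ThetaSpace τ N) (x : ℂ) :
    ∃ k, e k x ≠ 0 := by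
  by_contra! h
  obtain ⟨F, hF, hx⟩ := exists_mem_ThetaSpace_ne_zero hτ hτ' N x
  have hle : Submodule.span ℂ (Set.range e) ≤ LinearMap.ker
      (LinearMap.proj (R := ℂ) (φ := fun _ : ℂ => ℂ) x) := by
    rw [Submodule.span_le]
    rintro _ ⟨k, rfl⟩
    exact h k
  exact hx (hle (he ▸ hF))

theorem thetaFac_eq_zero {τ η z : ℂ} {k j : ℕ} (hj : j < k) (h : theta τ (z + 2 * j * η) = 0) :
    thetaFac τ η k z = 0 :=
  Finset.prod_eq_zero (Finset.mem_range.2 hj) h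

theorem thetaStr_self {τ η a : ℂ} {k : ℕ} (hk : 0 < k) : thetaStr τ η k a a = 0 := by
  rw [thetaStr, thetaFac_eq_zero (z := a - a) hk (by simp [theta_zero]), mul_zero]

/-- If θ(a ± b + 2rη) = 0, every product vanishes at the point b: for k > r through its a-string,
for k ≤ r through the factor θ(b−b). A spanning family has no common zero. The third case is the
same at the point a. -/
theorem theta_ne_zero_of_span {τ η : ℂ} (hτ : τ.re = 0) (hτ' : 0 < τ.im) {N : ℕ} {a b : ℂ}
    (h : Submodule.span ℂ (Set.range fun k : Fin (N + 1) =>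
      thetaStr τ η k a * thetaStr τ η (N - k) b) = ThetaSpace τ N) {r : ℕ} (hr : r < N) :
    theta τ (a + b + 2 * r * η) ≠ 0 ∧ theta τ (a - b + 2 * r * η) ≠ 0 ∧
      theta τ (b - a + 2 * r * η) ≠ 0 := by
  refine ⟨fun h0 => ?_, fun h0 => ?_, fun h0 => ?_⟩
  · obtain ⟨k, hk⟩ := exists_ne_zero_of_span hτ hτ' h b
    apply hk
    rw [Pi.mul_apply]
    rcases lt_or_ge r k with hrk | hrk
    · rw [thetaStr, thetaFac_eq_zero hrk h0, zero_mul, zero_mul]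
    · rw [thetaStr_self (show 0 < N - (k : ℕ) by omega), mul_zero]
  · obtain ⟨k, hk⟩ := exists_ne_zero_of_span hτ hτ' h b
    apply hk
    rw [Pi.mul_apply]
    rcases lt_or_ge r k with hrk | hrk
    · rw [thetaStr, thetaFac_eq_zero hrk h0, mul_zero, zero_mul]
    · rw [thetaStr_self (show 0 < N - (k : ℕ) by omega), mul_zero]
  · obtain ⟨k, hk⟩ := exists_ne_zero_of_span hτ hτ' h a
    apply hk
    rw [Pi.mul_apply]
    rcases lt_or_ge r (N - (k : ℕ)) with hrk | hrk
    · rw [thetaStr, thetaStr, thetaFac_eq_zero hrk h0, mul_zero, mul_zero]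
    · rw [thetaStr_self (show 0 < (k : ℕ) by omega), zero_mul]

theorem theta_sub_add_int_ne_zero {τ η : ℂ} (hτ : τ.re = 0) (hτ' : 0 < τ.im) {N : ℕ} {a b : ℂ}
    (h : Submodule.span ℂ (Set.range fun k : Fin (N + 1) =>
      thetaStr τ η k a * thetaStr τ η (N - k) b) = ThetaSpace τ N) {r : ℤ} (hr : |r| < N) :
    theta τ (a - b + 2 * r * η) ≠ 0 := by
  obtain ⟨n, rfl | rfl⟩ := Int.eq_nat_or_neg r
  · exact_mod_cast (theta_ne_zero_of_span hτ hτ' h (r := n) (by simpa using hr)).2.1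
  · have := (theta_ne_zero_of_span hτ hτ' h (r := n) (by simpa using hr)).2.2
    rw [← neg_ne_zero, ← theta_neg]
    push_cast
    convert this using 2
    ring

theorem diagFormula_ne_zero {τ η : ℂ} (hτ : τ.re = 0) (hτ' : 0 < τ.im) (hη : η ≠ 0) {k m N : ℕ}
    (hre : ((N : ℝ) + 1) * |η.re| < 1 / 2) (him : ((N : ℝ) + 1) * |η.im| < τ.im / 2)
    (hkm : k + m = N) {a b : ℂ} (h : Submodule.span ℂ (Set.range fun k : Fin (N + 1) =>
      thetaStr τ η k a * thetaStr τ η (N - k) b) = ThetaSpace τ N) :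
    diagFormula τ η N k m a b ≠ 0 := by
  have hnat : ∀ j : ℕ, 0 < j → j ≤ N + 1 → theta τ (2 * j * η) ≠ 0 :=
    fun j => theta_natCast_mul_ne_zero hτ hτ' hη hre him
  refine mul_ne_zero (mul_ne_zero (mul_ne_zero (mul_ne_zero (by simp) (div_ne_zero
    (mul_ne_zero (mul_ne_zero two_ne_zero hη) ?_) (mul_ne_zero ?_ (pow_ne_zero _
    (qPochInf_ne_zero hτ'))))) (Finset.prod_ne_zero_iff.2 fun j hj => div_ne_zero ?_ ?_))
    (mul_ne_zero (Finset.prod_ne_zero_iff.2 fun p hp => ?_)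
    (Finset.prod_ne_zero_iff.2 fun p hp => ?_))) (Finset.prod_ne_zero_iff.2 fun i hi => ?_)
  · rw [nome_cpow hτ]
    exact exp_ne_zero _
  · exact_mod_cast hnat (N + 1) (by omega) le_rfl
  · have hj := Finset.mem_range.1 hj
    exact_mod_cast hnat (j + 1) (by omega) (by omega)
  · have hj := Finset.mem_range.1 hj
    have := hnat (N - j) (by omega) (by omega)
    rwa [Nat.cast_sub (by omega)] at this
  · have hp := Finset.mem_range.1 hp
    have := theta_sub_add_int_ne_zero hτ hτ' h (r := p - m) (by rw [abs_lt]; omega)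
    rw [← neg_ne_zero, ← theta_neg]
    push_cast at this
    convert this using 2
    ring
  · have hp := Finset.mem_range.1 hp
    exact_mod_cast theta_sub_add_int_ne_zero hτ hτ' h (r := k - p) (by rw [abs_lt]; omega)
  · exact (theta_ne_zero_of_span hτ hτ' h (Finset.mem_range.1 hi)).1

theorem constC_mul_constGamma_ne_zero {τ η : ℂ} (hτ : τ.re = 0) (hτ' : 0 < τ.im) {k N : ℕ}
    (hre : ((N : ℝ) + 1) * |η.re| < 1 / 2) (him : ((N : ℝ) + 1) * |η.im| < τ.im / 2)
    (hk : k ≤ N) {a₁ a₂ : ℂ} (h : Submodule.span ℂ (Set.range fun k : Fin (N + 1) =>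
      thetaStr τ η k (a₁ - 1 / 2 * N * η) * thetaStr τ η (N - k) (a₂ - 1 / 2 * N * η)) =
      ThetaSpace τ N) :
    constC τ η N * constGamma τ η N k a₁ a₂ ≠ 0 := by
  rcases eq_or_ne η 0 with rfl | hη
  · have hq := qPochInf_ne_zero hτ'
    have hN : (N + 1 : ℂ) ≠ 0 := by exact_mod_cast Nat.succ_ne_zero N
    have hpi : (Real.pi : ℂ) ≠ 0 := by exact_mod_cast Real.pi_ne_zero
    have hp : ∀ x : ℂ, (0 < N → x ≠ 0) → x ^ N ≠ 0 := fun x hx => by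
      rcases Nat.eq_zero_or_pos N with h | h
      · simp [h]
      · exact pow_ne_zero _ (hx h)
    rw [constC, constGamma, if_pos rfl, if_pos rfl, nome_cpow hτ]
    refine mul_ne_zero (div_ne_zero (exp_ne_zero _) (mul_ne_zero (mul_ne_zero (mul_ne_zero
      two_ne_zero hpi) hN) (pow_ne_zero _ hq))) (mul_ne_zero (mul_ne_zero (mul_ne_zero
      (exp_ne_zero _) (div_ne_zero (by simp) (Nat.cast_ne_zero.2 (Nat.choose_pos hk).ne')))
      (hp _ fun hN => ?_)) (hp _ fun hN => ?_))
    · simpa using (theta_ne_zero_of_span hτ hτ' h hN).1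
    · simpa using (theta_ne_zero_of_span hτ hτ' h hN).2.1
  · rw [constGamma_eq hη hk, constC_mul_gammaCancelled hη (Nat.add_sub_cancel' hk)]
    exact mul_ne_zero (mul_ne_zero (by simp) (exp_ne_zero _))
      (diagFormula_ne_zero hτ hτ' hη hre him (Nat.add_sub_cancel' hk) h)

/-! ### Biorthogonality and the theorem. -/

theorem isBasisOf_of_linearIndependent {n : ℕ} {V : Submodule ℂ (ℂ → ℂ)} {e f : Fin n → ℂ → ℂ}
    (he : IsBasisOf V e) (hf : LinearIndependent ℂ f) (hfV : ∀ k, f k ∈ V) : IsBasisOf V f := by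
  refine ⟨hf, ?_⟩
  obtain ⟨he, rfl⟩ := he
  have : FiniteDimensional ℂ (Submodule.span ℂ (Set.range e)) :=
    FiniteDimensional.span_of_finite ℂ (Set.finite_range e)
  refine Submodule.eq_of_le_of_finrank_eq ?_ ?_
  · rw [Submodule.span_le]
    rintro _ ⟨k, rfl⟩
    exact hfV k
  · rw [finrank_span_eq_card hf, finrank_span_eq_card he]

theorem pairing_smul_right (τ η : ℂ) (N : ℕ) (r : ℂ) (F G : ℂ → ℂ) :
    pairing τ η N F (r • G) = r * pairing τ η N F G := by
  rw [pairing, pairing, ← torusInt_const_mul]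
  refine torusInt_congr fun x y => ?_
  simp only [pairKer, Pi.smul_apply, smul_eq_mul]
  ring

theorem metric_sum_right {τ η : ℂ} {N n : ℕ} {g : ℂ → ℂ} {f : Fin n → ℂ → ℂ}
    (hf : ∀ l, MeasureTheory.IntegrableOn (metricIntegrand τ η N g (f l)) (fundRect τ))
    (c : Fin n → ℂ) :
    metric τ η N g (∑ l, c l • f l) = ∑ l, (starRingEnd ℂ) (c l) * metric τ η N g (f l) := by
  simp only [metric, ← MeasureTheory.integral_const_mul]
  rw [← MeasureTheory.integral_finsetSum _ fun l _ => (hf l).const_mul _]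
  refine MeasureTheory.integral_congr_ae (Filter.Eventually.of_forall fun u => ?_)
  simp only [metricIntegrand, Finset.sum_apply, Pi.smul_apply, smul_eq_mul, map_sum, map_mul,
    Finset.mul_sum, Finset.sum_mul]
  refine Finset.sum_congr rfl fun l _ => ?_
  ring

/-- Pairing a vanishing combination of the f_l with e_k isolates the conjugate of the k-th
coefficient. Integrability is what allows the finite sum to leave the integral. -/
theorem linearIndependent_of_metric {τ η : ℂ} {N n : ℕ} {e f : Fin n → ℂ → ℂ} {D : Fin n → ℂ}
    (hint : ∀ k l, MeasureTheory.IntegrableOn (metricIntegrand τ η N (e k) (f l)) (fundRect τ))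
    (hD : ∀ k, D k ≠ 0) (hm : ∀ k l, metric τ η N (e k) (f l) = if k = l then D k else 0) :
    LinearIndependent ℂ f := by
  rw [Fintype.linearIndependent_iff]
  intro c hc k
  have h := metric_sum_right (hint k) c
  rw [hc] at h
  simp only [hm, mul_ite, mul_zero, Finset.sum_ite_eq, Finset.mem_univ, if_true] at h
  have h0 : metric τ η N (e k) 0 = 0 := by simp [metric, metricIntegrand]
  rw [h0] at h
  simpa [hD k] using h.symm

theorem mul_abs_lt_of_mem_range {τ η s : ℂ} (hτ' : 0 < τ.im) {N : ℕ}
    (hη : (s = -1 ∧ η ∈ RealRange N) ∨ (s = 1 ∧ η ∈ ImagRange τ N)) :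
    ((N : ℝ) + 1) * |η.re| < 1 / 2 ∧ ((N : ℝ) + 1) * |η.im| < τ.im / 2 := by
  rcases hη with ⟨-, h0, h⟩ | ⟨-, h0, h⟩
  · rw [h0, abs_zero, mul_zero]
    refine ⟨?_, by linarith⟩
    rw [lt_div_iff₀ (by positivity)] at h
    have := abs_re_le_norm η
    nlinarith [(Nat.cast_nonneg N : (0 : ℝ) ≤ N)]
  · rw [h0, abs_zero, mul_zero]
    refine ⟨by norm_num, ?_⟩
    rw [lt_div_iff₀ (by positivity)] at h
    have := abs_im_le_norm η
    nlinarith [(Nat.cast_nonneg N : (0 : ℝ) ≤ N)]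

/-- This relation is the common form of the real and imaginary cases, and lets both be conjugated in
one computation. -/
theorem mul_conj_eq_neg_of_mem_range {τ η s : ℂ} {N : ℕ}
    (hη : (s = -1 ∧ η ∈ RealRange N) ∨ (s = 1 ∧ η ∈ ImagRange τ N)) :
    s * (starRingEnd ℂ) η = -η := by
  rcases hη with ⟨rfl, h0, -⟩ | ⟨rfl, h0, -⟩ <;> apply Complex.ext <;> simp [h0]

end SklyaninTheta

open SklyaninTheta in
theorem theorem3p3 (τ : ℂ) (hτre : τ.re = 0) (hτim : 0 < τ.im) (N : ℕ)
    (η : ℂ) (s : ℂ)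
    (hη : (s = -1 ∧ η ∈ SklyaninTheta.RealRange N) ∨
      (s = 1 ∧ η ∈ SklyaninTheta.ImagRange τ N))
    (a₁ a₂ : ℂ) (e f : Fin (N + 1) → ℂ → ℂ)
    (he : ∀ k, e k = SklyaninTheta.eFun τ η N k (a₁ - 1 / 2 * N * η) (a₂ - 1 / 2 * N * η))
    (hf : ∀ k, f k = SklyaninTheta.sigma τ N (SklyaninTheta.eFun τ η N k
      (s * (starRingEnd ℂ) a₂ - 1 / 2 * N * η + η)
      (s * (starRingEnd ℂ) a₁ - 1 / 2 * N * η + η)))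
    (hbasis : SklyaninTheta.IsBasisOf (SklyaninTheta.ThetaSpace τ N) e) :
    SklyaninTheta.IsBasisOf (SklyaninTheta.ThetaSpace τ N) f ∧
    (∀ k l : Fin (N + 1), MeasureTheory.IntegrableOn (SklyaninTheta.metricIntegrand τ η N (e k) (f l))
      (SklyaninTheta.fundRect τ)) ∧
    (∀ k : Fin (N + 1), SklyaninTheta.constC τ η N * SklyaninTheta.constGamma τ η N k a₁ a₂ ≠ 0) ∧
    (∀ k l : Fin (N + 1), SklyaninTheta.metric τ η N (e k) (f l) =
      if k = l then SklyaninTheta.constC τ η N * SklyaninTheta.constGamma τ η N k a₁ a₂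
      else 0) := by
  obtain ⟨hre, him⟩ := mul_abs_lt_of_mem_range hτim hη
  have hs : s = -1 ∨ s = 1 := hη.imp And.left And.left
  have hconj := mul_conj_eq_neg_of_mem_range hη
  have hk : ∀ k : Fin (N + 1), (k : ℕ) ≤ N := fun k => Nat.lt_succ_iff.1 k.2
  -- The conjugate of f_l is an entire function of the conjugate variable, so the metric becomes the
  -- bilinear form with this function in the second slot.
  have hfc : ∀ l x, (starRingEnd ℂ) (f l x) =
      (((-1) ^ N * exp (Real.pi * I * N * (τ - 1) / 2)) •
        dualStr τ η N (N - l) l (a₁ - 1 / 2 * N * η) (a₂ - 1 / 2 * N * η)) ((starRingEnd ℂ) x) :=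
    fun l x => by rw [hf, conj_sigma_eFun hτre hs hconj (hk l)]; rfl
  have hec : ∀ k, Continuous (e k) := fun k => by
    rw [he, eFun_eq]
    exact (thetaStr_mul_mem hτim (Nat.add_sub_cancel' (hk k)) _ _).1.continuous
  have hdc : ∀ l : Fin (N + 1), Continuous (((-1) ^ N * exp (Real.pi * I * N * (τ - 1) / 2)) •
      dualStr τ η N (N - l) l (a₁ - 1 / 2 * N * η) (a₂ - 1 / 2 * N * η)) := fun l =>
    (dualStr_mem hτim (Nat.sub_add_cancel (hk l)) _ _).1.continuous.const_smul _
  have hint := fun k l => integrableOn_metricIntegrand hτre hτim hre him (hec k) (hdc l) (hfc l)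
  have hmet : ∀ k l : Fin (N + 1), metric τ η N (e k) (f l) =
      if k = l then constC τ η N * constGamma τ η N k a₁ a₂ else 0 := fun k l => by
    have h := pairing_dualStr hτre hτim hre him (hk k) (hk l) a₁ a₂
    simp only [Fin.val_inj] at h
    rw [metric_eq_pairing hτre hτim hre him (hec k) (hdc l) (hfc l), ← h, he, eFun_eq]
    exact pairing_smul_right ..
  have hne : ∀ k : Fin (N + 1), constC τ η N * constGamma τ η N k a₁ a₂ ≠ 0 := fun k => by
    refine constC_mul_constGamma_ne_zero hτre hτim hre him (hk k) ?_
    rw [← hbasis.2]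
    congr 2
    funext k
    rw [he, eFun_eq]
  refine ⟨isBasisOf_of_linearIndependent hbasis (linearIndependent_of_metric hint hne hmet)
    fun l => ?_, hint, hne, hmet⟩
  rw [hf]
  exact sigma_eFun_mem hτim η (hk l) _ _
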